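/- Consider a finite collection $V$ of qudits of local dimension $q\ge 1$. For each qudit let $Z|j\rangle=e^{2\pi i j/q}|j\rangle$ and $X|j\rangle=|j+1 \bmod q\rangle$; a Pauli operator is a tensor product of operators $X^aZ^b$ over the qudits, times a phase. A stabilizer group is a commuting group of Pauli operators whose only scalar element is $I$; its code is the space of vectors fixed by all its elements. A stabilizer projection state is $P/\operatorname{Tr}P$, where $P$ is the orthogonal projector onto the code of a stabilizer group; a pure stabilizer state is $|\psi\rangle\langle\psi|$ with $\psi$ a unit vector spanning a one-dimensional code. Let $\mathcal S$ denote the set of convex mixtures of pure stabilizer states (for a subsystem $A_i$, write $\mathcal S_i$). A stabilizer measurement ($\mathcal M\in\mathrm{SM}$) is a finite POVM $\{M_x\}$ in which every element is proportional to a stabilizer projection state, and $\mathcal M(\rho)=\sum_x\operatorname{Tr}(M_x\rho)|x\rangle\langle x|$. With $\|A\|_1=\operatorname{Tr}\sqrt{A^\dagger A}$, $F(\rho,\sigma)=\|\sqrt\rho\sqrt\sigma\|_1$, and $S(\rho\|\sigma)=\operatorname{Tr}\rho\log\rho-\operatorname{Tr}\rho\log\sigma$ (natural logarithm; $+\infty$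 unless $\ker\sigma\subseteq\ker\rho$), put $$S(\rho\|\mathcal S)=\min_{\sigma\in\mathcal S}S(\rho\|\sigma),\quad S_{\rm SM}(\rho\|\sigma)=\max_{\mathcal M\in\mathrm{SM}}S(\mathcal M(\rho)\|\mathcal M(\sigma)),\quad S_{\rm SM}(\rho\|\mathcal S)=\min_{\tau\in\mathcal S}S_{\rm SM}(\rho\|\tau),$$ $$F(\rho,\mathcal S)=\max_{\sigma\in\mathcal S}F(\rho,\sigma),\quad F_{\rm SM}(\rho,\sigma)=\min_{\mathcal M\in\mathrm{SM}}F(\mathcal M(\rho),\mathcal M(\sigma)),\quad F_{\rm SM}(\rho,\mathcal S)=\max_{\tau\in\mathcal S}F_{\rm SM}(\rho,\tau),$$ $$\operatorname{LF}(\rho)=-\log\max_{\sigma\in\mathcal S}F(\rho,\sigma)^2.$$ Let $A_1,\dots,A_n\subseteq V$ be pairwise disjoint subsystems ($n\ge 0$). **(1)** For every state (density matrix) $\rho$ on $V$ with reduced states $\rho_i=\operatorname{Tr}_{V\setminus A_i}\rho$, $$S(\rho\|\mathcal S)\ \ge\ \sum_{i=1}^n S_{\rm SM}(\rho_i\|\mathcal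 S_i).$$ If moreover each $A_i$ has Hilbert space dimension $q^{|A_i|}\le D$ and, for some $\epsilon\ge 0$, $\|\rho_i-\tau\|_1\ge\epsilon$ for all $i$ and all $\tau\in\mathcal S_i$, then $$S(\rho\|\mathcal S)\ \ge\ \frac{n\epsilon^2}{2D^2}.$$ **(2)** If $A_1,\dots,A_n$ together cover $V$ and $\rho_i$ is a state on $A_i$ for each $i$, then $$F\Big(\bigotimes_i\rho_i,\mathcal S\Big)\ \le\ \prod_{i=1}^n F_{\rm SM}(\rho_i,\mathcal S_i).$$ If moreover each $A_i$ has Hilbert space dimension $q^{|A_i|}\le D$ and, for some $\epsilon\ge 0$, $\|\rho_i-\tau\|_1\ge\epsilon$ for all $i$ and all $\tau\in\mathcal S_i$, then $$\operatorname{LF}\Big(\bigotimes_i\rho_i\Big)\ \ge\ n\log\Big(1-\frac{\epsilon^2}{4D^2}\Big)^{-1}.$$ -/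

import Mathlib

noncomputable section

namespace Magic

/-- Square complex matrices with rows and columns indexed by `ι`. -/
abbrev Op (ι : Type*) := Matrix ι ι ℂ

section General

open scoped ComplexOrder

variable {ι : Type*} [Fintype ι] [DecidableEq ι]

/-- Density matrices: positive semidefinite with unit trace. -/
def IsState (ρ : Op ι) : Prop := ρ.PosSemidef ∧ ρ.trace = 1

/-- The trace norm `‖A‖₁ = Tr √(A† A)`. -/
def traceNorm (A : Op ι) : ℝ := (cfc Real.sqrt (A.conjTranspose * A)).trace.re

/-- The fidelity `F(ρ, σ) = ‖√ρ √σ‖₁` (not squared). -/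
def fidelity (ρ σ : Op ι) : ℝ := traceNorm (cfc Real.sqrt ρ * cfc Real.sqrt σ)

open Classical in
/-- Quantum relative entropy `S(ρ‖σ) = Tr (ρ log ρ) - Tr (ρ log σ)` (natural logarithm), equal to
`+∞` unless `ker σ ⊆ ker ρ`. The value `Real.log 0 = 0` implements `0 log 0 = 0` in the first term
and, when `ker σ ⊆ ker ρ`, restricts `log σ` to the support of `σ` in the second one. -/
def relEntropy (ρ σ : Op ι) : EReal :=
  if ∀ v : ι → ℂ, σ.mulVec v = 0 → ρ.mulVec v = 0 then
    (((ρ * cfc Real.log ρ).trace - (ρ * cfc Real.log σ).trace).re : EReal)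
  else ⊤

end General

section Pauli

variable (q : ℕ) [NeZero q]

/-- The shift operator `X |j⟩ = |j + 1 mod q⟩`. -/
def shiftX : Op (Fin q) := Matrix.of fun i j => if i = j + 1 then 1 else 0

/-- The clock operator `Z |j⟩ = ω^j |j⟩` with `ω = exp (2πi/q)`. -/
def clockZ : Op (Fin q) :=
  Matrix.diagonal fun j => Complex.exp (2 * Real.pi * Complex.I / q) ^ (j : ℕ)

variable {q} {V : Type*} [Fintype V]

/-- The tensor product over all qudits `v` of the operators `X ^ a v * Z ^ b v`. -/
def pauliString (a b : V → ℕ) : Op (V → Fin q) :=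
  Matrix.of fun x y => ∏ v, (shiftX q ^ a v * clockZ q ^ b v) (x v) (y v)

/-- Multi-qudit Pauli operators, up to an arbitrary phase. -/
def IsPauli (g : Op (V → Fin q)) : Prop :=
  ∃ (c : ℂ) (a b : V → ℕ), ‖c‖ = 1 ∧ g = c • pauliString a b

variable [DecidableEq V]

/-- A stabilizer group: a commutative group of Pauli operators whose only scalar element is the
identity. -/
def IsStabilizerGroup (S : Subgroup (Op (V → Fin q))ˣ) : Prop :=
  (∀ g ∈ S, IsPauli (g : Op (V → Fin q))) ∧
  (∀ g ∈ S, ∀ h ∈ S, g * h = h * g) ∧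
  (∀ g ∈ S, ∀ c : ℂ, (g : Op (V → Fin q)) = c • (1 : Op (V → Fin q)) → g = 1)

/-- Membership of a vector in the stabilizer code of `S`: it is fixed by all elements of `S`. -/
def InCode (S : Subgroup (Op (V → Fin q))ˣ) (ψ : (V → Fin q) → ℂ) : Prop :=
  ∀ g ∈ S, (g : Op (V → Fin q)).mulVec ψ = ψ

/-- Stabilizer projection states: the maximally mixed state `P / Tr P` on a stabilizer code, where
`P` is the orthogonal projector onto the code. -/
def IsStabProjState (τ : Op (V → Fin q)) : Prop :=
  ∃ (S : Subgroup (Op (V → Fin q))ˣ) (P : Op (V → Fin q)), IsStabilizerGroup S ∧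
    P.IsHermitian ∧ P * P = P ∧ (∀ ψ, P.mulVec ψ = ψ ↔ InCode S ψ) ∧ τ = P.trace⁻¹ • P

/-- Pure stabilizer states (as density matrices `|ψ⟩⟨ψ|`): `ψ` is a unit vector spanning the code of
some stabilizer group, i.e. its unique common `+1` eigenvector up to scalars. -/
def IsPureStab (τ : Op (V → Fin q)) : Prop :=
  ∃ (S : Subgroup (Op (V → Fin q))ˣ) (ψ : (V → Fin q) → ℂ), IsStabilizerGroup S ∧
    star ψ ⬝ᵥ ψ = 1 ∧ (∀ φ, InCode S φ ↔ ∃ c : ℂ, φ = c • ψ) ∧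
    τ = Matrix.vecMulVec ψ (star ψ)

variable (q V) in
/-- The set `𝒮` of states without magic: convex mixtures of pure stabilizer states. -/
def stabMix : Set (Op (V → Fin q)) := convexHull ℝ {τ | IsPureStab τ}

/-- Stabilizer measurements: finite POVMs all of whose elements are (nonnegatively) proportional to
stabilizer projection states. -/
def IsStabMeas {m : ℕ} (M : Fin m → Op (V → Fin q)) : Prop :=
  (∀ x, ∃ (c : ℝ) (τ : Op (V → Fin q)), 0 ≤ c ∧ IsStabProjState τ ∧ M x = c • τ) ∧ ∑ x, M x = 1

/-- The measurement channel `ρ ↦ ∑ₓ Tr[Mₓ ρ] |x⟩⟨x|`. -/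
def measure {m : ℕ} (M : Fin m → Op (V → Fin q)) (ρ : Op (V → Fin q)) : Op (Fin m) :=
  Matrix.diagonal fun x => (M x * ρ).trace

/-- `S(ρ‖𝒮) = min_{σ ∈ 𝒮} S(ρ‖σ)`, the relative entropy of magic. -/
def relEntMagic (ρ : Op (V → Fin q)) : EReal := ⨅ σ ∈ stabMix q V, relEntropy ρ σ

/-- `S_SM(ρ‖σ) = max_{M ∈ SM} S(M(ρ)‖M(σ))`. -/
def relEntropySM (ρ σ : Op (V → Fin q)) : EReal :=
  ⨆ (m : ℕ) (M : Fin m → Op (V → Fin q)) (_ : IsStabMeas M),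
    relEntropy (measure M ρ) (measure M σ)

/-- `S_SM(ρ‖𝒮) = min_{τ ∈ 𝒮} S_SM(ρ‖τ)`. -/
def relEntMagicSM (ρ : Op (V → Fin q)) : EReal := ⨅ τ ∈ stabMix q V, relEntropySM ρ τ

/-- `F(ρ, 𝒮) = max_{σ ∈ 𝒮} F(ρ, σ)`. -/
def stabFidelity (ρ : Op (V → Fin q)) : ℝ := sSup {x | ∃ σ ∈ stabMix q V, x = fidelity ρ σ}

/-- `F_SM(ρ, σ) = min_{M ∈ SM} F(M(ρ), M(σ))`. -/
def fidelitySM (ρ σ : Op (V → Fin q)) : ℝ :=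
  sInf {x | ∃ (m : ℕ) (M : Fin m → Op (V → Fin q)), IsStabMeas M ∧
    x = fidelity (measure M ρ) (measure M σ)}

/-- `F_SM(ρ, 𝒮) = max_{τ ∈ 𝒮} F_SM(ρ, τ)`. -/
def stabFidelitySM (ρ : Op (V → Fin q)) : ℝ := sSup {x | ∃ τ ∈ stabMix q V, x = fidelitySM ρ τ}

/-- Log-stabilizer fidelity `LF(ρ) = - log max_{σ ∈ 𝒮} F(ρ, σ)²`. -/
def logStabFidelity (ρ : Op (V → Fin q)) : ℝ :=
  -Real.log (sSup {x | ∃ σ ∈ stabMix q V, x = fidelity ρ σ ^ 2})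

/-- `‖ρ - 𝒮‖₁ ≥ ε`: the trace-norm distance of `ρ` to every stabilizer mixture is at least `ε`. -/
def FarFromStab (ε : ℝ) (ρ : Op (V → Fin q)) : Prop :=
  ∀ τ ∈ stabMix q V, ε ≤ traceNorm (ρ - τ)

/-- The reduced density matrix on the qudits in `A` (partial trace over the other qudits). -/
def reduced (ρ : Op (V → Fin q)) (A : Finset V) : Op (A → Fin q) :=
  let glue := (Equiv.piEquivPiSubtypeProd (fun v => v ∈ A) fun _ => Fin q).symm
  Matrix.of fun x y => ∑ z : {v // v ∉ A} → Fin q, ρ (glue (x, z)) (glue (y, z))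

/-- The tensor product `⊗ᵢ ρᵢ` of operators on the subsystems `A i` (meant for `A` a partition of
the set of qudits). -/
def tensorState {n : ℕ} (A : Fin n → Finset V) (ρ : ∀ i, Op (A i → Fin q)) : Op (V → Fin q) :=
  Matrix.of fun x y => ∏ i, ρ i (fun v => x v) (fun v => y v)

end Pauli

end Magic

end

/-! Measure the subsystems one after another and let the stabilizer mixture `σ` be updated along the
way. A stabilizer measurement on a set `U` disjoint from `A i` sends `σ` to conditional states on `A
i` that are again stabilizer mixtures, and so does any reweighting of the outcomes
(`reduced_mul_mem_stabCone`, `postState_mem_stabMix`). The reweighted state `τ` on `A i` is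
therefore admissible in the minimum defining the local quantity. A measurement of `A i` is then
chosen against this very `τ` and joined to the earlier ones.

The classical chain rules fix the weights. For relative entropy, `klSum_chain` splits the joint
divergence into the divergence of the earlier outcomes and the divergence on `A i` from the mixture
of `σ`-conditionals weighted by the `ρ`-probabilities. For fidelity with a product `ρ`,
`fidSum_chain` does the same by Cauchy-Schwarz, with weights proportional to `√p √q`. Induction on
the set of subsystems yields one measurement whose classical divergence (fidelity) is at least the
sum (at most the product) of the local terms. Measuring cannot increase relative entropy
(`klSum_prob_le`) or decrease fidelity (`fidelity_le_fidSum`), which gives both general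
inequalities.

Closure of stabilizer mixtures rests on `IsStabVec.map`: expand `|φ⟩⟨φ|` in Weyl operators and push
the expansion through an operator intertwining Paulis. It is applied to projectors onto Pauli codes
and to slices by a basis vector, the latter giving the partial trace.

For the quantitative bounds, Parseval in the Weyl basis finds a Pauli operator whose expectation
separates two states at trace distance `ε` by at least `ε / D`. Measuring its eigenspaces is a
stabilizer measurement with the same separation in total variation. Pinsker's inequality and its
fidelity analogue then convert this separation. -/

noncomputable section
namespace Magic

/-! ### Classical divergence and fidelity: chain rules, Pinsker-type bounds, a comparison criterion.
-/

section Classical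

variable {X Y : Type*} [Fintype X] [Fintype Y]

/-- Classical relative entropy of two finite families of reals. -/
def klSum (p q : X → ℝ) : ℝ := ∑ x, p x * (Real.log (p x) - Real.log (q x))

/-- Classical fidelity of two finite families of reals. -/
def fidSum (p q : X → ℝ) : ℝ := ∑ x, √(p x) * √(q x)

/-- Tangent bound `log t ≤ t - 1` at `t = b s / a`; the free slope `s` lets one sum over `x` with a
common ratio. -/
theorem mul_log_sub_log_ge {a b s : ℝ} (ha : 0 ≤ a) (hb : 0 ≤ b) (hs : 0 < s) (hab : b = 0 → a = 0) :
    a * Real.log s + a - b * s ≤ a * (Real.log a - Real.log b) := by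
  rcases ha.eq_or_lt with rfl | ha
  · simp; positivity
  have hb : 0 < b := lt_of_le_of_ne hb fun h => ha.ne' (hab h.symm)
  have h := Real.log_le_sub_one_of_pos (x := b * s / a) (by positivity)
  rw [Real.log_div (by positivity) ha.ne', Real.log_mul hb.ne' hs.ne'] at h
  have h2 := mul_le_mul_of_nonneg_left h ha.le
  have : a * (b * s / a - 1) = b * s - a := by field_simp
  rw [this] at h2
  nlinarith

theorem log_sum_le {a b : X → ℝ} (ha : ∀ x, 0 ≤ a x) (hb : ∀ x, 0 ≤ b x)
    (hab : ∀ x, b x = 0 → a x = 0) :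
    (∑ x, a x) * (Real.log (∑ x, a x) - Real.log (∑ x, b x)) ≤ klSum a b := by
  rcases (Finset.sum_nonneg fun x _ => ha x).eq_or_lt with h | h
  · have h0 : ∀ x, a x = 0 := fun x =>
      (Finset.sum_eq_zero_iff_of_nonneg fun x _ => ha x).1 h.symm x (Finset.mem_univ x)
    simp [klSum, h0]
  have hB : 0 < ∑ x, b x := by
    refine lt_of_le_of_ne (Finset.sum_nonneg fun x _ => hb x) fun h' => h.ne' ?_
    refine Finset.sum_eq_zero fun x _ => hab x ?_
    exact (Finset.sum_eq_zero_iff_of_nonneg fun x _ => hb x).1 h'.symm x (Finset.mem_univ x)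
  -- The ratio of the totals is the optimal slope: the linear terms `a - b * s` then cancel after
  -- summation.
  have := Finset.sum_le_sum fun x (_ : x ∈ Finset.univ) =>
    mul_log_sub_log_ge (ha x) (hb x) (div_pos h hB) (hab x)
  refine le_trans (le_of_eq ?_) this
  rw [Finset.sum_sub_distrib, Finset.sum_add_distrib, ← Finset.sum_mul, ← Finset.sum_mul,
    Real.log_div h.ne' hB.ne']
  field_simp
  ring

/-- By the chain rule the divergence of `p` from `q` is that of the `X`-marginals plus that of `p`
from `p1(x) q(y|x)`; forgetting `x` in the second term only decreases it, by the log-sum inequality.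
The reference on `Y` stays a mixture of conditionals of `q`. -/
theorem klSum_chain {p q : X × Y → ℝ} (hp : ∀ z, 0 ≤ p z) (hq : ∀ z, 0 ≤ q z)
    (hpq : ∀ z, q z = 0 → p z = 0) {p1 q1 : X → ℝ} (hp1 : ∀ x, p1 x = ∑ y, p (x, y))
    (hq1 : ∀ x, q1 x = ∑ y, q (x, y)) :
    klSum p1 q1 + klSum (fun y => ∑ x, p (x, y)) (fun y => ∑ x, p1 x / q1 x * q (x, y))
      ≤ klSum p q := by
  have hp1' : ∀ x, 0 ≤ p1 x := fun x => hp1 x ▸ Finset.sum_nonneg fun y _ => hp _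
  have hq1' : ∀ x, 0 ≤ q1 x := fun x => hq1 x ▸ Finset.sum_nonneg fun y _ => hq _
  have hle1 : ∀ x y, p (x, y) ≤ p1 x := fun x y => hp1 x ▸
    Finset.single_le_sum (f := fun y => p (x, y)) (fun y _ => hp _) (Finset.mem_univ y)
  have hle2 : ∀ x y, q (x, y) ≤ q1 x := fun x y => hq1 x ▸
    Finset.single_le_sum (f := fun y => q (x, y)) (fun y _ => hq _) (Finset.mem_univ y)
  have key : ∀ y, (∑ x, p (x, y)) * (Real.log (∑ x, p (x, y))
      - Real.log (∑ x, p1 x / q1 x * q (x, y)))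
      ≤ klSum (fun x => p (x, y)) (fun x => p1 x / q1 x * q (x, y)) := fun y => by
    refine log_sum_le (fun x => hp _)
      (fun x => mul_nonneg (div_nonneg (hp1' x) (hq1' x)) (hq _)) fun x h => ?_
    rcases mul_eq_zero.1 h with h | h
    · rcases div_eq_zero_iff.1 h with h | h
      · exact le_antisymm (h ▸ hle1 x y) (hp _)
      · exact hpq _ (le_antisymm (h ▸ hle2 x y) (hq _))
    · exact hpq _ h
  have hsum := Finset.sum_le_sum fun y (_ : y ∈ Finset.univ) => key y
  refine le_trans (add_le_add_right hsum _) (le_of_eq ?_)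
  simp only [klSum]
  rw [Fintype.sum_prod_type, Finset.sum_comm (γ := Y), ← Finset.sum_add_distrib]
  refine Finset.sum_congr rfl fun x _ => ?_
  nth_rw 1 [hp1 x]
  rw [Finset.sum_mul, ← Finset.sum_add_distrib]
  refine Finset.sum_congr rfl fun y _ => ?_
  rcases (hp (x, y)).eq_or_lt with h | h
  · simp [← h]
  have hq0 : 0 < q (x, y) := lt_of_le_of_ne (hq _) fun h' => h.ne' (hpq _ h'.symm)
  have h1 : 0 < p1 x := h.trans_le (hle1 x y)
  have h2 : 0 < q1 x := hq0.trans_le (hle2 x y)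
  rw [Real.log_mul (by positivity) hq0.ne', Real.log_div h1.ne' h2.ne']
  ring

theorem fidSum_nonneg (p q : X → ℝ) : 0 ≤ fidSum p q :=
  Finset.sum_nonneg fun _ _ => by positivity

/-- Cauchy-Schwarz over `x` for each fixed `y`, with the weight `√(p1 x) √(q1 x)` split off.
Normalized by the marginal fidelity, this weight is the probability with which the conditionals of
`q` are mixed. -/
theorem fidSum_chain {p1 q1 : X → ℝ} {p2 : Y → ℝ} {q : X × Y → ℝ} (hp1 : ∀ x, 0 ≤ p1 x)
    (hq : ∀ z, 0 ≤ q z) (hq1 : ∀ x, q1 x = ∑ y, q (x, y)) :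
    fidSum (fun z : X × Y => p1 z.1 * p2 z.2) q ≤ fidSum p1 q1 *
      fidSum p2 (fun y => ∑ x, √(p1 x) * √(q1 x) / fidSum p1 q1 / q1 x * q (x, y)) := by
  have hq1' : ∀ x, 0 ≤ q1 x := fun x => hq1 x ▸ Finset.sum_nonneg fun y _ => hq _
  have hle2 : ∀ x y, q (x, y) ≤ q1 x := fun x y => hq1 x ▸
    Finset.single_le_sum (f := fun y => q (x, y)) (fun y _ => hq _) (Finset.mem_univ y)
  set F := fidSum p1 q1 with hF
  have hF0 : 0 ≤ F := fidSum_nonneg _ _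
  rw [fidSum, Fintype.sum_prod_type, Finset.sum_comm]
  conv_rhs => rw [fidSum, Finset.mul_sum]
  refine Finset.sum_le_sum fun y _ => ?_
  have hx : ∀ x, √(p1 x * p2 y) * √(q (x, y)) = √(p2 y) *
      (√(√(p1 x) * √(q1 x)) * √(√(p1 x) * √(q1 x) / q1 x * q (x, y))) := fun x => by
    rw [Real.sqrt_mul (hp1 x)]
    rcases (hq1' x).eq_or_lt with h | h
    · have : q (x, y) = 0 := le_antisymm (h ▸ hle2 x y) (hq _)
      simp [this]
    · rw [← Real.sqrt_mul (by positivity) (√(p1 x) * √(q1 x) / q1 x * q (x, y))]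
      have : √(p1 x) * √(q1 x) * (√(p1 x) * √(q1 x) / q1 x * q (x, y)) = p1 x * q (x, y) := by
        have h1 := Real.mul_self_sqrt (hp1 x)
        have h2 := Real.mul_self_sqrt h.le
        field_simp
        rw [Real.sq_sqrt (hp1 x), Real.sq_sqrt h.le]
        ring
      rw [this, Real.sqrt_mul (hp1 x)]
      ring
  simp only [hx]
  rw [← Finset.mul_sum]
  have hr : F * (√(p2 y) * √(∑ x, √(p1 x) * √(q1 x) / F / q1 x * q (x, y))) =
      √(p2 y) * (F * √(∑ x, √(p1 x) * √(q1 x) / F / q1 x * q (x, y))) := by ring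
  rw [hr]
  refine mul_le_mul_of_nonneg_left ?_ (Real.sqrt_nonneg _)
  refine (Real.sum_sqrt_mul_sqrt_le _ (fun x => mul_nonneg (Real.sqrt_nonneg _) (Real.sqrt_nonneg _))
    (fun x => mul_nonneg (div_nonneg (by positivity) (hq1' x)) (hq _))).trans (le_of_eq ?_)
  change √F * _ = _
  rw [← Real.sqrt_mul hF0]
  rcases hF0.eq_or_lt with h | h
  -- At zero marginal fidelity the factor `√F` vanishes, so the junk quotient by `F` is harmless.
  · rw [← h]; simp
  have h5 : ∑ x, √(p1 x) * √(q1 x) / q1 x * q (x, y) =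
      F * ∑ x, √(p1 x) * √(q1 x) / F / q1 x * q (x, y) := by
    rw [Finset.mul_sum]
    exact Finset.sum_congr rfl fun x _ => by field_simp
  rw [h5, ← mul_assoc, Real.sqrt_mul (mul_self_nonneg F), Real.sqrt_mul_self h.le]

/-- Cauchy-Schwarz on `|p - q| = |√p - √q| (√p + √q)`; the two sums of squares are `2 - 2F` and `2 +
2F`. -/
theorem sq_sum_abs_sub_le_fidSum {p q : X → ℝ} (hp : ∀ x, 0 ≤ p x) (hq : ∀ x, 0 ≤ q x)
    (hp1 : ∑ x, p x = 1) (hq1 : ∑ x, q x = 1) :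
    fidSum p q ^ 2 ≤ 1 - (∑ x, |p x - q x|) ^ 2 / 4 := by
  have h1 : ∑ x, (√(p x) - √(q x)) ^ 2 = 2 - 2 * fidSum p q := by
    have : ∀ x, (√(p x) - √(q x)) ^ 2 = p x + q x - 2 * (√(p x) * √(q x)) := fun x => by
      rw [sub_sq, Real.sq_sqrt (hp x), Real.sq_sqrt (hq x)]; ring
    simp only [this, Finset.sum_sub_distrib, Finset.sum_add_distrib, hp1, hq1, fidSum,
      ← Finset.mul_sum]
    norm_num
  have h2 : ∑ x, (√(p x) + √(q x)) ^ 2 = 2 + 2 * fidSum p q := by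
    have : ∀ x, (√(p x) + √(q x)) ^ 2 = p x + q x + 2 * (√(p x) * √(q x)) := fun x => by
      rw [add_sq, Real.sq_sqrt (hp x), Real.sq_sqrt (hq x)]; ring
    simp only [this, Finset.sum_add_distrib, hp1, hq1, fidSum, ← Finset.mul_sum]
    norm_num
  have h3 := Finset.sum_mul_sq_le_sq_mul_sq Finset.univ (fun x => |√(p x) - √(q x)|)
    (fun x => √(p x) + √(q x))
  have h4 : ∀ x, |√(p x) - √(q x)| * (√(p x) + √(q x)) = |p x - q x| := fun x => by
    rw [← abs_of_nonneg (add_nonneg (Real.sqrt_nonneg (p x)) (Real.sqrt_nonneg (q x))), ← abs_mul]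
    congr 1
    nlinarith [Real.mul_self_sqrt (hp x), Real.mul_self_sqrt (hq x)]
  simp only [h4, sq_abs, h1, h2] at h3
  nlinarith

theorem hasDerivAt_pinsker_aux {t : ℝ} (ht : 0 < t) :
    HasDerivAt (fun t => t * Real.log t - t + 1 - 3 / 2 * ((t - 1) ^ 2 / (t + 2)))
      (Real.log t - 3 / 2 * ((t - 1) * (t + 5) / (t + 2) ^ 2)) t := by
  have h1 := (((hasDerivAt_id t).mul (Real.hasDerivAt_log ht.ne')).sub (hasDerivAt_id t)).add_const 1
  have h2 := ((((hasDerivAt_id t).sub_const 1).pow 2).div ((hasDerivAt_id t).add_const 2)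
    (show id t + 2 ≠ 0 by simp only [id]; positivity)).const_mul (3 / 2)
  refine (h1.sub h2).congr_deriv ?_
  simp only [id, Nat.cast_ofNat, Pi.pow_apply]
  field_simp
  ring

theorem hasDerivAt_pinsker_aux' {t : ℝ} (ht : 0 < t) :
    HasDerivAt (fun t => Real.log t - 3 / 2 * ((t - 1) * (t + 5) / (t + 2) ^ 2))
      (t⁻¹ - 27 / (t + 2) ^ 3) t := by
  have h2 := ((((hasDerivAt_id t).sub_const 1).mul ((hasDerivAt_id t).add_const 5)).div
    (((hasDerivAt_id t).add_const 2).pow 2)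
    (show (id t + 2) ^ 2 ≠ 0 by simp only [id]; positivity)).const_mul (3 / 2)
  refine ((Real.hasDerivAt_log ht.ne').sub h2).congr_deriv ?_
  simp only [id, Nat.cast_ofNat, Pi.pow_apply, Pi.mul_apply]
  field_simp
  ring

/-- Pointwise form of Pinsker. The difference, divided by `2t + 4`, vanishes to first order at `t =
1` and is convex, since its second derivative is `1/t - 27/(t+2)^3 ≥ 0`. -/
theorem sq_sub_one_le {t : ℝ} (ht : 0 < t) :
    3 * (t - 1) ^ 2 ≤ (2 * t + 4) * (t * Real.log t - t + 1) := by
  set f : ℝ → ℝ := fun t => t * Real.log t - t + 1 - 3 / 2 * ((t - 1) ^ 2 / (t + 2)) with hf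
  set g : ℝ → ℝ := fun t => Real.log t - 3 / 2 * ((t - 1) * (t + 5) / (t + 2) ^ 2) with hg
  have hgm : MonotoneOn g (Set.Ioi 0) := by
    refine monotoneOn_of_deriv_nonneg (convex_Ioi 0)
      (fun x hx => (hasDerivAt_pinsker_aux' hx).continuousAt.continuousWithinAt)
      (fun x hx => (hasDerivAt_pinsker_aux'
        (interior_subset hx)).differentiableAt.differentiableWithinAt) fun x hx => ?_
    have hx : 0 < x := interior_subset hx
    rw [(hasDerivAt_pinsker_aux' hx).deriv, sub_nonneg, div_le_iff₀ (by positivity),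
      inv_mul_eq_div, le_div_iff₀ hx]
    -- Here `(x + 2)^3 - 27 x = (x - 1)^2 (x + 8)`.
    nlinarith [mul_nonneg (sq_nonneg (x - 1)) (by linarith : 0 ≤ x + 8)]
  have hg1 : g 1 = 0 := by simp [hg]
  have hf1 : f 1 = 0 := by simp [hf]
  have hfc : ∀ x, 0 < x → HasDerivAt f (g x) x := fun x hx => hasDerivAt_pinsker_aux hx
  have hfnn : 0 ≤ f t := by
    rcases le_total 1 t with h | h
    · have : MonotoneOn f (Set.Ici 1) := by
        refine monotoneOn_of_deriv_nonneg (convex_Ici 1)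
          (fun x hx => (hfc x (zero_lt_one.trans_le hx)).continuousAt.continuousWithinAt)
          (fun x hx => (hfc x (zero_lt_one.trans_le
            (interior_subset hx))).differentiableAt.differentiableWithinAt) fun x hx => ?_
        have hx : 1 ≤ x := interior_subset hx
        rw [(hfc x (by linarith)).deriv, ← hg1]
        exact hgm (Set.mem_Ioi.2 one_pos) (Set.mem_Ioi.2 (by linarith)) hx
      simpa [hf1] using this (Set.mem_Ici.2 le_rfl) (Set.mem_Ici.2 h) h
    · have : AntitoneOn f (Set.Ioc 0 1) := by
        refine antitoneOn_of_deriv_nonpos (convex_Ioc 0 1)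
          (fun x hx => (hfc x hx.1).continuousAt.continuousWithinAt)
          (fun x hx => (hfc x
            (interior_subset hx).1).differentiableAt.differentiableWithinAt) fun x hx => ?_
        have hx : x ∈ Set.Ioc (0 : ℝ) 1 := interior_subset hx
        rw [(hfc x hx.1).deriv, ← hg1]
        exact hgm (Set.mem_Ioi.2 hx.1) (Set.mem_Ioi.2 one_pos) hx.2
      simpa [hf1] using this (Set.mem_Ioc.2 ⟨ht, h⟩) (Set.mem_Ioc.2 ⟨one_pos, le_rfl⟩) h
  have h2 := mul_nonneg (show 0 ≤ 2 * t + 4 by positivity) hfnn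
  have h3 : (2 * t + 4) * f t = (2 * t + 4) * (t * Real.log t - t + 1) - 3 * (t - 1) ^ 2 := by
    simp only [hf]
    field_simp
    ring
  linarith

theorem pinsker {p q : X → ℝ} (hp : ∀ x, 0 ≤ p x) (hq : ∀ x, 0 ≤ q x)
    (hp1 : ∑ x, p x = 1) (hq1 : ∑ x, q x = 1) (hpq : ∀ x, q x = 0 → p x = 0) :
    (∑ x, |p x - q x|) ^ 2 / 2 ≤ klSum p q := by
  have hx : ∀ x, 3 * (p x - q x) ^ 2 ≤ (2 * p x + 4 * q x) *
      (p x * (Real.log (p x) - Real.log (q x)) - p x + q x) := fun x => by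
    rcases (hp x).eq_or_lt with h | h
    · rw [← h]; nlinarith [hq x]
    have hq0 : 0 < q x := lt_of_le_of_ne (hq _) fun h' => h.ne' (hpq _ h'.symm)
    have := mul_le_mul_of_nonneg_left (sq_sub_one_le (div_pos h hq0)) (sq_nonneg (q x))
    rw [Real.log_div h.ne' hq0.ne'] at this
    calc 3 * (p x - q x) ^ 2 = q x ^ 2 * (3 * (p x / q x - 1) ^ 2) := by field_simp
      _ ≤ _ := this
      _ = _ := by field_simp
  set g : X → ℝ := fun x => p x * (Real.log (p x) - Real.log (q x)) - p x + q x with hg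
  have hg0 : ∀ x, 0 ≤ g x := fun x => by
    rcases (hp x).eq_or_lt with h | h
    · simp [hg, ← h, hq x]
    have hq0 : 0 < q x := lt_of_le_of_ne (hq _) fun h' => h.ne' (hpq _ h'.symm)
    by_contra hneg
    have h1 := hx x
    have : (2 * p x + 4 * q x) * g x < 0 := mul_neg_of_pos_of_neg (by positivity) (not_le.1 hneg)
    nlinarith [sq_nonneg (p x - q x)]
  have hsum : ∑ x, g x = klSum p q := by
    simp only [hg, Finset.sum_add_distrib, Finset.sum_sub_distrib, hp1, hq1, klSum]; ring
  -- The weights of the Cauchy-Schwarz step total 2, which is the constant in Pinsker's inequality.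
  have hw : ∑ x, (2 * p x + 4 * q x) / 3 = 2 := by
    rw [← Finset.sum_div, Finset.sum_add_distrib, ← Finset.mul_sum, ← Finset.mul_sum, hp1, hq1]
    norm_num
  have h1 : ∑ x, |p x - q x| ≤ ∑ x, √((2 * p x + 4 * q x) / 3) * √(g x) := by
    refine Finset.sum_le_sum fun x _ => ?_
    rw [← Real.sqrt_mul (by have := hp x; have := hq x; positivity)]
    refine Real.abs_le_sqrt ?_
    have := hx x
    change _ ≤ _ * g x at this
    nlinarith
  have h2 := h1.trans (Real.sum_sqrt_mul_sqrt_le _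
    (fun x => by have := hp x; have := hq x; positivity) hg0)
  rw [hsum, hw, ← Real.sqrt_mul (by norm_num)] at h2
  have h3 := pow_le_pow_left₀ (Finset.sum_nonneg fun x _ => abs_nonneg _) h2 2
  rw [Real.sq_sqrt (mul_nonneg zero_le_two (hsum ▸ Finset.sum_nonneg fun x _ => hg0 x))] at h3
  linarith

-- Relative entropy is an integral over `t > 0` of differences of the rational sums, because `a² /
-- (b + t a)` is the `t`-derivative of `a log (b + t a)`. Comparing divergences thus reduces to
-- comparing rational functions, for which no logarithm of an operator is needed.
open Filter Topology in
theorem klSum_le_of_rational {P Q : X → ℝ} {p q : Y → ℝ} (hP : ∀ x, 0 ≤ P x) (hQ : ∀ x, 0 ≤ Q x)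
    (hp : ∀ x, 0 ≤ p x) (hq : ∀ x, 0 ≤ q x) (hPQ : ∀ x, Q x = 0 → P x = 0)
    (hpq : ∀ x, q x = 0 → p x = 0) (hs : ∑ x, P x = ∑ x, p x)
    (h : ∀ t : ℝ, 0 < t → ∑ x, p x ^ 2 / (q x + t * p x) ≤ ∑ x, P x ^ 2 / (Q x + t * P x)) :
    klSum p q ≤ klSum P Q := by
  have hpos : ∀ {a b t : ℝ}, 0 < a → 0 ≤ b → 0 ≤ t → (b = 0 → a = 0) → 0 < b + t * a :=
    fun ha hb ht hab => by
      have := lt_of_le_of_ne hb fun h' => ha.ne' (hab h'.symm)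
      positivity
  have hterm : ∀ {a b t : ℝ}, 0 ≤ a → 0 ≤ b → 0 ≤ t → (b = 0 → a = 0) →
      HasDerivAt (fun t => a * Real.log (b + t * a)) (a ^ 2 / (b + t * a)) t :=
    fun {a b t} ha hb ht hab => by
      rcases ha.eq_or_lt with rfl | ha
      · simpa using hasDerivAt_const t (0 : ℝ)
      have h1 := ((((hasDerivAt_id t).mul_const a).const_add b).log
        (hpos ha hb ht hab).ne').const_mul a
      refine h1.congr_deriv ?_
      simp only [id]
      ring
  have hlim : ∀ {a b : ℝ}, 0 ≤ a → 0 ≤ b → (b = 0 → a = 0) →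
      Tendsto (fun t => a * (Real.log (b + t * a) - Real.log t)) atTop (𝓝 (a * Real.log a)) :=
    fun {a b} ha hb hab => by
      rcases ha.eq_or_lt with rfl | ha
      · simp
      have h1 : Tendsto (fun t : ℝ => b / t + a) atTop (𝓝 (0 + a)) :=
        (tendsto_const_nhds.div_atTop tendsto_id).add tendsto_const_nhds
      rw [zero_add] at h1
      refine ((h1.log ha.ne').const_mul a).congr' ?_
      filter_upwards [eventually_gt_atTop 0] with t ht
      rw [← Real.log_div (hpos ha hb ht.le hab).ne' ht.ne']
      congr 2
      field_simp
  set G : ℝ → ℝ := fun t => ∑ x, P x * Real.log (Q x + t * P x) -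
    ∑ x, p x * Real.log (q x + t * p x) with hG
  have hGd : ∀ t, 0 ≤ t → HasDerivAt G (∑ x, P x ^ 2 / (Q x + t * P x) -
      ∑ x, p x ^ 2 / (q x + t * p x)) t := fun t ht =>
    (HasDerivAt.fun_sum fun x _ => hterm (hP x) (hQ x) ht (hPQ x)).sub
      (HasDerivAt.fun_sum fun x _ => hterm (hp x) (hq x) ht (hpq x))
  have hmono : MonotoneOn G (Set.Ici 0) := by
    refine monotoneOn_of_deriv_nonneg (convex_Ici 0)
      (fun x hx => (hGd x hx).continuousAt.continuousWithinAt)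
      (fun x hx => (hGd x (interior_subset hx)).differentiableAt.differentiableWithinAt)
      fun x hx => ?_
    rw [interior_Ici, Set.mem_Ioi] at hx
    rw [(hGd x hx.le).deriv, sub_nonneg]
    exact h x hx
  -- Each sum diverges like its total mass times `log t`; equal masses (`hs`) make these parts
  -- cancel.
  have hGlim : Tendsto G atTop (𝓝 (∑ x, P x * Real.log (P x) - ∑ x, p x * Real.log (p x))) := by
    refine ((tendsto_finsetSum _ fun x _ => hlim (hP x) (hQ x) (hPQ x)).sub
      (tendsto_finsetSum _ fun x _ => hlim (hp x) (hq x) (hpq x))).congr fun t => ?_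
    simp only [mul_sub, Finset.sum_sub_distrib, ← Finset.sum_mul, hs, hG]
    ring
  have hle : G 0 ≤ ∑ x, P x * Real.log (P x) - ∑ x, p x * Real.log (p x) := by
    refine ge_of_tendsto hGlim ?_
    filter_upwards [eventually_ge_atTop 0] with t ht
    exact hmono (Set.mem_Ici.2 le_rfl) (Set.mem_Ici.2 ht) ht
  simp only [hG, zero_mul, add_zero] at hle
  simp only [klSum, mul_sub, Finset.sum_sub_distrib]
  linarith

end Classical

/-! ### Functional calculus, and monotonicity of relative entropy and fidelity under measurement. -/

section Operators

open Matrix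
open scoped ComplexOrder

variable {ι : Type*} [Fintype ι] [DecidableEq ι]

theorem cfc_diagonal_ofReal (f : ℝ → ℝ) (p : ι → ℝ) :
    cfc f (diagonal fun x => (p x : ℂ)) = diagonal fun x => (f (p x) : ℂ) := by
  classical
  set D : Op ι := diagonal fun x => (p x : ℂ) with hD
  have hDh : D.IsHermitian := by
    rw [hD, IsHermitian, diagonal_conjTranspose]
    congr 1; ext x; simp
  -- Interpolating `f` at both the diagonal entries and the eigenvalues avoids having to identify
  -- the two sets.
  set s : Finset ℝ := Finset.univ.image p ∪ Finset.univ.image hDh.eigenvalues with hs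
  set P : Polynomial ℝ := Lagrange.interpolate s id f with hP
  have hev : ∀ x ∈ s, P.eval x = f x := fun x hx =>
    Lagrange.eval_interpolate_at_node f (Function.injective_id.injOn) hx
  have h1 : cfc f D = cfc P.eval D := by
    refine cfc_congr fun x hx => (hev x ?_).symm
    rw [hDh.spectrum_real_eq_range_eigenvalues] at hx
    obtain ⟨i, rfl⟩ := hx
    simp [hs]
  refine h1.trans ((cfc_polynomial P D hDh).trans ?_)
  have h2 : ∀ R : Polynomial ℝ, Polynomial.aeval D R = diagonal fun x => ((R.eval (p x) : ℝ) : ℂ) := by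
    intro R
    induction R using Polynomial.induction_on' with
    | add a b ha hb => simp [ha, hb]
    | monomial n a =>
      rw [Polynomial.aeval_monomial, hD, diagonal_pow, ← Algebra.smul_def, ← diagonal_smul]
      congr 1
      ext x
      simp
  rw [h2]
  congr 1
  ext x
  rw [hev]
  simp [hs]

theorem _root_.Matrix.IsHermitian.cfc_eq_mul {A : Op ι} (hA : A.IsHermitian) (f : ℝ → ℝ) :
    cfc f A = (hA.eigenvectorUnitary : Op ι) * diagonal (fun i => (f (hA.eigenvalues i) : ℂ)) *
      (hA.eigenvectorUnitary : Op ι)ᴴ := by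
  rw [hA.cfc_eq, IsHermitian.cfc, Unitary.conjStarAlgAut_apply]
  rfl

theorem _root_.Matrix.IsHermitian.eq_mul {A : Op ι} (hA : A.IsHermitian) :
    A = (hA.eigenvectorUnitary : Op ι) * diagonal (fun i => (hA.eigenvalues i : ℂ)) *
      (hA.eigenvectorUnitary : Op ι)ᴴ := by
  conv_lhs => rw [hA.spectral_theorem, Unitary.conjStarAlgAut_apply]
  rfl

theorem _root_.Matrix.IsHermitian.eigenvectorUnitary_conjTranspose_mul {A : Op ι}
    (hA : A.IsHermitian) :
    (hA.eigenvectorUnitary : Op ι)ᴴ * (hA.eigenvectorUnitary : Op ι) = 1 :=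
  Unitary.coe_star_mul_self _

theorem _root_.Matrix.IsHermitian.eigenvectorUnitary_mul_conjTranspose {A : Op ι}
    (hA : A.IsHermitian) :
    (hA.eigenvectorUnitary : Op ι) * (hA.eigenvectorUnitary : Op ι)ᴴ = 1 :=
  Unitary.coe_mul_star_self _

theorem trace_cfc {A : Op ι} (hA : A.IsHermitian) (f : ℝ → ℝ) :
    (cfc f A).trace = ∑ i, (f (hA.eigenvalues i) : ℂ) := by
  rw [hA.cfc_eq_mul, trace_mul_comm, ← mul_assoc, hA.eigenvectorUnitary_conjTranspose_mul, one_mul,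
    trace_diagonal]

theorem traceNorm_eq (A : Op ι) :
    traceNorm A = ∑ i, √((isHermitian_conjTranspose_mul_self A).eigenvalues i) := by
  rw [traceNorm, trace_cfc (isHermitian_conjTranspose_mul_self A)]
  simp

theorem traceNorm_nonneg (A : Op ι) : 0 ≤ traceNorm A := by
  rw [traceNorm_eq]
  exact Finset.sum_nonneg fun _ _ => Real.sqrt_nonneg _

theorem trace_conjTranspose_mul_self_re (A : Op ι) :
    (Aᴴ * A).trace.re = ∑ i, (isHermitian_conjTranspose_mul_self A).eigenvalues i := by
  rw [(isHermitian_conjTranspose_mul_self A).trace_eq_sum_eigenvalues]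
  simp

theorem traceNorm_sq_le (A : Op ι) :
    traceNorm A ^ 2 ≤ Fintype.card ι * (Aᴴ * A).trace.re := by
  rw [traceNorm_eq, trace_conjTranspose_mul_self_re]
  refine (sq_sum_le_card_mul_sum_sq (s := Finset.univ)).trans (le_of_eq ?_)
  congr 1
  exact Finset.sum_congr rfl fun i _ =>
    Real.sq_sqrt ((posSemidef_conjTranspose_mul_self A).eigenvalues_nonneg i)

theorem trace_le_traceNorm_sq (A : Op ι) : (Aᴴ * A).trace.re ≤ traceNorm A ^ 2 := by
  rw [traceNorm_eq, trace_conjTranspose_mul_self_re]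
  refine le_trans (le_of_eq ?_) (Finset.sum_sq_le_sq_sum_of_nonneg fun i _ => Real.sqrt_nonneg _)
  exact Finset.sum_congr rfl fun i _ =>
    (Real.sq_sqrt ((posSemidef_conjTranspose_mul_self A).eigenvalues_nonneg i)).symm

theorem cfc_mul_cfc {A : Op ι} (hA : A.IsHermitian) (f g : ℝ → ℝ) :
    cfc f A * cfc g A = cfc (fun x => f x * g x) A := by
  simp only [hA.cfc_eq_mul]
  set U : Op ι := (hA.eigenvectorUnitary).1 with hU
  have h : Uᴴ * U = 1 := hA.eigenvectorUnitary_conjTranspose_mul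
  rw [show ∀ D E : Op ι, U * D * Uᴴ * (U * E * Uᴴ) = U * (D * (Uᴴ * U) * E) * Uᴴ by
    intro D E; simp only [mul_assoc], h, mul_one, diagonal_mul_diagonal]
  simp

theorem cfc_congr_eigenvalues {A : Op ι} (hA : A.IsHermitian) {f g : ℝ → ℝ}
    (h : ∀ i, f (hA.eigenvalues i) = g (hA.eigenvalues i)) : cfc f A = cfc g A := by
  simp only [hA.cfc_eq_mul, h]

theorem cfc_id_of_isHermitian {A : Op ι} (hA : A.IsHermitian) : cfc (fun x : ℝ => x) A = A := by
  rw [hA.cfc_eq_mul, ← hA.eq_mul]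

theorem isHermitian_cfc {A : Op ι} (hA : A.IsHermitian) (f : ℝ → ℝ) : (cfc f A).IsHermitian := by
  rw [hA.cfc_eq_mul, IsHermitian, conjTranspose_mul, conjTranspose_mul, conjTranspose_conjTranspose,
    diagonal_conjTranspose, mul_assoc]
  congr 3
  ext i
  simp

theorem cfc_sqrt_mul_self {A : Op ι} (hA : A.PosSemidef) :
    cfc Real.sqrt A * cfc Real.sqrt A = A := by
  rw [cfc_mul_cfc hA.1]
  conv_rhs => rw [← cfc_id_of_isHermitian hA.1]
  exact cfc_congr_eigenvalues hA.1 fun i => Real.mul_self_sqrt (hA.eigenvalues_nonneg i)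

theorem _root_.Matrix.PosSemidef.exists_isHermitian_sq {A : Op ι} (hA : A.PosSemidef) :
    ∃ B : Op ι, B.IsHermitian ∧ A = B * B :=
  ⟨_, isHermitian_cfc hA.1 _, (cfc_sqrt_mul_self hA).symm⟩

theorem trace_mul_nonneg {A B : Op ι} (hA : A.PosSemidef) (hB : B.PosSemidef) :
    0 ≤ (A * B).trace := by
  obtain ⟨C, hC, rfl⟩ := hA.exists_isHermitian_sq
  have h := (hB.mul_mul_conjTranspose_same C).trace_nonneg
  rwa [hC, trace_mul_comm, ← mul_assoc] at h

/-- With `A = C²` and `B = D²` the trace is the squared Hilbert-Schmidt norm of `D C`. -/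
theorem mul_eq_zero_of_trace_eq_zero {A B : Op ι} (hA : A.PosSemidef) (hB : B.PosSemidef)
    (h : (A * B).trace = 0) : B * A = 0 := by
  obtain ⟨C, hC, rfl⟩ := hA.exists_isHermitian_sq
  obtain ⟨D, hD, rfl⟩ := hB.exists_isHermitian_sq
  have h1 : ((D * C)ᴴ * (D * C)).trace = 0 := by
    rw [conjTranspose_mul, hC, hD, ← h, mul_assoc C C, trace_mul_comm C]
    simp only [mul_assoc]
  have h2 := trace_conjTranspose_mul_self_eq_zero_iff.1 h1
  rw [mul_assoc, ← mul_assoc D C, h2, zero_mul, mul_zero]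

variable {X : Type*} [Fintype X]

/-- A positive operator-valued measure with outcomes in `X`. -/
def IsPOVM (N : X → Op ι) : Prop := (∀ x, (N x).PosSemidef) ∧ ∑ x, N x = 1

/-- The outcome weights of the family of effects `N` on `ρ`. -/
def prob (N : X → Op ι) (ρ : Op ι) (x : X) : ℝ := (N x * ρ).trace.re

omit [Fintype X] in
theorem prob_nonneg {N : X → Op ι} (hN : ∀ x, (N x).PosSemidef) {ρ : Op ι} (hρ : ρ.PosSemidef)
    (x : X) : 0 ≤ prob N ρ x :=
  (Complex.le_def.1 (trace_mul_nonneg (hN x) hρ)).1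

omit [Fintype X] in
theorem ofReal_prob {N : X → Op ι} (hN : ∀ x, (N x).PosSemidef) {ρ : Op ι} (hρ : ρ.PosSemidef)
    (x : X) : (prob N ρ x : ℂ) = (N x * ρ).trace :=
  Complex.ext rfl (Complex.le_def.1 (trace_mul_nonneg (hN x) hρ)).2

theorem sum_prob {N : X → Op ι} (hN : ∑ x, N x = 1) (ρ : Op ι) :
    ∑ x, prob N ρ x = ρ.trace.re := by
  simp only [prob]
  rw [← Complex.re_sum, ← trace_sum, ← Finset.sum_mul, hN, one_mul]

-- A zero outcome weight forces `σ * N x = 0`, so the columns of `N x` lie in `ker σ`, hence in `ker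
-- ρ`.
omit [Fintype X] in
theorem prob_eq_zero {N : X → Op ι} (hN : ∀ x, (N x).PosSemidef) {ρ σ : Op ι}
    (hσ : σ.PosSemidef) (hker : ∀ v : ι → ℂ, σ *ᵥ v = 0 → ρ *ᵥ v = 0)
    (x : X) (h : prob N σ x = 0) : prob N ρ x = 0 := by
  have h1 := mul_eq_zero_of_trace_eq_zero (hN x) hσ (by rw [← ofReal_prob hN hσ, h]; simp)
  have h2 : ρ * N x = 0 := by
    ext i j
    have := hker ((N x).col j) (by
      ext k
      exact congrFun (congrFun h1 k) j)
    exact congrFun this i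
  rw [prob, trace_mul_comm, h2]
  simp

theorem trace_diagonal_mul_mul_diagonal_mul (d e : ι → ℂ) (C D : Op ι) :
    (diagonal d * C * diagonal e * Dᴴ).trace = ∑ i, ∑ j, d i * e j * (C i j * star (D i j)) := by
  simp only [trace, diag, mul_apply (M := diagonal d * C * diagonal e), mul_diagonal, diagonal_mul,
    conjTranspose_apply]
  exact Finset.sum_congr rfl fun i _ => Finset.sum_congr rfl fun j _ => by ring

/-- The difference is the operator variance `∑ (y x - Y) N x (y x - Y)ᴴ`. -/
theorem kadison {N : X → Op ι} (hN : IsPOVM N) (y : X → ℝ) :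
    (∑ x, (y x ^ 2 : ℝ) • N x - (∑ x, y x • N x) * (∑ x, y x • N x)).PosSemidef := by
  set Y := ∑ x, y x • N x with hY
  have hYh : Y.IsHermitian := by
    rw [hY, IsHermitian, conjTranspose_sum]
    refine Finset.sum_congr rfl fun x _ => ?_
    rw [conjTranspose_smul, (hN.1 x).1]
    simp
  have h : ∑ x, (y x ^ 2 : ℝ) • N x - Y * Y =
      ∑ x, (y x • (1 : Op ι) - Y) * N x * (y x • (1 : Op ι) - Y)ᴴ := by
    have : ∀ x, (y x • (1 : Op ι) - Y) * N x * (y x • (1 : Op ι) - Y)ᴴ =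
        (y x ^ 2 : ℝ) • N x - Y * (y x • N x) - (y x • N x) * Y + Y * N x * Y := fun x => by
      rw [conjTranspose_sub, conjTranspose_smul, hYh, conjTranspose_one]
      simp only [sub_mul, mul_sub, smul_mul_assoc, mul_smul_comm, one_mul, mul_one, star_trivial,
        smul_sub, smul_smul, pow_two]
      abel
    simp only [this, Finset.sum_add_distrib, Finset.sum_sub_distrib, ← Finset.sum_mul,
      ← Finset.mul_sum, hN.2, ← hY]
    noncomm_ring
  rw [h]
  exact posSemidef_sum _ fun x _ => (hN.1 x).mul_mul_conjTranspose_same _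

/-- The measured relative entropy is at most the quantum relative entropy. -/
theorem klSum_prob_le {N : X → Op ι} (hN : IsPOVM N) {ρ σ : Op ι} (hρ : ρ.PosSemidef)
    (hσ : σ.PosSemidef) (hker : ∀ v : ι → ℂ, σ *ᵥ v = 0 → ρ *ᵥ v = 0) :
    klSum (prob N ρ) (prob N σ) ≤
      ((ρ * cfc Real.log ρ).trace - (ρ * cfc Real.log σ).trace).re := by
  set U : Op ι := (hρ.1.eigenvectorUnitary).1 with hU
  set V : Op ι := (hσ.1.eigenvectorUnitary).1 with hV
  set r := hρ.1.eigenvalues with hr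
  set s := hσ.1.eigenvalues with hs
  have hUU' : U * Uᴴ = 1 := hρ.1.eigenvectorUnitary_mul_conjTranspose
  have hVV : Vᴴ * V = 1 := hσ.1.eigenvectorUnitary_conjTranspose_mul
  have hVV' : V * Vᴴ = 1 := hσ.1.eigenvectorUnitary_mul_conjTranspose
  have hUc : ∀ M : Op ι, U * (Uᴴ * M) = M := fun M => by rw [← mul_assoc, hUU', one_mul]
  have hVc : ∀ M : Op ι, V * (Vᴴ * M) = M := fun M => by rw [← mul_assoc, hVV', one_mul]
  have hρU : ρ = U * diagonal (fun i => (r i : ℂ)) * Uᴴ := hρ.1.eq_mul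
  have hσV : σ = V * diagonal (fun i => (s i : ℂ)) * Vᴴ := hσ.1.eq_mul
  have hr0 : ∀ i, 0 ≤ r i := hρ.eigenvalues_nonneg
  have hs0 : ∀ i, 0 ≤ s i := hσ.eigenvalues_nonneg
  set c : Op ι := Uᴴ * V with hc
  -- Nussbaum-Szkoła distributions: the two spectra weighted by the squared overlaps of the
  -- eigenbases. Their classical divergence equals the quantum relative entropy (`hent`).
  set P : ι × ι → ℝ := fun z => r z.1 * ‖c z.1 z.2‖ ^ 2 with hP
  set Q : ι × ι → ℝ := fun z => s z.2 * ‖c z.1 z.2‖ ^ 2 with hQ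
  have hsq : ∀ z : ℂ, z * star z = ((‖z‖ ^ 2 : ℝ) : ℂ) := fun z => by
    rw [← starRingEnd_apply, Complex.mul_conj, Complex.normSq_eq_norm_sq]
  have hgen : ∀ d e : ι → ℂ, (U * diagonal d * Uᴴ * (V * diagonal e * Vᴴ)).trace =
      ∑ i, ∑ j, d i * e j * ((‖c i j‖ ^ 2 : ℝ) : ℂ) := fun d e => by
    have h1 : (U * diagonal d * Uᴴ * (V * diagonal e * Vᴴ)).trace =
        (diagonal d * c * diagonal e * cᴴ).trace := by
      rw [hc, conjTranspose_mul, conjTranspose_conjTranspose]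
      rw [show U * diagonal d * Uᴴ * (V * diagonal e * Vᴴ) =
        U * (diagonal d * Uᴴ * V * diagonal e * Vᴴ) by simp only [mul_assoc], trace_mul_comm]
      simp only [mul_assoc]
    rw [h1, trace_diagonal_mul_mul_diagonal_mul]
    simp only [hsq]
  have honeV : V * diagonal (fun _ => (1 : ℂ)) * Vᴴ = 1 := by
    rw [diagonal_one, mul_one, hVV']
  have hPQ : ∀ z, Q z = 0 → P z = 0 := by
    rintro ⟨i, j⟩ h
    rcases mul_eq_zero.1 h with h | h
    · have h1 : σ * V = V * diagonal (fun i => (s i : ℂ)) := by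
        rw [hσV, mul_assoc, hVV, mul_one]
      have h2 : ρ *ᵥ V.col j = 0 := hker _ (by
        ext k
        refine (congrFun (congrFun h1 k) j).trans ?_
        rw [mul_diagonal, h]
        simp)
      have h3 : ∑ i, ((r i * ‖c i j‖ ^ 2 : ℝ) : ℂ) = 0 := by
        have h4 : (Vᴴ * (ρ * V)) j j = 0 := by
          rw [mul_apply]
          refine Finset.sum_eq_zero fun k _ => ?_
          rw [show (ρ * V) k j = 0 from congrFun h2 k, mul_zero]
        rw [← h4, show Vᴴ * (ρ * V) = cᴴ * diagonal (fun i => (r i : ℂ)) * c by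
          rw [hc, hρU, conjTranspose_mul, conjTranspose_conjTranspose]; simp only [mul_assoc],
          mul_apply]
        refine Finset.sum_congr rfl fun k _ => ?_
        rw [mul_diagonal, conjTranspose_apply, Complex.ofReal_mul, ← hsq]
        ring
      rw [← Complex.ofReal_sum, Complex.ofReal_eq_zero] at h3
      exact (Finset.sum_eq_zero_iff_of_nonneg fun k _ => mul_nonneg (hr0 k) (sq_nonneg _)).1 h3 i
        (Finset.mem_univ i)
    · simp only [hP] at *
      rw [h, mul_zero]
  have hent : ((ρ * cfc Real.log ρ).trace - (ρ * cfc Real.log σ).trace).re = klSum P Q := by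
    have h1 : ρ * cfc Real.log ρ = cfc (fun x => x * Real.log x) ρ := by
      nth_rw 1 [← cfc_id_of_isHermitian hρ.1]
      rw [cfc_mul_cfc hρ.1]
    have h2 : (ρ * cfc Real.log ρ).trace =
        ((∑ i, ∑ j, r i * Real.log (r i) * ‖c i j‖ ^ 2 : ℝ) : ℂ) := by
      rw [h1, hρ.1.cfc_eq_mul, ← mul_one (_ * _), ← honeV]
      refine (hgen _ _).trans ?_
      push_cast
      simp [hr]
    have h3 : (ρ * cfc Real.log σ).trace =
        ((∑ i, ∑ j, r i * Real.log (s j) * ‖c i j‖ ^ 2 : ℝ) : ℂ) := by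
      rw [hσ.1.cfc_eq_mul]
      nth_rw 1 [hρU]
      refine (hgen _ _).trans ?_
      push_cast
      rfl
    rw [h2, h3, ← Complex.ofReal_sub, Complex.ofReal_re, klSum, Fintype.sum_prod_type,
      ← Finset.sum_sub_distrib]
    refine Finset.sum_congr rfl fun i _ => ?_
    rw [← Finset.sum_sub_distrib]
    refine Finset.sum_congr rfl fun j _ => ?_
    by_cases hz : P (i, j) = 0
    · rw [hz, zero_mul]
      rcases mul_eq_zero.1 hz with h | h
      · simp only at h; rw [h]; ring
      · simp only at h; rw [h]; ring
    · have hz' : Q (i, j) ≠ 0 := fun h => hz (hPQ _ h)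
      have a1 := left_ne_zero_of_mul hz
      have a2 := right_ne_zero_of_mul hz
      have a3 := left_ne_zero_of_mul hz'
      simp only [hP, hQ]
      rw [Real.log_mul a1 a2, Real.log_mul a3 a2]
      ring
  rw [hent]
  refine klSum_le_of_rational (fun z => mul_nonneg (hr0 _) (sq_nonneg _))
    (fun z => mul_nonneg (hs0 _) (sq_nonneg _)) (prob_nonneg hN.1 hρ) (prob_nonneg hN.1 hσ) hPQ
    (prob_eq_zero hN.1 hσ hker) ?_ fun t ht => ?_
  · rw [sum_prob hN.2, Fintype.sum_prod_type, ← Complex.ofReal_re (∑ x, ∑ y, P (x, y))]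
    congr 1
    have := hgen (fun i => (r i : ℂ)) (fun _ => 1)
    rw [honeV, mul_one, ← hρU] at this
    rw [this]
    push_cast
    simp [hP]
  set p := prob N ρ with hp
  set q := prob N σ with hq
  have hp0 : ∀ x, 0 ≤ p x := prob_nonneg hN.1 hρ
  have hq0 : ∀ x, 0 ≤ q x := prob_nonneg hN.1 hσ
  -- `y` maximizes `2 y p - y² (q + t p)`, whose maximum is `p² / (q + t p)`. The same variational
  -- formula bounds the Nussbaum-Szkoła side from below.
  set y : X → ℝ := fun x => p x / (q x + t * p x) with hy
  set Y := ∑ x, y x • N x with hY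
  have hYh : Yᴴ = Y := by
    rw [hY, conjTranspose_sum]
    refine Finset.sum_congr rfl fun x _ => ?_
    rw [conjTranspose_smul, (hN.1 x).1, star_trivial]
  set w : Op ι := Uᴴ * Y * V with hw
  have hlin : ∀ (f : X → ℝ) (τ : Op ι), ((∑ x, f x • N x) * τ).trace.re = ∑ x, f x * prob N τ x :=
    fun f τ => by
      rw [Finset.sum_mul, trace_sum, Complex.re_sum]
      refine Finset.sum_congr rfl fun x _ => ?_
      rw [smul_mul_assoc, trace_smul, Complex.smul_re, smul_eq_mul, prob]
  have hkad : ∀ τ : Op ι, τ.PosSemidef → (Y * Y * τ).trace.re ≤ ∑ x, y x ^ 2 * prob N τ x :=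
    fun τ hτ => by
      have h := (Complex.le_def.1 (trace_mul_nonneg (kadison hN y) hτ)).1
      rw [sub_mul, trace_sub, Complex.sub_re, hlin, Complex.zero_re] at h
      linarith
  have hB : (Y * ρ).trace.re = ∑ i, ∑ j, r i * (w i j * star (c i j)).re := by
    have h1 : (Y * ρ).trace = (diagonal (fun i => (r i : ℂ)) * w * diagonal (fun _ => 1) * cᴴ).trace := by
      rw [hρU, hw, hc, diagonal_one, mul_one, conjTranspose_mul, conjTranspose_conjTranspose,
        show Y * (U * diagonal (fun i => (r i : ℂ)) * Uᴴ) =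
          Y * U * (diagonal (fun i => (r i : ℂ)) * Uᴴ) by simp only [mul_assoc], trace_mul_comm]
      simp only [mul_assoc, hVc]
    rw [h1, trace_diagonal_mul_mul_diagonal_mul, Complex.re_sum]
    simp only [Complex.re_sum, mul_one, Complex.re_ofReal_mul]
  have hC : (Y * Y * σ).trace.re = ∑ i, ∑ j, s j * ‖w i j‖ ^ 2 := by
    have h1 : (Y * Y * σ).trace =
        (diagonal (fun _ => 1) * w * diagonal (fun i => (s i : ℂ)) * wᴴ).trace := by
      rw [diagonal_one, one_mul, trace_mul_comm _ wᴴ, hσV, hw, conjTranspose_mul, conjTranspose_mul,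
        conjTranspose_conjTranspose, hYh,
        show Y * Y * (V * diagonal (fun i => (s i : ℂ)) * Vᴴ) =
          Y * Y * V * diagonal (fun i => (s i : ℂ)) * Vᴴ by simp only [mul_assoc], trace_mul_comm]
      simp only [mul_assoc, hUc]
    rw [h1, trace_diagonal_mul_mul_diagonal_mul, Complex.re_sum]
    simp only [Complex.re_sum, one_mul, Complex.re_ofReal_mul, hsq, Complex.ofReal_re]
  have hD : (Y * Y * ρ).trace.re = ∑ i, ∑ j, r i * ‖w i j‖ ^ 2 := by
    have h1 : (Y * Y * ρ).trace =
        (diagonal (fun i => (r i : ℂ)) * w * diagonal (fun _ => 1) * wᴴ).trace := by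
      rw [hρU, hw, diagonal_one, mul_one, conjTranspose_mul, conjTranspose_mul,
        conjTranspose_conjTranspose, hYh,
        show Y * Y * (U * diagonal (fun i => (r i : ℂ)) * Uᴴ) =
          Y * Y * U * (diagonal (fun i => (r i : ℂ)) * Uᴴ) by simp only [mul_assoc], trace_mul_comm]
      simp only [mul_assoc, hVc]
    rw [h1, trace_diagonal_mul_mul_diagonal_mul, Complex.re_sum]
    simp only [Complex.re_sum, mul_one, Complex.re_ofReal_mul, hsq, Complex.ofReal_re]
  have hcl : ∀ x, p x ^ 2 / (q x + t * p x) =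
      2 * (y x * p x) - y x ^ 2 * q x - t * (y x ^ 2 * p x) := fun x => by
    rcases eq_or_ne (q x + t * p x) 0 with h | h
    · have : p x = 0 := by
        have := hq0 x
        have := mul_nonneg ht.le (hp0 x)
        have h3 : t * p x = 0 := by linarith
        exact (mul_eq_zero.1 h3).resolve_left ht.ne'
      simp [this, hy]
    · have h1 : y x * (q x + t * p x) = p x := div_mul_cancel₀ _ h
      have h2 : p x ^ 2 / (q x + t * p x) = p x * y x := by
        simp only [hy]; ring
      rw [h2]
      linear_combination (y x) * h1
  -- Completing the square: the left side is the quadratic evaluated at the matrix entry `w i j`,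
  -- the right side its maximum.
  have hpt : ∀ i j, 2 * (r i * (w i j * star (c i j)).re) - s j * ‖w i j‖ ^ 2 -
      t * (r i * ‖w i j‖ ^ 2) ≤ P (i, j) ^ 2 / (Q (i, j) + t * P (i, j)) := fun i j => by
    have h1 : (w i j * star (c i j)).re ≤ ‖w i j‖ * ‖c i j‖ := by
      refine (Complex.re_le_norm _).trans (le_of_eq ?_)
      rw [norm_mul, norm_star]
    have h2 : P (i, j) ^ 2 / (Q (i, j) + t * P (i, j)) =
        r i ^ 2 * ‖c i j‖ ^ 2 / (s j + t * r i) := by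
      simp only [hP, hQ]
      rcases eq_or_ne ‖c i j‖ 0 with h | h
      · simp [h]
      · rw [show s j * ‖c i j‖ ^ 2 + t * (r i * ‖c i j‖ ^ 2) =
          (s j + t * r i) * ‖c i j‖ ^ 2 by ring, show (r i * ‖c i j‖ ^ 2) ^ 2 =
          r i ^ 2 * ‖c i j‖ ^ 2 * ‖c i j‖ ^ 2 by ring, mul_div_mul_right _ _ (pow_ne_zero 2 h)]
    rw [h2]
    have h3 := mul_le_mul_of_nonneg_left h1 (hr0 i)
    rcases eq_or_ne (s j + t * r i) 0 with h | h
    · have h4 := mul_nonneg ht.le (hr0 i)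
      have h5 : s j = 0 := by linarith [hs0 j]
      have h6 : r i = 0 := (mul_eq_zero.1 (by linarith : t * r i = 0)).resolve_left ht.ne'
      simp [h5, h6]
    · have hpos : 0 < s j + t * r i :=
        lt_of_le_of_ne (add_nonneg (hs0 j) (mul_nonneg ht.le (hr0 i))) h.symm
      rw [le_div_iff₀ hpos]
      nlinarith [sq_nonneg ((s j + t * r i) * ‖w i j‖ - r i * ‖c i j‖)]
  -- Kadison's inequality replaces `∑ y² N` by `Y²`, used for `σ` and for `ρ`.
  have e1 : ∑ x, p x ^ 2 / (q x + t * p x) ≤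
      2 * (Y * ρ).trace.re - (Y * Y * σ).trace.re - t * (Y * Y * ρ).trace.re := by
    have h1 := hkad σ hσ
    have h2 := mul_le_mul_of_nonneg_left (hkad ρ hρ) ht.le
    have h3 : (Y * ρ).trace.re = ∑ x, y x * p x := hlin y ρ
    simp only [hcl, Finset.sum_sub_distrib, ← Finset.mul_sum]
    rw [h3]
    linarith
  refine e1.trans ?_
  rw [hB, hC, hD, Fintype.sum_prod_type]
  simp only [Finset.mul_sum, ← Finset.sum_sub_distrib]
  exact Finset.sum_le_sum fun i _ => Finset.sum_le_sum fun j _ => hpt i j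

omit [DecidableEq ι] in
theorem sqrt_trace_mul_sqrt_trace {A B : Op ι} :
    ‖(A * B).trace‖ ≤ √(A * Aᴴ).trace.re * √(Bᴴ * B).trace.re := by
  have hA : ∀ C : Op ι, (C * Cᴴ).trace.re = ∑ i, ∑ j, ‖C i j‖ ^ 2 := fun C => by
    simp only [trace, diag, mul_apply, conjTranspose_apply, Complex.re_sum]
    refine Finset.sum_congr rfl fun i _ => Finset.sum_congr rfl fun j _ => ?_
    rw [← starRingEnd_apply, Complex.mul_conj, Complex.normSq_eq_norm_sq, Complex.ofReal_re]
  rw [trace_mul_comm Bᴴ B, hA, hA, Finset.sum_comm (s := Finset.univ) (f := fun i j => ‖B i j‖ ^ 2)]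
  simp only [← Fintype.sum_prod_type' (fun i j => ‖A i j‖ ^ 2),
    ← Fintype.sum_prod_type' (fun i j => ‖B j i‖ ^ 2)]
  refine le_trans ?_ (Real.sum_mul_le_sqrt_mul_sqrt Finset.univ (fun z : ι × ι => ‖A z.1 z.2‖)
    (fun z => ‖B z.2 z.1‖))
  rw [Fintype.sum_prod_type]
  simp only [trace, diag, mul_apply]
  refine (norm_sum_le _ _).trans (Finset.sum_le_sum fun i _ => (norm_sum_le _ _).trans
    (Finset.sum_le_sum fun j _ => ?_))
  rw [norm_mul]

/-- A contraction attaining the trace norm. -/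
theorem exists_trace_mul_eq_traceNorm (A : Op ι) :
    ∃ U : Op ι, (1 - Uᴴ * U).PosSemidef ∧ (U * A).trace = traceNorm A := by
  set H := Aᴴ * A with hH
  have hHp : H.PosSemidef := posSemidef_conjTranspose_mul_self A
  -- Since `(√0)⁻¹ = 0`, `cfc f H` is the pseudo-inverse of `√H`, and `cfc f H * Aᴴ` is the adjoint
  -- of the partial isometry in the polar decomposition of `A`.
  set f : ℝ → ℝ := fun t => (√t)⁻¹ with hf
  have hfh : (cfc f H)ᴴ = cfc f H := isHermitian_cfc hHp.1 f
  refine ⟨cfc f H * Aᴴ, ?_, ?_⟩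
  · have hUU : (cfc f H * Aᴴ)ᴴ * (cfc f H * Aᴴ) = A * cfc (fun t => f t * f t) H * Aᴴ := by
      rw [conjTranspose_mul, conjTranspose_conjTranspose, hfh, ← cfc_mul_cfc hHp.1]
      simp only [mul_assoc]
    have hproj : cfc (fun t => f t * f t) H * H * cfc (fun t => f t * f t) H =
        cfc (fun t => f t * f t) H := by
      nth_rw 2 [← cfc_id_of_isHermitian hHp.1]
      rw [cfc_mul_cfc hHp.1, cfc_mul_cfc hHp.1]
      refine cfc_congr_eigenvalues hHp.1 fun i => ?_
      have h0 := hHp.eigenvalues_nonneg i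
      rcases h0.eq_or_lt with h | h
      · simp [hf, ← h]
      · simp only [hf]
        rw [← mul_inv, Real.mul_self_sqrt h0]
        field_simp
    set G := A * cfc (fun t => f t * f t) H * Aᴴ with hG
    have hGh : Gᴴ = G := by
      rw [hG, conjTranspose_mul, conjTranspose_mul, conjTranspose_conjTranspose,
        (isHermitian_cfc hHp.1 _ : (cfc (fun t => f t * f t) H)ᴴ = _), mul_assoc]
    have hGG : G * G = G := by
      rw [hG]
      calc A * cfc (fun t => f t * f t) H * Aᴴ * (A * cfc (fun t => f t * f t) H * Aᴴ) =
          A * (cfc (fun t => f t * f t) H * H * cfc (fun t => f t * f t) H) * Aᴴ := by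
            rw [hH]; simp only [mul_assoc]
        _ = _ := by rw [hproj]
    rw [hUU]
    have : 1 - G = (1 - G)ᴴ * (1 - G) := by
      rw [conjTranspose_sub, conjTranspose_one, hGh, mul_sub, sub_mul, sub_mul, hGG]
      simp
    rw [this]
    exact posSemidef_conjTranspose_mul_self _
  · rw [mul_assoc, ← hH]
    nth_rw 2 [← cfc_id_of_isHermitian hHp.1]
    rw [cfc_mul_cfc hHp.1, traceNorm, ← hH, cfc_congr_eigenvalues hHp.1 (g := Real.sqrt)]
    · rw [trace_cfc hHp.1, ← Complex.ofReal_sum, Complex.ofReal_re]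
    · intro i
      have h0 := hHp.eigenvalues_nonneg i
      simp only [hf]
      rcases h0.eq_or_lt with h | h
      · simp [← h]
      · nth_rw 2 [← Real.mul_self_sqrt h0]
        field_simp

/-- The fidelity is at most the fidelity of the outcome distributions of any measurement. -/
theorem fidelity_le_fidSum {N : X → Op ι} (hN : IsPOVM N) {ρ σ : Op ι} (hρ : ρ.PosSemidef)
    (hσ : σ.PosSemidef) : fidelity ρ σ ≤ fidSum (prob N ρ) (prob N σ) := by
  obtain ⟨U, hU, hUt⟩ := exists_trace_mul_eq_traceNorm (cfc Real.sqrt ρ * cfc Real.sqrt σ)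
  rw [fidelity]
  set R := cfc Real.sqrt ρ with hR
  set S := cfc Real.sqrt σ with hS
  have hRh : Rᴴ = R := isHermitian_cfc hρ.1 _
  have hSh : Sᴴ = S := isHermitian_cfc hσ.1 _
  -- Insert `1 = ∑ N x` between the two square roots; Cauchy-Schwarz then applies to each outcome
  -- separately.
  have h1 : (traceNorm (R * S) : ℂ) = ∑ x, (U * R * N x * S).trace := by
    rw [← trace_sum, ← Finset.sum_mul, ← Finset.mul_sum, hN.2, ← hUt, mul_one, mul_assoc]
  have h2 : traceNorm (R * S) ≤ ∑ x, ‖(U * R * N x * S).trace‖ := by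
    refine le_trans (le_of_eq ?_) (norm_sum_le Finset.univ fun x => (U * R * N x * S).trace)
    rw [← h1, Complex.norm_real, Real.norm_of_nonneg (traceNorm_nonneg _)]
  refine h2.trans (Finset.sum_le_sum fun x _ => ?_)
  obtain ⟨B, hB, hBN⟩ := (hN.1 x).exists_isHermitian_sq
  have h3 : U * R * N x * S = (U * R * B) * (B * S) := by
    rw [hBN]; simp only [mul_assoc]
  rw [h3]
  refine sqrt_trace_mul_sqrt_trace.trans (mul_le_mul (Real.sqrt_le_sqrt ?_) (Real.sqrt_le_sqrt ?_)
    (Real.sqrt_nonneg _) (Real.sqrt_nonneg _))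
  · have h4 := (Complex.le_def.1 (trace_mul_nonneg hU
      ((hN.1 x).mul_mul_conjTranspose_same R))).1
    have h5 : (U * R * B * (U * R * B)ᴴ).trace = (Uᴴ * U * (R * N x * Rᴴ)).trace := by
      rw [conjTranspose_mul, conjTranspose_mul, hB.eq, hRh, hBN,
        show U * R * B * (B * (R * Uᴴ)) = U * R * B * (B * R) * Uᴴ by simp only [mul_assoc],
        trace_mul_comm]
      simp only [mul_assoc]
    have h6 : (R * N x * Rᴴ).trace = (N x * ρ).trace := by
      rw [hRh, mul_assoc, trace_mul_comm, mul_assoc, hR, cfc_sqrt_mul_self hρ]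
    rw [sub_mul, one_mul, trace_sub, h6, ← h5, Complex.sub_re, Complex.zero_re] at h4
    rw [prob]
    linarith
  · refine le_of_eq ?_
    rw [prob, conjTranspose_mul, hSh, hB.eq, mul_assoc, trace_mul_comm, ← mul_assoc, ← hBN, mul_assoc, hS,
      cfc_sqrt_mul_self hσ]

theorem fidelity_diagonal (p q : ι → ℝ) :
    fidelity (diagonal fun x => (p x : ℂ)) (diagonal fun x => (q x : ℂ)) = fidSum p q := by
  rw [fidelity, cfc_diagonal_ofReal, cfc_diagonal_ofReal, diagonal_mul_diagonal, traceNorm,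
    diagonal_conjTranspose, diagonal_mul_diagonal]
  have : (fun i => (star fun i => ((√(p i) : ℝ) : ℂ) * ((√(q i) : ℝ) : ℂ)) i *
      (((√(p i) : ℝ) : ℂ) * ((√(q i) : ℝ) : ℂ))) = fun i => (((√(p i) * √(q i)) ^ 2 : ℝ) : ℂ) := by
    ext i
    simp [pow_two]
  rw [this, cfc_diagonal_ofReal, trace_diagonal, ← Complex.ofReal_sum, Complex.ofReal_re, fidSum]
  exact Finset.sum_congr rfl fun i _ => Real.sqrt_sq (by positivity)

theorem relEntropy_diagonal {p q : ι → ℝ} (hpq : ∀ x, q x = 0 → p x = 0) :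
    relEntropy (diagonal fun x => (p x : ℂ)) (diagonal fun x => (q x : ℂ)) = (klSum p q : EReal) := by
  rw [relEntropy, if_pos]
  · congr 1
    rw [cfc_diagonal_ofReal, cfc_diagonal_ofReal, diagonal_mul_diagonal, diagonal_mul_diagonal,
      trace_diagonal, trace_diagonal, klSum]
    simp [mul_sub]
  · intro v hv
    ext x
    have h := congrFun hv x
    rw [mulVec_diagonal] at h ⊢
    rcases mul_eq_zero.1 h with h | h
    · rw [hpq x (by simpa using h)]; simp
    · rw [h]; simp

end Operators

/-! ### Pauli operators as Weyl operators indexed by `(ℤ/q)^V`. -/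

section Weyl

open Matrix

variable {q : ℕ} [NeZero q] {V : Type*} [Fintype V]

variable (q) in
/-- The primitive root of unity `exp (2πi/q)`. -/
def rootU : ℂ := Complex.exp (2 * Real.pi * Complex.I / q)

variable (q) in
theorem isPrimitiveRoot_rootU : IsPrimitiveRoot (rootU q) q :=
  Complex.isPrimitiveRoot_exp q (NeZero.ne q)

theorem norm_rootU : ‖rootU q‖ = 1 :=
  (isPrimitiveRoot_rootU q).norm'_eq_one (NeZero.ne q)

/-- The bicharacter of `(ℤ/q)^V`. -/
def bichar (b y : V → Fin q) : ℂ := ∏ v, rootU q ^ ((b v : ℕ) * (y v : ℕ))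

omit [NeZero q] in
theorem bichar_comm (b y : V → Fin q) : bichar b y = bichar y b := by
  simp only [bichar, mul_comm]

theorem bichar_add (b y z : V → Fin q) : bichar b (y + z) = bichar b y * bichar b z := by
  simp only [bichar, ← Finset.prod_mul_distrib]
  refine Finset.prod_congr rfl fun v _ => ?_
  rw [← pow_add, ← mul_add, Pi.add_apply, Fin.val_add, mul_comm (b v : ℕ), mul_comm (b v : ℕ),
    pow_mul, pow_mul, ← pow_eq_pow_mod _ (isPrimitiveRoot_rootU q).pow_eq_one]

theorem bichar_add_left (b c y : V → Fin q) : bichar (b + c) y = bichar b y * bichar c y := by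
  rw [bichar_comm, bichar_add, bichar_comm y b, bichar_comm y c]

@[simp] theorem bichar_zero (b : V → Fin q) : bichar b 0 = 1 := by
  simp [bichar]

@[simp] theorem bichar_zero_left (b : V → Fin q) : bichar 0 b = 1 := by
  rw [bichar_comm, bichar_zero]

@[simp] theorem norm_bichar (b y : V → Fin q) : ‖bichar b y‖ = 1 := by
  simp [bichar, norm_rootU]

theorem bichar_ne_zero (b y : V → Fin q) : bichar b y ≠ 0 := fun h => by
  simpa [h] using norm_bichar b y

theorem star_mul_self_of_norm_eq_one {z : ℂ} (h : ‖z‖ = 1) : star z * z = 1 := by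
  rw [← starRingEnd_apply, Complex.conj_mul', h]
  simp

theorem star_bichar_mul_self (b y : V → Fin q) : star (bichar b y) * bichar b y = 1 :=
  star_mul_self_of_norm_eq_one (norm_bichar b y)

theorem star_bichar (b y : V → Fin q) : star (bichar b y) = bichar b (-y) := by
  have h : bichar b (-y) * bichar b y = 1 := by rw [← bichar_add]; simp
  exact mul_right_cancel₀ (bichar_ne_zero b y) ((star_bichar_mul_self b y).trans h.symm)

theorem bichar_neg_left (b y : V → Fin q) : bichar (-b) y = star (bichar b y) := by
  rw [bichar_comm, ← star_bichar, bichar_comm]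

omit [NeZero q] in
theorem geom_sum_fin_eq_zero {z : ℂ} (hz : z ^ q = 1) (h1 : z ≠ 1) :
    ∑ j : Fin q, z ^ (j : ℕ) = 0 := by
  rw [Fin.sum_univ_eq_sum_range (fun j => z ^ j) q]
  have := mul_geom_sum z q
  rw [hz, sub_self] at this
  exact (mul_eq_zero.1 this).resolve_left (sub_ne_zero.2 h1)

theorem sum_bichar [DecidableEq V] (y : V → Fin q) :
    ∑ b : V → Fin q, bichar b y = if y = 0 then (q : ℂ) ^ Fintype.card V else 0 := by
  have h : ∑ b : V → Fin q, bichar b y = ∏ v, ∑ j : Fin q, (rootU q ^ (y v : ℕ)) ^ (j : ℕ) := by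
    rw [Finset.prod_univ_sum, Fintype.piFinset_univ]
    refine Finset.sum_congr rfl fun b _ => Finset.prod_congr rfl fun v _ => ?_
    rw [← pow_mul, mul_comm]
  rw [h]
  split_ifs with hy
  · simp [hy]
  · obtain ⟨v, hv⟩ := Function.ne_iff.1 hy
    refine Finset.prod_eq_zero (Finset.mem_univ v) (geom_sum_fin_eq_zero ?_ fun h1 => hv ?_)
    · rw [← pow_mul, mul_comm, pow_mul, (isPrimitiveRoot_rootU q).pow_eq_one, one_pow]
    · have := (isPrimitiveRoot_rootU q).pow_inj (y v).isLt (Nat.pos_of_neZero q)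
        (by rw [h1, pow_zero])
      exact Fin.ext (by simpa using this)

/-- The Weyl operators `X ^ a Z ^ b`. -/
def weyl (a b : V → Fin q) : Op (V → Fin q) :=
  Matrix.of fun x y => if x = y + a then bichar b y else 0

omit [NeZero q] in
theorem weyl_apply (a b x y : V → Fin q) :
    weyl a b x y = if x = y + a then bichar b y else 0 := rfl

theorem shiftX_pow_apply (n : ℕ) (i j : Fin q) :
    (shiftX q ^ n) i j = if i = j + Fin.ofNat q n then 1 else 0 := by
  induction n generalizing i with
  | zero =>
    have : Fin.ofNat q 0 = 0 := by ext; simp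
    rw [pow_zero, this, add_zero, one_apply]
  | succ n ih =>
    have : Fin.ofNat q (n + 1) = Fin.ofNat q n + 1 := by
      ext; simp [Fin.val_add, Nat.add_mod]
    rw [pow_succ', mul_apply, Finset.sum_eq_single (j + Fin.ofNat q n)]
    · rw [ih, if_pos rfl, mul_one, shiftX, of_apply, this, add_assoc]
    · intro k _ hk
      rw [ih, if_neg hk, mul_zero]
    · simp

theorem pauliString_eq_weyl (a b : V → ℕ) :
    pauliString a b = weyl (q := q) (fun v => Fin.ofNat q (a v)) (fun v => Fin.ofNat q (b v)) := by
  ext x y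
  have h : ∀ v, (shiftX q ^ a v * clockZ q ^ b v) (x v) (y v) =
      if x v = y v + Fin.ofNat q (a v) then rootU q ^ ((Fin.ofNat q (b v) : ℕ) * (y v : ℕ)) else 0 := by
    intro v
    rw [clockZ, diagonal_pow, mul_diagonal, shiftX_pow_apply]
    split_ifs
    · rw [one_mul, Pi.pow_apply, ← pow_mul]
      change rootU q ^ _ = _
      rw [mul_comm, pow_mul, pow_mul, Fin.val_ofNat,
        ← pow_eq_pow_mod _ (isPrimitiveRoot_rootU q).pow_eq_one]
    · rw [zero_mul]
  rw [pauliString, of_apply, weyl_apply]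
  simp only [h]
  split_ifs with hx
  · exact Finset.prod_congr rfl fun v _ => if_pos (congrFun hx v)
  · obtain ⟨v, hv⟩ := Function.ne_iff.1 hx
    exact Finset.prod_eq_zero (Finset.mem_univ v) (if_neg hv)

theorem isPauli_iff {g : Op (V → Fin q)} :
    IsPauli g ↔ ∃ (c : ℂ) (a b : V → Fin q), ‖c‖ = 1 ∧ g = c • weyl a b := by
  constructor
  · rintro ⟨c, a, b, hc, rfl⟩
    exact ⟨c, _, _, hc, by rw [pauliString_eq_weyl]⟩
  · rintro ⟨c, a, b, hc, rfl⟩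
    refine ⟨c, fun v => a v, fun v => b v, hc, ?_⟩
    rw [pauliString_eq_weyl]
    simp

theorem isPauli_weyl (a b : V → Fin q) : IsPauli (weyl a b) :=
  isPauli_iff.2 ⟨1, a, b, by simp, by simp⟩

theorem IsPauli.smul {g : Op (V → Fin q)} (hg : IsPauli g) {c : ℂ} (hc : ‖c‖ = 1) :
    IsPauli (c • g) := by
  obtain ⟨d, a, b, hd, rfl⟩ := hg
  exact ⟨c * d, a, b, by simp [hc, hd], by rw [smul_smul]⟩

theorem weyl_zero : weyl (0 : V → Fin q) 0 = 1 := by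
  ext x y
  simp [weyl_apply, one_apply]

theorem isPauli_one : IsPauli (1 : Op (V → Fin q)) := weyl_zero (q := q) (V := V) ▸ isPauli_weyl 0 0

theorem conjTranspose_weyl (a b : V → Fin q) :
    (weyl a b)ᴴ = bichar b a • weyl (-a) (-b) := by
  ext x y
  rw [conjTranspose_apply, Matrix.smul_apply, weyl_apply, weyl_apply, smul_eq_mul]
  by_cases h : y = x + a
  · rw [if_pos h, if_pos (by rw [h]; abel), h, bichar_neg_left, bichar_add, star_mul',
      mul_left_comm, mul_comm (bichar b a), star_bichar_mul_self, mul_one]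
  · rw [if_neg h, if_neg (fun h' => h (by rw [h']; abel))]
    simp

variable [DecidableEq V]

theorem weyl_mul (a b a' b' : V → Fin q) :
    weyl a b * weyl a' b' = bichar b a' • weyl (a + a') (b + b') := by
  ext x z
  rw [mul_apply, Finset.sum_eq_single (z + a')]
  · rw [weyl_apply, weyl_apply, if_pos rfl, Matrix.smul_apply, weyl_apply, bichar_add, bichar_add_left,
      add_assoc, add_comm a' a]
    split_ifs
    · simp only [smul_eq_mul]; ring
    · simp
  · intro y _ hy
    rw [weyl_apply a' b', if_neg hy, mul_zero]
  · simp

theorem IsPauli.mul {g h : Op (V → Fin q)} (hg : IsPauli g) (hh : IsPauli h) : IsPauli (g * h) := by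
  obtain ⟨c, a, b, hc, rfl⟩ := isPauli_iff.1 hg
  obtain ⟨d, a', b', hd, rfl⟩ := isPauli_iff.1 hh
  rw [smul_mul_smul_comm, weyl_mul, smul_smul]
  exact (isPauli_weyl _ _).smul (by simp [hc, hd])

theorem conjTranspose_weyl_mul_self (a b : V → Fin q) : (weyl a b)ᴴ * weyl a b = 1 := by
  ext x z
  rw [mul_apply, Finset.sum_eq_single (x + a)]
  · rw [conjTranspose_apply, weyl_apply, if_pos rfl, weyl_apply, one_apply]
    by_cases h : x = z
    · rw [h, if_pos rfl, if_pos rfl, star_bichar_mul_self]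
    · rw [if_neg h, if_neg fun h' => h (add_right_cancel h'), mul_zero]
  · intro y _ hy
    rw [conjTranspose_apply, weyl_apply, if_neg hy, star_zero, zero_mul]
  · simp

omit [DecidableEq V] in
theorem IsPauli.conjTranspose {g : Op (V → Fin q)} (hg : IsPauli g) : IsPauli gᴴ := by
  obtain ⟨c, a, b, hc, rfl⟩ := isPauli_iff.1 hg
  rw [conjTranspose_smul, conjTranspose_weyl]
  exact ((isPauli_weyl _ _).smul (norm_bichar _ _)).smul (by simpa using hc)

theorem IsPauli.conjTranspose_mul_self {g : Op (V → Fin q)} (hg : IsPauli g) : gᴴ * g = 1 := by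
  obtain ⟨c, a, b, hc, rfl⟩ := isPauli_iff.1 hg
  rw [conjTranspose_smul, smul_mul_smul_comm, conjTranspose_weyl_mul_self,
    star_mul_self_of_norm_eq_one hc, one_smul]

theorem IsPauli.mul_conjTranspose_self {g : Op (V → Fin q)} (hg : IsPauli g) : g * gᴴ = 1 :=
  mul_eq_one_comm.1 hg.conjTranspose_mul_self

/-- Pauli operators commute up to a phase. -/
theorem IsPauli.exists_mul_eq_smul {g h : Op (V → Fin q)} (hg : IsPauli g) (hh : IsPauli h) :
    ∃ ω : ℂ, g * h = ω • (h * g) := by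
  obtain ⟨c, a, b, -, rfl⟩ := isPauli_iff.1 hg
  obtain ⟨d, a', b', -, rfl⟩ := isPauli_iff.1 hh
  refine ⟨bichar b a' / bichar b' a, ?_⟩
  simp only [smul_mul_smul_comm, weyl_mul, smul_smul]
  rw [add_comm a a', add_comm b b']
  congr 1
  have := bichar_ne_zero b' a
  field_simp

/-- The expansion of an operator in the Weyl basis. -/
theorem sum_trace_weyl_smul (M : Op (V → Fin q)) :
    ∑ a, ∑ b, ((weyl a b)ᴴ * M).trace • weyl a b = ((q : ℂ) ^ Fintype.card V) • M := by
  ext y x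
  have htr : ∀ a b, ((weyl a b)ᴴ * M).trace = ∑ u, star (bichar b u) * M (u + a) u := fun a b => by
    simp only [trace, diag, mul_apply, conjTranspose_apply, weyl_apply]
    refine Finset.sum_congr rfl fun u _ => ?_
    rw [Finset.sum_eq_single (u + a)]
    · rw [if_pos rfl]
    · intro k _ hk
      rw [if_neg hk, star_zero, zero_mul]
    · simp
  simp only [Matrix.sum_apply, Matrix.smul_apply, smul_eq_mul, htr, weyl_apply]
  -- Only the shift `y - x` reaches the entry `(y, x)`; the sum over characters `b` then isolates `u
  -- = x`.
  rw [Finset.sum_eq_single (y - x)]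
  · simp only [add_sub_cancel, if_true, Finset.sum_mul]
    rw [Finset.sum_comm]
    have : ∀ u, ∑ b, star (bichar b u) * M (u + (y - x)) u * bichar b x =
        M (u + (y - x)) u * if x - u = 0 then (q : ℂ) ^ Fintype.card V else 0 := fun u => by
      rw [← sum_bichar, Finset.mul_sum]
      refine Finset.sum_congr rfl fun b _ => ?_
      rw [star_bichar, sub_eq_add_neg x, bichar_add]
      ring
    simp only [this]
    rw [Finset.sum_eq_single x]
    · rw [if_pos (sub_self x)]
      simp [mul_comm]
    · intro u _ hu
      rw [if_neg (sub_ne_zero.2 hu.symm), mul_zero]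
    · simp
  · intro a _ ha
    refine Finset.sum_eq_zero fun b _ => ?_
    rw [if_neg fun h => ha (by rw [h]; abel), mul_zero]
  · simp

/-- Configurations on `V` as pairs of configurations on `A` and on its complement. -/
abbrev glue (A : Finset V) :
    ((A → Fin q) × ({v // v ∉ A} → Fin q)) ≃ (V → Fin q) :=
  (Equiv.piEquivPiSubtypeProd (fun v => v ∈ A) fun _ => Fin q).symm

omit [NeZero q] [Fintype V] in
theorem glue_apply_mem {A : Finset V} (p : (A → Fin q) × ({v // v ∉ A} → Fin q)) (v : A) :
    glue A p v = p.1 v := by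
  simp [glue, Equiv.piEquivPiSubtypeProd]

omit [NeZero q] [Fintype V] in
theorem glue_apply_notMem {A : Finset V} (p : (A → Fin q) × ({v // v ∉ A} → Fin q))
    (v : {v // v ∉ A}) : glue A p v = p.2 v := by
  simp [glue, Equiv.piEquivPiSubtypeProd, v.2]

omit [NeZero q] in
theorem bichar_glue (A : Finset V) (b : V → Fin q) (p : (A → Fin q) × ({v // v ∉ A} → Fin q)) :
    bichar b (glue A p) = bichar (fun v : A => b v) p.1 * bichar (fun v : {v // v ∉ A} => b v) p.2 := by
  simp only [bichar, ← glue_apply_mem p, ← glue_apply_notMem p]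
  convert (Fintype.prod_subtype_mul_prod_subtype (fun v => v ∈ A)
    fun v => rootU q ^ ((b v : ℕ) * (glue A p v : ℕ))).symm

omit [NeZero q] in
theorem weyl_glue (A : Finset V) (a b : V → Fin q) (p p' : (A → Fin q) × ({v // v ∉ A} → Fin q)) :
    weyl a b (glue A p) (glue A p') =
      weyl (fun v : A => a v) (fun v : A => b v) p.1 p'.1 *
        weyl (fun v : {v // v ∉ A} => a v) (fun v : {v // v ∉ A} => b v) p.2 p'.2 := by
  have h : glue A p = glue A p' + a ↔
      (p.1 = p'.1 + fun v : A => a v) ∧ (p.2 = p'.2 + fun v : {v // v ∉ A} => a v) := by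
    constructor
    · intro h
      constructor
      · ext1 v
        have := congrFun h v
        rwa [Pi.add_apply, glue_apply_mem, glue_apply_mem] at this
      · ext1 v
        have := congrFun h v
        rwa [Pi.add_apply, glue_apply_notMem, glue_apply_notMem] at this
    · rintro ⟨h1, h2⟩
      ext1 v
      by_cases hv : v ∈ A
      · have := congrFun h1 ⟨v, hv⟩
        rwa [← glue_apply_mem p ⟨v, hv⟩, Pi.add_apply, ← glue_apply_mem p' ⟨v, hv⟩] at this
      · have := congrFun h2 ⟨v, hv⟩
        rwa [← glue_apply_notMem p ⟨v, hv⟩, Pi.add_apply, ← glue_apply_notMem p' ⟨v, hv⟩] at this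
  simp only [weyl_apply, h, bichar_glue]
  by_cases h1 : p.1 = p'.1 + fun v : A => a v <;>
    by_cases h2 : p.2 = p'.2 + fun v : {v // v ∉ A} => a v <;> simp [h1, h2]

end Weyl

/-! ### Stabilizer vectors and the operations preserving them. -/

section StabVec

open Matrix
open scoped ComplexOrder

variable {q : ℕ} [NeZero q] {V : Type*} [Fintype V] [DecidableEq V]

/-- A vector `φ` is a stabilizer vector if the vectors fixed by all Pauli operators fixing `φ` are
multiples of `φ`. The zero vector qualifies. -/
def IsStabVec (φ : (V → Fin q) → ℂ) : Prop :=
  ∀ w : (V → Fin q) → ℂ, (∀ g, IsPauli g → g *ᵥ φ = φ → g *ᵥ w = w) → ∃ c : ℂ, w = c • φ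

theorem exists_dotProduct_star_self {ι : Type*} [Fintype ι] {φ : ι → ℂ} (h : φ ≠ 0) :
    ∃ r : ℝ, 0 < r ∧ star φ ⬝ᵥ φ = r := by
  have := Matrix.dotProduct_star_self_pos_iff.2 h
  exact ⟨(star φ ⬝ᵥ φ).re, (Complex.lt_def.1 this).1,
    Complex.ext rfl (Complex.lt_def.1 this).2.symm⟩

/-- A group of Pauli operators fixing a nonzero vector is a stabilizer group. -/
theorem isStabilizerGroup_of_fixed {S : Subgroup (Op (V → Fin q))ˣ}
    (hS : ∀ g ∈ S, IsPauli (g : Op (V → Fin q))) {φ : (V → Fin q) → ℂ} (hφ : φ ≠ 0)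
    (h : ∀ g ∈ S, (g : Op (V → Fin q)) *ᵥ φ = φ) : IsStabilizerGroup S := by
  have hc : ∀ c : ℂ, c • φ = φ → c = 1 := fun c hc => by
    have : (c - 1) • φ = 0 := by rw [sub_smul, hc, one_smul, sub_self]
    exact sub_eq_zero.1 ((smul_eq_zero.1 this).resolve_right hφ)
  refine ⟨hS, fun g hg k hk => ?_, fun g hg c hgc => ?_⟩
  · obtain ⟨ω, hω⟩ := (hS g hg).exists_mul_eq_smul (hS k hk)
    have h1 := congrArg (· *ᵥ φ) hω
    simp only [smul_mulVec, ← mulVec_mulVec, h g hg, h k hk] at h1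
    rw [hc ω h1.symm, one_smul] at hω
    exact Units.ext hω
  · have h1 := h g hg
    rw [hgc, smul_mulVec, one_mulVec] at h1
    rw [hc c h1, one_smul] at hgc
    exact Units.ext hgc

/-- A Pauli operator as a unit of the matrix ring. -/
def pauliUnit {g : Op (V → Fin q)} (hg : IsPauli g) : (Op (V → Fin q))ˣ :=
  ⟨g, gᴴ, hg.mul_conjTranspose_self, hg.conjTranspose_mul_self⟩

theorem coe_inv_of_isPauli {u : (Op (V → Fin q))ˣ} (hu : IsPauli (u : Op (V → Fin q))) :
    ((u⁻¹ : (Op (V → Fin q))ˣ) : Op (V → Fin q)) = (u : Op (V → Fin q))ᴴ :=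
  Units.inv_eq_of_mul_eq_one_right hu.mul_conjTranspose_self

/-- The group of Pauli operators fixing `φ`. -/
def stabGroup (φ : (V → Fin q) → ℂ) : Subgroup (Op (V → Fin q))ˣ where
  carrier := {u | IsPauli (u : Op (V → Fin q)) ∧ (u : Op (V → Fin q)) *ᵥ φ = φ}
  mul_mem' := fun {a b} ha hb => ⟨ha.1.mul hb.1, by
    rw [Units.val_mul, ← mulVec_mulVec, hb.2, ha.2]⟩
  one_mem' := ⟨isPauli_one, by simp⟩
  inv_mem' := fun {a} ha => by
    refine ⟨coe_inv_of_isPauli ha.1 ▸ ha.1.conjTranspose, ?_⟩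
    nth_rw 1 [← ha.2]
    rw [mulVec_mulVec, Units.inv_mul, one_mulVec]

theorem IsStabVec.isPureStab {φ : (V → Fin q) → ℂ} (h : IsStabVec φ) (h1 : star φ ⬝ᵥ φ = 1) :
    IsPureStab (vecMulVec φ (star φ)) := by
  have h0 : φ ≠ 0 := by rintro rfl; simp at h1
  refine ⟨stabGroup φ, φ, isStabilizerGroup_of_fixed (fun g hg => hg.1) h0 (fun g hg => hg.2), h1,
    fun w => ⟨fun hw => h w fun g hg hgφ => hw (pauliUnit hg) ⟨hg, hgφ⟩, ?_⟩, rfl⟩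
  rintro ⟨c, rfl⟩ g hg
  rw [mulVec_smul, hg.2]

theorem IsPureStab.exists_isStabVec {τ : Op (V → Fin q)} (h : IsPureStab τ) :
    ∃ φ, IsStabVec φ ∧ star φ ⬝ᵥ φ = 1 ∧ τ = vecMulVec φ (star φ) := by
  obtain ⟨S, φ, hS, h1, hφ, rfl⟩ := h
  refine ⟨φ, fun w hw => (hφ w).1 fun g hg => hw g (hS.1 g hg) ?_, h1, rfl⟩
  exact (hφ φ).2 ⟨1, (one_smul _ _).symm⟩ g hg

theorem star_dotProduct_mulVec {ι : Type*} [Fintype ι] (M : Op ι) (u v : ι → ℂ) :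
    star u ⬝ᵥ (M *ᵥ v) = star (Mᴴ *ᵥ u) ⬝ᵥ v := by
  rw [star_mulVec, conjTranspose_conjTranspose, dotProduct_mulVec]

theorem IsPauli.star_mulVec_dotProduct_mulVec {g : Op (V → Fin q)} (hg : IsPauli g)
    (u v : (V → Fin q) → ℂ) : star (g *ᵥ u) ⬝ᵥ (g *ᵥ v) = star u ⬝ᵥ v := by
  rw [star_dotProduct_mulVec, mulVec_mulVec, hg.conjTranspose_mul_self, one_mulVec]

theorem IsPauli.norm_eq_one_of_mulVec_eq_smul {g : Op (V → Fin q)} (hg : IsPauli g)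
    {φ : (V → Fin q) → ℂ} (hφ : φ ≠ 0) {c : ℂ} (h : g *ᵥ φ = c • φ) : ‖c‖ = 1 := by
  obtain ⟨r, hr, hrφ⟩ := exists_dotProduct_star_self hφ
  have h1 := hg.star_mulVec_dotProduct_mulVec φ φ
  rw [h, star_smul, smul_dotProduct, dotProduct_smul, hrφ, smul_smul, smul_eq_mul] at h1
  have h2 : star c * c = 1 := mul_right_cancel₀ (Complex.ofReal_ne_zero.2 hr.ne') (h1.trans (one_mul _).symm)
  rw [← starRingEnd_apply, Complex.conj_mul'] at h2
  have h3 : ‖c‖ ^ 2 = 1 := by exact_mod_cast h2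
  exact (pow_eq_one_iff_of_nonneg (norm_nonneg c) two_ne_zero).1 h3

/-- A stabilizer vector is either an eigenvector of a Pauli operator or mapped by it to an
orthogonal vector. -/
theorem IsStabVec.eigen_or_orthogonal {φ : (V → Fin q) → ℂ} (h : IsStabVec φ) (hφ : φ ≠ 0)
    {g : Op (V → Fin q)} (hg : IsPauli g) :
    (∃ c : ℂ, ‖c‖ = 1 ∧ g *ᵥ φ = c • φ) ∨ star φ ⬝ᵥ (g *ᵥ φ) = 0 := by
  -- If `g` commutes with the stabilizer of `φ`, then `g φ` is fixed by it too. Otherwise some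
  -- stabilizing `k` satisfies `k g = ω g k` with `ω ≠ 1`, and unitarity of `k` gives `⟨φ, gφ⟩ = ω
  -- ⟨φ, gφ⟩`.
  by_cases hc : ∀ k, IsPauli k → k *ᵥ φ = φ → k * g = g * k
  · left
    obtain ⟨c, hc⟩ := h (g *ᵥ φ) fun k hk hkφ => by
      rw [mulVec_mulVec, hc k hk hkφ, ← mulVec_mulVec, hkφ]
    exact ⟨c, hg.norm_eq_one_of_mulVec_eq_smul hφ hc, hc⟩
  · right
    push Not at hc
    obtain ⟨k, hk, hkφ, hne⟩ := hc
    obtain ⟨ω, hω⟩ := hk.exists_mul_eq_smul hg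
    have h1 : star φ ⬝ᵥ (g *ᵥ φ) = ω * (star φ ⬝ᵥ (g *ᵥ φ)) := by
      conv_lhs => rw [← hk.star_mulVec_dotProduct_mulVec, mulVec_mulVec, hω, smul_mulVec,
        ← mulVec_mulVec, hkφ, dotProduct_smul, smul_eq_mul]
    have h2 : (1 - ω) * (star φ ⬝ᵥ (g *ᵥ φ)) = 0 := by linear_combination h1
    refine (mul_eq_zero.1 h2).resolve_left fun h3 => hne ?_
    rw [hω, ← sub_eq_zero.1 h3, one_smul]

/-- The Pauli operator `-1` fixes 0 but no nonzero vector. Admitting 0 spares case distinctions when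
a projection annihilates a state. -/
theorem isStabVec_zero : IsStabVec (0 : (V → Fin q) → ℂ) := fun w hw => by
  have h := hw ((-1 : ℂ) • 1) (isPauli_one.smul (by simp)) (by simp)
  refine ⟨0, ?_⟩
  rw [smul_mulVec, one_mulVec, neg_one_smul, neg_eq_self] at h
  simp [h]

theorem mul_vecMulVec_star_mul {ι κ : Type*} [Fintype ι] (K : Matrix κ ι ℂ) (φ : ι → ℂ) :
    K * vecMulVec φ (star φ) * Kᴴ = vecMulVec (K *ᵥ φ) (star (K *ᵥ φ)) := by
  rw [mul_vecMulVec, vecMulVec_mul, star_mulVec]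

theorem vecMulVec_mulVec_eq_smul {ι : Type*} [Fintype ι] (u v w : ι → ℂ) :
    vecMulVec u v *ᵥ w = (v ⬝ᵥ w) • u := by
  ext i
  simp only [mulVec, vecMulVec_apply, dotProduct, Pi.smul_apply, smul_eq_mul, Finset.sum_mul]
  exact Finset.sum_congr rfl fun j _ => by ring

/-- Images of stabilizer vectors under an operator which intertwines Pauli operators. -/
theorem IsStabVec.map {W : Type*} [Fintype W] [DecidableEq W] {φ : (V → Fin q) → ℂ}
    (h : IsStabVec φ) (K : Matrix (W → Fin q) (V → Fin q) ℂ)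
    (h1 : ∀ g : Matrix (V → Fin q) (V → Fin q) ℂ, IsPauli g → K * g * Kᴴ = 0 ∨
      ∃ g' : Matrix (W → Fin q) (W → Fin q) ℂ, IsPauli g' ∧ K * g = g' * K)
    (h2 : ∀ w, (∀ g, IsPauli g → g *ᵥ (K *ᵥ φ) = K *ᵥ φ → g *ᵥ w = w) → (K * Kᴴ) *ᵥ w = w) :
    IsStabVec (K *ᵥ φ) := by
  rcases eq_or_ne φ 0 with rfl | hφ
  · rw [mulVec_zero]
    exact isStabVec_zero
  intro w hw
  rcases eq_or_ne w 0 with rfl | hw0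
  · exact ⟨0, by simp⟩
  obtain ⟨r, hr, hrφ⟩ := exists_dotProduct_star_self hφ
  have hKw := h2 w hw
  set N := vecMulVec φ (star φ) with hN
  have htr : ∀ g : Op (V → Fin q), (gᴴ * N).trace = star (star φ ⬝ᵥ (g *ᵥ φ)) := fun g => by
    rw [hN, mul_vecMulVec, trace_vecMulVec, dotProduct_comm, star_dotProduct_mulVec,
      conjTranspose_conjTranspose, star_dotProduct]
  let Wm : (V → Fin q) → (V → Fin q) → Matrix (V → Fin q) (V → Fin q) ℂ := weyl
  -- The identity term of the Weyl expansion contributes a strictly positive multiple of `w`.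
  have hone : ∃ s : ℝ, 0 < s ∧ ((Wm 0 0)ᴴ * N).trace • ((K * Wm 0 0 * Kᴴ) *ᵥ w) = (s : ℂ) • w := by
    refine ⟨r, hr, ?_⟩
    rw [htr, show Wm 0 0 = 1 from weyl_zero, one_mulVec, Matrix.mul_one, hKw, hrφ]
    simp
  -- A Weyl operator appears only if `φ` is an eigenvector of it. It is then either killed by `K ·
  -- Kᴴ` or carried to a Pauli which, up to the conjugate phase, fixes `K φ` and hence `w`; the
  -- phases cancel, so no term is negative.
  have hterm : ∀ a b : V → Fin q, ∃ s : ℝ, 0 ≤ s ∧ ((Wm a b)ᴴ * N).trace •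
      ((K * Wm a b * Kᴴ) *ᵥ w) = (s : ℂ) • w := fun a b => by
    rw [htr]
    rcases h.eigen_or_orthogonal hφ (isPauli_weyl a b) with ⟨c, hc, hcφ⟩ | h0
    · rcases h1 _ (isPauli_weyl a b) with h0 | ⟨g', hg', hK⟩
      · exact ⟨0, le_rfl, by rw [h0]; simp⟩
      · refine ⟨r, hr.le, ?_⟩
        have h3 : (star c • g') *ᵥ w = w := by
          refine hw _ (hg'.smul (by simpa using hc)) ?_
          rw [smul_mulVec, mulVec_mulVec, ← hK, ← mulVec_mulVec, hcφ, mulVec_smul, smul_smul,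
            star_mul_self_of_norm_eq_one hc, one_smul]
        rw [hK, Matrix.mul_assoc, ← mulVec_mulVec, hKw, hcφ, dotProduct_smul, hrφ, smul_eq_mul, star_mul',
          mul_comm, mul_smul, ← smul_mulVec, h3]
        simp
    · exact ⟨0, le_rfl, by rw [h0]; simp⟩
  choose s hs0 hs using hterm
  -- Applying `K |φ⟩⟨φ| Kᴴ` to `w` gives a multiple of `K φ` directly and a positive multiple of `w`
  -- through the expansion.
  have hsum : ((q : ℂ) ^ Fintype.card V * (star (K *ᵥ φ) ⬝ᵥ w)) • (K *ᵥ φ) =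
      ((∑ a, ∑ b, s a b : ℝ) : ℂ) • w := by
    rw [mul_smul, ← vecMulVec_mulVec_eq_smul, ← mul_vecMulVec_star_mul, ← smul_mulVec,
      ← Matrix.smul_mul, ← Matrix.mul_smul, ← hN,
      show ((q : ℂ) ^ Fintype.card V) • N = ∑ a, ∑ b, ((Wm a b)ᴴ * N).trace • Wm a b from
        (sum_trace_weyl_smul N).symm]
    simp only [Matrix.mul_sum, Matrix.sum_mul, sum_mulVec, Matrix.mul_smul, Matrix.smul_mul,
      smul_mulVec, hs]
    push_cast
    simp only [Finset.sum_smul]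
  have hpos : 0 < ∑ a, ∑ b, s a b := by
    refine Finset.sum_pos' (fun a _ => Finset.sum_nonneg fun b _ => hs0 a b) ⟨0, Finset.mem_univ _, ?_⟩
    refine Finset.sum_pos' (fun b _ => hs0 0 b) ⟨0, Finset.mem_univ _, ?_⟩
    obtain ⟨t, ht, htw⟩ := hone
    rw [hs 0 0] at htw
    have : (s 0 0 : ℂ) = t := smul_left_injective ℂ hw0 htw
    rw [Complex.ofReal_inj.1 this]
    exact ht
  refine ⟨((∑ a, ∑ b, s a b : ℝ) : ℂ)⁻¹ * ((q : ℂ) ^ Fintype.card V * (star (K *ᵥ φ) ⬝ᵥ w)), ?_⟩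
  rw [mul_smul, hsum, smul_smul, inv_mul_cancel₀ (Complex.ofReal_ne_zero.2 hpos.ne'), one_smul]

/-- The partial inner product of `φ` with the basis vector `z` on the complement of `A`. -/
def sliceVec (A : Finset V) (z : {v // v ∉ A} → Fin q) (φ : (V → Fin q) → ℂ) : (A → Fin q) → ℂ :=
  fun x => φ (glue A (x, z))

/-- The slice is the image under `1 ⊗ ⟨z|`. A Weyl operator that shifts outside `A` has zero
compression; any other restricts to a Weyl operator on `A`, up to a phase. -/
theorem isStabVec_sliceVec {φ : (V → Fin q) → ℂ} (h : IsStabVec φ) (A : Finset V)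
    (z : {v // v ∉ A} → Fin q) : IsStabVec (sliceVec A z φ) := by
  set K : Matrix (A → Fin q) (V → Fin q) ℂ := Matrix.of fun x y => if y = glue A (x, z) then 1 else 0
    with hK
  have hKφ : sliceVec A z φ = K *ᵥ φ := by
    ext x
    simp [hK, mulVec, dotProduct, Magic.sliceVec]
  have hKM : ∀ (M : Matrix (V → Fin q) (V → Fin q) ℂ) x y, (K * M) x y = M (glue A (x, z)) y := fun M x y => by
    simp [hK, mul_apply]
  have hKMK : ∀ (M : Matrix (V → Fin q) (V → Fin q) ℂ) x y, (K * M * Kᴴ) x y = M (glue A (x, z)) (glue A (y, z)) :=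
    fun M x y => by
      rw [mul_apply]
      simp only [hKM]
      simp [hK]
  rw [hKφ]
  refine h.map K (fun g hg => ?_) fun w _ => ?_
  · obtain ⟨c, a, b, hc, rfl⟩ := isPauli_iff.1 hg
    by_cases ha : (fun v : {v // v ∉ A} => a v) = 0
    · right
      refine ⟨(c * bichar (fun v : {v // v ∉ A} => b v) z) • weyl (fun v : A => a v) fun v : A => b v,
        (isPauli_weyl _ _).smul (by simp [hc]), ?_⟩
      ext x y
      obtain ⟨⟨x', z'⟩, rfl⟩ := (glue A).surjective y
      rw [hKM, Matrix.smul_apply, weyl_glue, mul_apply, Finset.sum_eq_single x']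
      · simp only [hK, of_apply, (glue A).injective.eq_iff, Prod.mk.injEq, true_and,
          Matrix.smul_apply, ha, weyl_apply _ _ z, add_zero, smul_eq_mul, eq_comm (a := z')]
        by_cases hz : z = z'
        · subst hz
          simp only [if_true]
          ring
        · simp [hz]
      · intro x'' _ hx
        simp [hK, (glue A).injective.eq_iff, hx.symm]
      · simp
    · left
      ext x y
      rw [hKMK, Matrix.smul_apply, weyl_glue, weyl_apply _ _ z, if_neg fun h => ha ?_]
      · simp
      · simpa using h
  · have : K * Kᴴ = 1 := by
      ext x y
      have := hKMK 1 x y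
      rw [Matrix.mul_one] at this
      simp only [this, one_apply, (glue A).injective.eq_iff]
      simp
    rw [this, one_mulVec]

/-- Projectors onto codes of Pauli operators preserve stabilizer vectors. -/
theorem IsStabVec.projector {φ : (V → Fin q) → ℂ} (h : IsStabVec φ) {K : Op (V → Fin q)}
    (hK : Kᴴ = K) (hKK : K * K = K) (T : Set (Op (V → Fin q))) (hT : ∀ g ∈ T, IsPauli g)
    (h1 : ∀ g ∈ T, g * K = K) (h2 : ∀ w, (∀ g ∈ T, g *ᵥ w = w) → K *ᵥ w = w) :
    IsStabVec (K *ᵥ φ) := by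
  have h1' : ∀ g ∈ T, K * g = K := fun g hg => by
    have h3 : gᴴ * K = K := by
      conv_lhs => rw [← h1 g hg, ← mul_assoc, (hT g hg).conjTranspose_mul_self, one_mul]
    have := congrArg conjTranspose h3
    rwa [conjTranspose_mul, conjTranspose_conjTranspose, hK] at this
  refine h.map K (fun g hg => ?_) fun w hw => ?_
  -- A Pauli commuting with `T` preserves the code, and so does its adjoint, hence it commutes with
  -- `K`. One that fails to commute with some `k ∈ T` satisfies `K g K = ω K g K` with `ω ≠ 1`.
  · by_cases hc : ∀ k ∈ T, k * g = g * k
    · right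
      refine ⟨g, hg, ?_⟩
      have h3 : ∀ M : Op (V → Fin q), (∀ k ∈ T, k * M = M * k) → K * M * K = M * K := fun M hM => by
        ext i j
        rw [mul_assoc]
        refine congrFun (h2 ((M * K).col j) fun k hk => ?_) i
        ext i
        have h4 : k * (M * K) = M * K := by rw [← mul_assoc, hM k hk, mul_assoc, h1 k hk]
        exact congrFun (congrFun h4 i) j
      have h4 := h3 g hc
      have h5 := h3 gᴴ fun k hk => by
        calc k * gᴴ = gᴴ * (g * k) * gᴴ := by
              rw [← mul_assoc, hg.conjTranspose_mul_self, one_mul]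
          _ = gᴴ * k := by rw [← hc k hk, mul_assoc, mul_assoc, hg.mul_conjTranspose_self, mul_one]
      have h6 := congrArg conjTranspose h5
      simp only [conjTranspose_mul, hK, conjTranspose_conjTranspose] at h6
      rw [← h6, ← mul_assoc]
      exact h4
    · left
      push Not at hc
      obtain ⟨k, hk, hne⟩ := hc
      obtain ⟨ω, hω⟩ := (hT k hk).exists_mul_eq_smul hg
      have h3 : K * g * K = ω • (K * g * K) := by
        calc K * g * K = K * (k * g) * K := by rw [← mul_assoc, h1' k hk]
          _ = ω • (K * g * (k * K)) := by
            rw [hω, mul_smul_comm, smul_mul_assoc]; simp only [mul_assoc]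
          _ = _ := by rw [h1 k hk]
      rw [hK]
      have h4 : (1 - ω) • (K * g * K) = 0 := by rw [sub_smul, one_smul, ← h3, sub_self]
      refine (smul_eq_zero.1 h4).resolve_left fun h5 => hne ?_
      rw [hω, ← sub_eq_zero.1 h5, one_smul]
  · rw [hK, hKK]
    refine h2 w fun g hg => hw g (hT g hg) ?_
    rw [mulVec_mulVec, h1 g hg]

/-- All the operators `Z^b`, with a suitable phase, fix the basis vector; averaging the fixed-point
equations over `b` annihilates every other coordinate. -/
theorem isStabVec_single (x : V → Fin q) : IsStabVec (Pi.single x (1 : ℂ)) := by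
  intro w hw
  have hz : ∀ b y, bichar b (-x) * bichar b y * w y = w y := fun b y => by
    have happ : ∀ u : (V → Fin q) → ℂ, ((bichar b (-x)) • weyl 0 b) *ᵥ u =
        fun y => bichar b (-x) * bichar b y * u y := fun u => by
      ext y
      simp [mulVec, dotProduct, weyl_apply, mul_assoc]
    have := hw (bichar b (-x) • weyl 0 b) ((isPauli_weyl _ _).smul (norm_bichar _ _)) (by
      rw [happ]
      ext y
      rcases eq_or_ne y x with rfl | hy
      · simp [← bichar_add]
      · simp [hy])
    rw [happ] at this
    exact congrFun this y
  refine ⟨w x, ?_⟩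
  ext y
  rcases eq_or_ne y x with rfl | hy
  · simp
  · have h1 : ∑ b, bichar b (-x) * bichar b y * w y = ∑ _b : V → Fin q, w y :=
      Finset.sum_congr rfl fun b _ => hz b y
    simp only [← bichar_add] at h1
    rw [← Finset.sum_mul, sum_bichar, if_neg, zero_mul] at h1
    · have : w y = 0 := by simpa [NeZero.ne q] using h1.symm
      simp [this, hy]
    · rw [neg_add_eq_sub, sub_eq_zero]; exact hy

end StabVec

/-! ### The stabilizer cone, and Pauli measurements that distinguish states. -/

section Measurements

open Matrix
open scoped ComplexOrder

variable {q : ℕ} [NeZero q] {V : Type*} [Fintype V] [DecidableEq V]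

theorem isState_of_mem_stabMix {σ : Op (V → Fin q)} (h : σ ∈ stabMix q V) : IsState σ := by
  have hconv : Convex ℝ {σ : Op (V → Fin q) | IsState σ} := by
    intro x hx y hy a b ha hb hab
    refine ⟨(hx.1.smul ha).add (hy.1.smul hb), ?_⟩
    rw [trace_add, trace_smul, trace_smul, hx.2, hy.2, ← add_smul, hab, one_smul]
  refine convexHull_min ?_ hconv h
  intro τ hτ
  obtain ⟨φ, -, h1, rfl⟩ := hτ.exists_isStabVec
  refine ⟨posSemidef_vecMulVec_self_star φ, ?_⟩
  rw [trace_vecMulVec, dotProduct_comm, h1]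

/-- The convex cone generated by `stabMix`. -/
def stabCone (q : ℕ) [NeZero q] (V : Type*) [Fintype V] [DecidableEq V] : Set (Op (V → Fin q)) :=
  {τ | ∃ c : ℝ, 0 ≤ c ∧ ∃ σ ∈ stabMix q V, τ = c • σ}

theorem stabMix_nonempty : (stabMix q V).Nonempty :=
  ⟨_, subset_convexHull _ _ ((isStabVec_single (0 : V → Fin q)).isPureStab (by simp))⟩

theorem zero_mem_stabCone : 0 ∈ stabCone q V :=
  ⟨0, le_rfl, _, stabMix_nonempty.some_mem, by simp⟩

theorem smul_mem_stabCone {τ : Op (V → Fin q)} (h : τ ∈ stabCone q V) {c : ℝ} (hc : 0 ≤ c) :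
    c • τ ∈ stabCone q V := by
  obtain ⟨d, hd, σ, hσ, rfl⟩ := h
  exact ⟨c * d, by positivity, σ, hσ, by rw [smul_smul]⟩

theorem add_mem_stabCone {τ τ' : Op (V → Fin q)} (h : τ ∈ stabCone q V) (h' : τ' ∈ stabCone q V) :
    τ + τ' ∈ stabCone q V := by
  obtain ⟨c, hc, σ, hσ, rfl⟩ := h
  obtain ⟨d, hd, σ', hσ', rfl⟩ := h'
  rcases (add_nonneg hc hd).eq_or_lt with h0 | h0
  · have hc0 : c = 0 := by linarith
    have hd0 : d = 0 := by linarith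
    rw [hc0, hd0, zero_smul, zero_smul, add_zero]
    exact zero_mem_stabCone
  refine ⟨c + d, h0.le, (c / (c + d)) • σ + (d / (c + d)) • σ',
    convex_convexHull ℝ _ hσ hσ' (by positivity) (by positivity) (by field_simp), ?_⟩
  rw [smul_add, smul_smul, smul_smul, mul_div_cancel₀ _ h0.ne', mul_div_cancel₀ _ h0.ne']

theorem sum_mem_stabCone {X : Type*} (s : Finset X) {τ : X → Op (V → Fin q)}
    (h : ∀ x ∈ s, τ x ∈ stabCone q V) : ∑ x ∈ s, τ x ∈ stabCone q V :=
  Finset.sum_induction _ (· ∈ stabCone q V) (fun _ _ => add_mem_stabCone) zero_mem_stabCone h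

theorem mem_stabMix_of_mem_stabCone {τ : Op (V → Fin q)} (h : τ ∈ stabCone q V)
    (h1 : τ.trace = 1) : τ ∈ stabMix q V := by
  obtain ⟨c, hc, σ, hσ, rfl⟩ := h
  rw [trace_smul, (isState_of_mem_stabMix hσ).2] at h1
  have : c = 1 := by
    have := congrArg Complex.re h1
    simpa using this
  rwa [this, one_smul]

theorem IsStabVec.vecMulVec_mem_stabCone {φ : (V → Fin q) → ℂ} (h : IsStabVec φ) :
    vecMulVec φ (star φ) ∈ stabCone q V := by
  rcases eq_or_ne φ 0 with rfl | hφ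
  · simpa using zero_mem_stabCone
  obtain ⟨r, hr, hrφ⟩ := exists_dotProduct_star_self hφ
  set c : ℂ := (((√r)⁻¹ : ℝ) : ℂ) with hc
  have hcr : c * c * r = 1 := by
    rw [hc, ← Complex.ofReal_mul, ← Complex.ofReal_mul, ← mul_inv, Real.mul_self_sqrt hr.le,
      inv_mul_cancel₀ hr.ne', Complex.ofReal_one]
  have hc0 : c ≠ 0 := by rintro h; simp [h] at hcr
  have hcs : star c = c := by simp [hc]
  have h1 : IsStabVec (c • φ) := fun w hw => by
    obtain ⟨d, rfl⟩ := h w fun g hg hgφ => hw g hg (by rw [mulVec_smul, hgφ])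
    exact ⟨d * c⁻¹, by rw [smul_smul, mul_assoc, inv_mul_cancel₀ hc0, mul_one]⟩
  refine ⟨r, hr.le, _, subset_convexHull _ _ (h1.isPureStab ?_), ?_⟩
  · rw [star_smul, hcs, smul_dotProduct, dotProduct_smul, hrφ, smul_eq_mul, smul_eq_mul,
      ← mul_assoc, hcr]
  · ext i j
    simp only [Matrix.smul_apply, vecMulVec_apply, Pi.smul_apply, Pi.star_apply, smul_eq_mul,
      star_mul', hcs, Complex.real_smul]
    linear_combination -(φ i * star (φ j)) * hcr

/-- Working in the cone removes the need to normalize outputs: positivity on stabilizer vectors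
extends to mixtures by convexity. -/
theorem map_mem_stabCone {W : Type*} [Fintype W] [DecidableEq W]
    (L : Op (V → Fin q) →ₗ[ℝ] Op (W → Fin q))
    (h : ∀ φ, IsStabVec φ → L (vecMulVec φ (star φ)) ∈ stabCone q W) {σ : Op (V → Fin q)}
    (hσ : σ ∈ stabMix q V) : L σ ∈ stabCone q W := by
  have hconv : Convex ℝ {σ | L σ ∈ stabCone q W} := by
    intro x hx y hy a b ha hb _
    change L _ ∈ stabCone q W
    rw [map_add, map_smul, map_smul]
    exact add_mem_stabCone (smul_mem_stabCone hx ha) (smul_mem_stabCone hy hb)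
  refine convexHull_min ?_ hconv hσ
  intro τ hτ
  obtain ⟨φ, hφ, -, rfl⟩ := hτ.exists_isStabVec
  exact h φ hφ

/-- The maximally mixed state is a mixture of stabilizer states. -/
theorem maximallyMixed_mem_stabMix :
    (((q : ℝ) ^ Fintype.card V)⁻¹ • 1 : Op (V → Fin q)) ∈ stabMix q V := by
  have hq : (q : ℝ) ≠ 0 := Nat.cast_ne_zero.2 (NeZero.ne q)
  refine mem_stabMix_of_mem_stabCone (smul_mem_stabCone ?_ (by positivity)) ?_
  · have h : (1 : Op (V → Fin q)) = ∑ x, vecMulVec (Pi.single x 1) (star (Pi.single x 1)) := by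
      ext i j
      rw [Matrix.sum_apply, Finset.sum_eq_single i]
      · simp [vecMulVec_apply, one_apply, Pi.single_apply, eq_comm]
      · intro k _ hk
        simp [vecMulVec_apply, Pi.single_apply, hk.symm]
      · simp
    rw [h]
    exact sum_mem_stabCone _ fun x _ => (isStabVec_single x).vecMulVec_mem_stabCone
  · rw [trace_smul, trace_one, Fintype.card_fun, Fintype.card_fin]
    have hq' : (q : ℂ) ≠ 0 := Nat.cast_ne_zero.2 (NeZero.ne q)
    simp [hq']

/-- Projectors onto the joint fixed space of a set of Pauli operators. -/
def IsCodeProj (P : Op (V → Fin q)) : Prop :=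
  Pᴴ = P ∧ P * P = P ∧ ∃ T : Set (Op (V → Fin q)), (∀ g ∈ T, IsPauli g) ∧
    (∀ g ∈ T, g * P = P) ∧ ∀ w, (∀ g ∈ T, g *ᵥ w = w) → P *ᵥ w = w

theorem IsCodeProj.posSemidef {P : Op (V → Fin q)} (h : IsCodeProj P) : P.PosSemidef := by
  rw [← h.2.1]
  nth_rw 1 [← h.1]
  exact posSemidef_conjTranspose_mul_self P

theorem mul_eq_of_mulVec_col {ι : Type*} [Fintype ι] {g P : Op ι}
    (h : ∀ j, g *ᵥ P.col j = P.col j) : g * P = P := by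
  ext i j
  exact congrFun (h j) i

theorem mulVec_col_of_mul_eq {ι : Type*} [Fintype ι] {g P : Op ι} (h : g * P = P) (j : ι) :
    g *ᵥ P.col j = P.col j := by
  ext i
  exact congrFun (congrFun h i) j

theorem IsStabProjState.exists_isCodeProj {τ : Op (V → Fin q)} (h : IsStabProjState τ) :
    ∃ (c : ℝ) (P : Op (V → Fin q)), 0 ≤ c ∧ IsCodeProj P ∧ τ = c • P := by
  obtain ⟨S, P, hS, hP, hPP, hcode, rfl⟩ := h
  have hPc : IsCodeProj P := by
    refine ⟨hP, hPP, {g | ∃ u ∈ S, g = u}, ?_, ?_, fun w hw => ?_⟩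
    · rintro _ ⟨u, hu, rfl⟩
      exact hS.1 u hu
    · rintro _ ⟨u, hu, rfl⟩
      exact mul_eq_of_mulVec_col fun j => (hcode _).1 (mulVec_col_of_mul_eq hPP j) u hu
    · exact (hcode w).2 fun g hg => hw g ⟨g, hg, rfl⟩
  have htr := Complex.le_def.1 hPc.posSemidef.trace_nonneg
  refine ⟨P.trace.re⁻¹, P, inv_nonneg.2 htr.1, hPc, ?_⟩
  have : P.trace = (P.trace.re : ℂ) := Complex.ext rfl htr.2.symm
  rw [this, Complex.ofReal_re, ← Complex.ofReal_inv]
  rfl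

theorem IsStabMeas.exists_isCodeProj {m : ℕ} {M : Fin m → Op (V → Fin q)} (h : IsStabMeas M)
    (x : Fin m) : ∃ (c : ℝ) (P : Op (V → Fin q)), 0 ≤ c ∧ IsCodeProj P ∧ M x = c • P := by
  obtain ⟨c, τ, hc, hτ, hM⟩ := h.1 x
  obtain ⟨d, P, hd, hP, rfl⟩ := hτ.exists_isCodeProj
  exact ⟨c * d, P, by positivity, hP, by rw [hM, smul_smul]⟩

theorem IsStabMeas.isPOVM {m : ℕ} {M : Fin m → Op (V → Fin q)} (h : IsStabMeas M) : IsPOVM M := by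
  refine ⟨fun x => ?_, h.2⟩
  obtain ⟨c, P, hc, hP, hM⟩ := h.exists_isCodeProj x
  rw [hM]
  exact hP.posSemidef.smul hc

theorem measure_eq_diagonal {m : ℕ} {M : Fin m → Op (V → Fin q)} (h : IsStabMeas M)
    {ρ : Op (V → Fin q)} (hρ : ρ.PosSemidef) :
    measure M ρ = diagonal fun x => (prob M ρ x : ℂ) := by
  rw [measure]
  congr 1
  ext x
  rw [ofReal_prob h.isPOVM.1 hρ]

/-- The code of the trivial group. It also serves as the formal stabilizer state attached to a zero
effect. -/
theorem isStabProjState_maximallyMixed :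
    IsStabProjState ((1 : Op (V → Fin q)).trace⁻¹ • (1 : Op (V → Fin q))) := by
  refine ⟨⊥, 1, isStabilizerGroup_of_fixed (φ := fun _ => 1) ?_ ?_ ?_, isHermitian_one, one_mul 1,
    fun ψ => ⟨fun _ g hg => ?_, fun _ => one_mulVec ψ⟩, rfl⟩
  · rintro g hg
    rw [Subgroup.mem_bot.1 hg]
    exact isPauli_one
  · exact fun h => one_ne_zero (congrFun h 0)
  · rintro g hg
    rw [Subgroup.mem_bot.1 hg]
    exact one_mulVec _
  · rw [Subgroup.mem_bot.1 hg]
    exact one_mulVec _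

/-- The average of the powers of an operator of order `q`. -/
def powAvg (u : Op (V → Fin q)) : Op (V → Fin q) := (q : ℂ)⁻¹ • ∑ j ∈ Finset.range q, u ^ j

omit [NeZero q] in
theorem mul_powAvg {u : Op (V → Fin q)} (hu : u ^ q = 1) : u * powAvg u = powAvg u := by
  have h := mul_geom_sum u q
  rw [hu, sub_self, sub_mul, one_mul, sub_eq_zero] at h
  rw [powAvg, mul_smul_comm, h]

theorem powAvg_mul_of_mul_eq {ι : Type*} [Fintype ι] [DecidableEq ι] {n : ℕ} (hn : n ≠ 0)
    {v P : Op ι} (h : v * P = P) : ((n : ℂ)⁻¹ • ∑ j ∈ Finset.range n, v ^ j) * P = P := by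
  have hj : ∀ j, v ^ j * P = P := fun j => by
    induction j with
    | zero => rw [pow_zero, one_mul]
    | succ j ih => rw [pow_succ, mul_assoc, h, ih]
  rw [smul_mul_assoc, Finset.sum_mul]
  simp only [hj, Finset.sum_const, Finset.card_range]
  rw [← Nat.cast_smul_eq_nsmul ℂ, smul_smul, inv_mul_cancel₀ (Nat.cast_ne_zero.2 hn), one_smul]

theorem powAvg_mulVec_of_mulVec_eq {u : Op (V → Fin q)} {w : (V → Fin q) → ℂ} (h : u *ᵥ w = w) :
    powAvg u *ᵥ w = w := by
  have hj : ∀ j, u ^ j *ᵥ w = w := fun j => by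
    induction j with
    | zero => rw [pow_zero, one_mulVec]
    | succ j ih => rw [pow_succ, ← mulVec_mulVec, h, ih]
  rw [powAvg, smul_mulVec, sum_mulVec]
  simp only [hj, Finset.sum_const, Finset.card_range]
  rw [← Nat.cast_smul_eq_nsmul ℂ, smul_smul, inv_mul_cancel₀ (Nat.cast_ne_zero.2 (NeZero.ne q)),
    one_smul]

/-- From `u P = P` and unitarity `uᴴ P = P`; averaging gives `Pᴴ P = P`, whose left side is
self-adjoint. -/
theorem isHermitian_powAvg {u : Op (V → Fin q)} (hu : IsPauli u) (huq : u ^ q = 1) :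
    (powAvg u)ᴴ = powAvg u := by
  have h1 : uᴴ * powAvg u = powAvg u := by
    conv_lhs => rw [← mul_powAvg huq, ← mul_assoc, hu.conjTranspose_mul_self, one_mul]
  have h2 : (powAvg u)ᴴ * powAvg u = powAvg u := by
    have : (powAvg u)ᴴ = (q : ℂ)⁻¹ • ∑ j ∈ Finset.range q, uᴴ ^ j := by
      simp [powAvg, conjTranspose_smul, conjTranspose_sum, conjTranspose_pow]
    rw [this]
    exact powAvg_mul_of_mul_eq (NeZero.ne q) h1
  conv_lhs => rw [← h2]
  conv_rhs => rw [← h2]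
  rw [conjTranspose_mul, conjTranspose_conjTranspose]

theorem isCodeProj_powAvg {u : Op (V → Fin q)} (hu : IsPauli u) (huq : u ^ q = 1) :
    IsCodeProj (powAvg u) :=
  ⟨isHermitian_powAvg hu huq, powAvg_mul_of_mul_eq (NeZero.ne q) (mul_powAvg huq), {u},
    fun g hg => hg ▸ hu, fun g hg => by rw [Set.mem_singleton_iff.1 hg, mul_powAvg huq],
    fun _ hw => powAvg_mulVec_of_mulVec_eq (hw u rfl)⟩

/-- The projector onto the fixed space of a Pauli operator of order `q` is proportional to a
stabilizer projection state. -/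
theorem exists_isStabProjState_powAvg {u : Op (V → Fin q)} (hu : IsPauli u) (huq : u ^ q = 1) :
    ∃ (c : ℝ) (τ : Op (V → Fin q)), 0 ≤ c ∧ IsStabProjState τ ∧ powAvg u = c • τ := by
  have hP := isCodeProj_powAvg hu huq
  by_cases h0 : powAvg u = 0
  · exact ⟨0, _, le_rfl, isStabProjState_maximallyMixed, by rw [h0, zero_smul]⟩
  have htr := Complex.le_def.1 hP.posSemidef.trace_nonneg
  have htr0 : (powAvg u).trace ≠ 0 := fun h => h0 (hP.posSemidef.trace_eq_zero_iff.1 h)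
  have hre : (powAvg u).trace = ((powAvg u).trace.re : ℂ) := Complex.ext rfl htr.2.symm
  have hfix : ∀ φ : (V → Fin q) → ℂ, u *ᵥ φ = φ →
      Subgroup.zpowers (pauliUnit hu) ≤ stabGroup φ := fun φ hφ =>
    Subgroup.zpowers_le.2 ⟨hu, hφ⟩
  -- A nonzero column is a vector fixed by `u`, which excludes nontrivial scalars from the cyclic
  -- group.
  obtain ⟨j, hj⟩ : ∃ j, (powAvg u).col j ≠ 0 := by
    by_contra! h
    exact h0 (by ext i j; exact congrFun (h j) i)
  have hjfix := hfix _ (mulVec_col_of_mul_eq (mul_powAvg huq) j)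
  refine ⟨(powAvg u).trace.re, (powAvg u).trace⁻¹ • powAvg u, htr.1,
    ⟨Subgroup.zpowers (pauliUnit hu), powAvg u, isStabilizerGroup_of_fixed
      (fun g hg => (hjfix hg).1) hj (fun g hg => (hjfix hg).2), hP.1, hP.2.1, fun ψ => ⟨fun h => ?_,
      fun h => ?_⟩, rfl⟩, ?_⟩
  · have : u *ᵥ ψ = ψ := by
      conv_lhs => rw [← h, mulVec_mulVec, mul_powAvg huq, h]
    exact fun g hg => (hfix ψ this hg).2
  · exact powAvg_mulVec_of_mulVec_eq (h (pauliUnit hu) (Subgroup.mem_zpowers _))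
  · rw [← Complex.coe_smul, ← hre, smul_smul, mul_inv_cancel₀ htr0, one_smul]

/-- Powers of a Weyl operator multiply the labels, and `q` annihilates `(ℤ/q)^V`. -/
theorem IsPauli.exists_pow_eq_smul_one {g : Op (V → Fin q)} (hg : IsPauli g) :
    ∃ s : ℂ, ‖s‖ = 1 ∧ g ^ q = s • 1 := by
  obtain ⟨c, a, b, hc, rfl⟩ := isPauli_iff.1 hg
  have h : ∀ n : ℕ, ∃ s : ℂ, ‖s‖ = 1 ∧ (c • weyl a b) ^ n = s • weyl (n • a) (n • b) := fun n => by
    induction n with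
    | zero => exact ⟨1, by simp, by rw [pow_zero, zero_smul, zero_smul, weyl_zero, one_smul]⟩
    | succ n ih =>
      obtain ⟨s, hs, hn⟩ := ih
      refine ⟨s * c * bichar (n • b) a, by simp [hs, hc], ?_⟩
      rw [pow_succ, hn, smul_mul_smul_comm, weyl_mul, smul_smul, succ_nsmul, succ_nsmul]
  obtain ⟨s, hs, hq⟩ := h q
  have h0 : ∀ a : V → Fin q, q • a = 0 := fun a => by
    ext1 v
    have := card_nsmul_eq_zero (x := a v)
    rwa [Fintype.card_fin] at this
  exact ⟨s, hs, by rw [hq, h0, h0, weyl_zero]⟩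

/-- The measurement of the eigenspaces of a Pauli operator. -/
theorem IsPauli.exists_isStabMeas {g : Op (V → Fin q)} (hg : IsPauli g) (X : Op (V → Fin q)) :
    ∃ M : Fin q → Op (V → Fin q), IsStabMeas M ∧ ‖(g * X).trace‖ ≤ ∑ k, ‖(M k * X).trace‖ := by
  obtain ⟨s, hs, hgq⟩ := hg.exists_pow_eq_smul_one
  have hs0 : s ≠ 0 := by rintro rfl; simp at hs
  -- Rescaling by a `q`-th root of `s⁻¹` makes the eigenvalues `q`-th roots of unity.
  obtain ⟨c, hc⟩ := IsAlgClosed.exists_pow_nat_eq (s⁻¹) (Nat.pos_of_neZero q)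
  have hc1 : ‖c‖ = 1 := by
    have := congrArg norm hc
    rw [norm_pow, norm_inv, hs, inv_one] at this
    exact (pow_eq_one_iff_of_nonneg (norm_nonneg c) (NeZero.ne q)).1 this
  set U := c • g with hU
  have hUq : U ^ q = 1 := by
    rw [hU, smul_pow, hc, hgq, smul_smul, inv_mul_cancel₀ hs0, one_smul]
  have hUp : IsPauli U := hg.smul hc1
  set ζ : ℂ := star (rootU q) with hζ
  have hζω : rootU q * ζ = 1 := by rw [mul_comm]; exact star_mul_self_of_norm_eq_one norm_rootU
  have hζq : ζ ^ q = 1 := by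
    rw [hζ, ← star_pow, (isPrimitiveRoot_rootU q).pow_eq_one, star_one]
  have hζ1 : ‖ζ‖ = 1 := by rw [hζ, norm_star, norm_rootU]
  -- The fixed space of `ζ^k U` is the eigenspace of `U` for `ω^k`.
  set u : Fin q → Op (V → Fin q) := fun k => ζ ^ (k : ℕ) • U with hu
  have hup : ∀ k, IsPauli (u k) := fun k => hUp.smul (by rw [norm_pow, hζ1, one_pow])
  have huq : ∀ k, u k ^ q = 1 := fun k => by
    rw [hu, smul_pow, hUq, ← pow_mul, mul_comm, pow_mul, hζq, one_pow, one_smul]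
  have hsum : ∑ k, powAvg (u k) = 1 := by
    have hpow : ∀ (k : Fin q) (j : ℕ), u k ^ j = (ζ ^ j) ^ (k : ℕ) • U ^ j := fun k j => by
      rw [hu, smul_pow, ← pow_mul, ← pow_mul, mul_comm]
    simp only [powAvg, hpow]
    rw [← Finset.smul_sum, Finset.sum_comm]
    simp only [← Finset.sum_smul]
    rw [Finset.sum_eq_single_of_mem 0 (Finset.mem_range.2 (Nat.pos_of_neZero q))]
    · simp only [pow_zero, one_pow, Finset.sum_const, Finset.card_univ, Fintype.card_fin]
      rw [smul_smul, nsmul_eq_mul, mul_one, inv_mul_cancel₀ (Nat.cast_ne_zero.2 (NeZero.ne q)),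
        one_smul]
    · intro j hj hj0
      rw [geom_sum_fin_eq_zero, zero_smul]
      · rw [← pow_mul, mul_comm, pow_mul, hζq, one_pow]
      · intro h
        have h1 : rootU q ^ j = 1 := by
          have h2 := congrArg (rootU q ^ j * ·) h
          simp only [← mul_pow, hζω, one_pow, mul_one] at h2
          exact h2.symm
        exact (isPrimitiveRoot_rootU q).pow_ne_one_of_pos_of_lt hj0 (Finset.mem_range.1 hj) h1
  refine ⟨fun k => powAvg (u k), ⟨fun k => exists_isStabProjState_powAvg (hup k) (huq k), hsum⟩, ?_⟩
  have h1 : ∀ k, U * powAvg (u k) = rootU q ^ (k : ℕ) • powAvg (u k) := fun k => by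
    conv_rhs => rw [← mul_powAvg (huq k)]
    rw [show u k * powAvg (u k) = ζ ^ (k : ℕ) • (U * powAvg (u k)) from smul_mul_assoc _ _ _,
      smul_smul, ← mul_pow, hζω, one_pow, one_smul]
  have h2 : (U * X).trace = ∑ k : Fin q, rootU q ^ (k : ℕ) * (powAvg (u k) * X).trace := by
    rw [← mul_one U, ← hsum, Finset.mul_sum, Finset.sum_mul, trace_sum]
    refine Finset.sum_congr rfl fun k _ => ?_
    rw [h1, smul_mul_assoc, trace_smul, smul_eq_mul]
  have h3 : ‖(g * X).trace‖ = ‖(U * X).trace‖ := by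
    rw [hU, smul_mul_assoc, trace_smul, norm_smul, hc1, one_mul]
  rw [h3, h2]
  refine (norm_sum_le _ _).trans (Finset.sum_le_sum fun k _ => ?_)
  rw [norm_mul, norm_pow, norm_rootU, one_pow, one_mul]

/-- Let `d` be the dimension. By Parseval the `d²` squared Weyl coefficients sum to `d ‖X‖₂²`, which
is at least `‖X‖₁²`; so some coefficient is at least `‖X‖₁ / d`. -/
theorem exists_weyl_traceNorm_le (X : Op (V → Fin q)) : ∃ a b : V → Fin q,
    traceNorm X ≤ (q : ℝ) ^ Fintype.card V * ‖((weyl a b)ᴴ * X).trace‖ := by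
  by_contra! h
  set d : ℝ := (q : ℝ) ^ Fintype.card V with hd
  have hd0 : 0 < d := pow_pos (Nat.cast_pos.2 (Nat.pos_of_neZero q)) _
  have hcard : (Fintype.card (V → Fin q) : ℝ) = d := by simp [hd]
  have hpar : ∑ a, ∑ b, ‖((weyl a b)ᴴ * X).trace‖ ^ 2 = d * (Xᴴ * X).trace.re := by
    have h1 := congrArg (fun M => (Xᴴ * M).trace.re) (sum_trace_weyl_smul X)
    simp only [Finset.mul_sum, trace_sum, mul_smul_comm, trace_smul, Complex.re_sum] at h1
    have h2 : ∀ a b : V → Fin q, (((weyl a b)ᴴ * X).trace • (Xᴴ * weyl a b).trace).re =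
        ‖((weyl a b)ᴴ * X).trace‖ ^ 2 := fun a b => by
      have : (Xᴴ * weyl a b).trace = star ((weyl a b)ᴴ * X).trace := by
        rw [← trace_conjTranspose, conjTranspose_mul, conjTranspose_conjTranspose]
      rw [this, smul_eq_mul, ← starRingEnd_apply, Complex.mul_conj, Complex.normSq_eq_norm_sq,
        Complex.ofReal_re]
    simp only [h2] at h1
    rw [h1, smul_eq_mul, hd, ← Complex.re_ofReal_mul]
    push_cast
    rfl
  have hlt : ∑ a : V → Fin q, ∑ b : V → Fin q, ‖((weyl a b)ᴴ * X).trace‖ ^ 2 <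
      ∑ _a : V → Fin q, ∑ _b : V → Fin q, (traceNorm X / d) ^ 2 := by
    refine Finset.sum_lt_sum_of_nonempty Finset.univ_nonempty fun a _ =>
      Finset.sum_lt_sum_of_nonempty Finset.univ_nonempty fun b _ => ?_
    refine pow_lt_pow_left₀ ?_ (norm_nonneg _) two_ne_zero
    rw [lt_div_iff₀ hd0, mul_comm]
    exact h a b
  have h3 := traceNorm_sq_le X
  rw [hcard, ← hpar] at h3
  simp only [Finset.sum_const, Finset.card_univ, nsmul_eq_mul, hcard] at hlt
  have : d * (d * (traceNorm X / d) ^ 2) = traceNorm X ^ 2 := by field_simp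
  linarith

/-- Some Pauli measurement distinguishes two states up to the dimension factor. -/
theorem exists_isStabMeas_traceNorm_le {ρ σ : Op (V → Fin q)} (hρ : ρ.PosSemidef)
    (hσ : σ.PosSemidef) : ∃ M : Fin q → Op (V → Fin q), IsStabMeas M ∧
      traceNorm (ρ - σ) ≤ (q : ℝ) ^ Fintype.card V * ∑ k, |prob M ρ k - prob M σ k| := by
  obtain ⟨a, b, h⟩ := exists_weyl_traceNorm_le (ρ - σ)
  obtain ⟨M, hM, hMX⟩ := (isPauli_weyl a b).conjTranspose.exists_isStabMeas (ρ - σ)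
  refine ⟨M, hM, h.trans (mul_le_mul_of_nonneg_left (hMX.trans (le_of_eq ?_)) (by positivity))⟩
  refine Finset.sum_congr rfl fun k _ => ?_
  rw [mul_sub, trace_sub, ← ofReal_prob hM.isPOVM.1 hρ, ← ofReal_prob hM.isPOVM.1 hσ,
    ← Complex.ofReal_sub, Complex.norm_real, Real.norm_eq_abs]

end Measurements

/-! ### Tensor factors, partial traces and local measurements. -/

section Local

open Matrix
open scoped ComplexOrder Kronecker

variable {q : ℕ} [NeZero q] {V : Type*} [Fintype V] [DecidableEq V]

/-- Operators on `V` from operators on the pairs of configurations on `A` and its complement. -/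
def lift (A : Finset V) (T : Op ((A → Fin q) × ({v // v ∉ A} → Fin q))) : Op (V → Fin q) :=
  T.submatrix (glue A).symm (glue A).symm

omit [Fintype V] [NeZero q] in
theorem lift_glue (A : Finset V) (T : Op ((A → Fin q) × ({v // v ∉ A} → Fin q)))
    (p p' : (A → Fin q) × ({v // v ∉ A} → Fin q)) : lift A T (glue A p) (glue A p') = T p p' := by
  simp [lift]

omit [Fintype V] [NeZero q] in
theorem ext_glue (A : Finset V) {M N : Op (V → Fin q)}
    (h : ∀ p p', M (glue A p) (glue A p') = N (glue A p) (glue A p')) : M = N := by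
  ext x y
  obtain ⟨p, rfl⟩ := (glue A).surjective x
  obtain ⟨p', rfl⟩ := (glue A).surjective y
  exact h p p'

omit [NeZero q] in
theorem lift_mul (A : Finset V) (S T : Op ((A → Fin q) × ({v // v ∉ A} → Fin q))) :
    lift A S * lift A T = lift A (S * T) :=
  submatrix_mul_equiv S T _ _ _

omit [NeZero q] in
theorem trace_lift (A : Finset V) (T : Op ((A → Fin q) × ({v // v ∉ A} → Fin q))) :
    (lift A T).trace = T.trace := by
  rw [trace, trace, ← (glue A).sum_comp]
  exact Finset.sum_congr rfl fun p _ => lift_glue A T p p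

/-- The operator `M ⊗ 1` for `M` acting on `A`. -/
def embed (A : Finset V) (M : Op (A → Fin q)) : Op (V → Fin q) := lift A (M ⊗ₖ 1)

/-- The operator `1 ⊗ N` for `N` acting on the complement of `A`. -/
def coembed (A : Finset V) (N : Op ({v // v ∉ A} → Fin q)) : Op (V → Fin q) := lift A (1 ⊗ₖ N)

omit [NeZero q] in
theorem embed_mul (A : Finset V) (M N : Op (A → Fin q)) :
    embed A (M * N) = embed A M * embed A N := by
  rw [embed, embed, embed, lift_mul, ← mul_kronecker_mul, one_mul]

omit [NeZero q] in
theorem coembed_mul (A : Finset V) (M N : Op ({v // v ∉ A} → Fin q)) :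
    coembed A (M * N) = coembed A M * coembed A N := by
  rw [coembed, coembed, coembed, lift_mul, ← mul_kronecker_mul, one_mul]

omit [NeZero q] in
theorem coembed_mul_embed (A : Finset V) (M : Op (A → Fin q)) (N : Op ({v // v ∉ A} → Fin q)) :
    coembed A N * embed A M = lift A (M ⊗ₖ N) := by
  rw [coembed, embed, lift_mul, ← mul_kronecker_mul, one_mul, mul_one]

omit [NeZero q] in
theorem embed_mul_coembed (A : Finset V) (M : Op (A → Fin q)) (N : Op ({v // v ∉ A} → Fin q)) :
    embed A M * coembed A N = coembed A N * embed A M := by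
  rw [coembed_mul_embed, coembed, embed, lift_mul, ← mul_kronecker_mul, one_mul, mul_one]

omit [NeZero q] in
theorem embed_glue (A : Finset V) (M : Op (A → Fin q))
    (p p' : (A → Fin q) × ({v // v ∉ A} → Fin q)) :
    embed A M (glue A p) (glue A p') = M p.1 p'.1 * (1 : Op ({v // v ∉ A} → Fin q)) p.2 p'.2 := by
  rw [embed, lift_glue]
  rfl

omit [NeZero q] in
theorem embed_one (A : Finset V) : embed A (1 : Op (A → Fin q)) = 1 := by
  rw [embed, one_kronecker_one, lift, submatrix_one_equiv]

omit [NeZero q] in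
theorem coembed_one (A : Finset V) : coembed A (1 : Op ({v // v ∉ A} → Fin q)) = 1 :=
  embed_one A

omit [NeZero q] in
theorem embed_smul (A : Finset V) {R : Type*} [SMul R ℂ] [IsScalarTower R ℂ ℂ] (c : R)
    (M : Op (A → Fin q)) : embed A (c • M) = c • embed A M :=
  ext_glue A fun p p' => by
    rw [embed_glue, Matrix.smul_apply, Matrix.smul_apply, embed_glue, smul_mul_assoc]

omit [NeZero q] [Fintype V] in
theorem coembed_smul (A : Finset V) (c : ℝ) (N : Op ({v // v ∉ A} → Fin q)) :
    coembed A (c • N) = c • coembed A N := by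
  rw [coembed, kronecker_smul]
  rfl

omit [NeZero q] in
theorem embed_sum (A : Finset V) {X : Type*} [Fintype X] (M : X → Op (A → Fin q)) :
    embed A (∑ x, M x) = ∑ x, embed A (M x) :=
  ext_glue A fun p p' => by
    simp only [embed_glue, Matrix.sum_apply, Finset.sum_mul]

omit [NeZero q] in
theorem conjTranspose_embed (A : Finset V) (M : Op (A → Fin q)) : (embed A M)ᴴ = embed A Mᴴ := by
  rw [embed, embed, lift, conjTranspose_submatrix, conjTranspose_kronecker, conjTranspose_one]
  rfl

omit [NeZero q] in
theorem embed_mulVec (A : Finset V) (M : Op (A → Fin q)) (w : (V → Fin q) → ℂ)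
    (z : {v // v ∉ A} → Fin q) : sliceVec A z (embed A M *ᵥ w) = M *ᵥ sliceVec A z w := by
  ext x
  rw [sliceVec, mulVec, dotProduct, ← (glue A).sum_comp, Fintype.sum_prod_type]
  simp only [embed_glue, mulVec, dotProduct, sliceVec, one_apply]
  simp

omit [NeZero q] [Fintype V] in
theorem eq_of_sliceVec_eq {A : Finset V} {v w : (V → Fin q) → ℂ}
    (h : ∀ z, sliceVec A z v = sliceVec A z w) : v = w := by
  ext x
  obtain ⟨⟨x, z⟩, rfl⟩ := (glue A).surjective x
  exact congrFun (h z) x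

theorem isPauli_embed (A : Finset V) {g : Op (A → Fin q)} (hg : IsPauli g) :
    IsPauli (embed A g) := by
  obtain ⟨c, a, b, hc, rfl⟩ := isPauli_iff.1 hg
  rw [embed_smul]
  refine IsPauli.smul ?_ hc
  have h1 : ∀ a : A → Fin q, (fun v : A => glue A (a, 0) v) = a := fun a => by
    ext1 v; exact glue_apply_mem (a, 0) v
  have h2 : ∀ a : A → Fin q, (fun v : {v // v ∉ A} => glue A (a, 0) v) = 0 := fun a => by
    ext1 v; exact glue_apply_notMem (a, 0) v
  have : embed A (weyl a b) = weyl (glue A (a, 0)) (glue A (b, 0)) :=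
    ext_glue A fun p p' => by rw [embed_glue, weyl_glue, h1, h1, h2, h2, weyl_zero]
  rw [this]
  exact isPauli_weyl _ _

theorem IsCodeProj.embed {A : Finset V} {P : Op (A → Fin q)} (h : IsCodeProj P) :
    IsCodeProj (embed A P) := by
  obtain ⟨h1, h2, T, hT, hTP, hfix⟩ := h
  refine ⟨by rw [conjTranspose_embed, h1], by rw [← embed_mul, h2], Magic.embed A '' T, ?_, ?_,
    fun w hw => ?_⟩
  · rintro _ ⟨g, hg, rfl⟩
    exact isPauli_embed A (hT g hg)
  · rintro _ ⟨g, hg, rfl⟩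
    rw [← embed_mul, hTP g hg]
  · refine eq_of_sliceVec_eq (A := A) fun z => ?_
    rw [embed_mulVec]
    refine hfix _ fun g hg => ?_
    rw [← embed_mulVec, hw _ ⟨g, hg, rfl⟩]

omit [NeZero q] in
/-- Operators acting trivially on a subsystem disjoint from their support. -/
theorem exists_embed_eq_coembed {A B : Finset V} (h : Disjoint A B) (M : Op (A → Fin q)) :
    ∃ N, embed A M = coembed B N := by
  have hB : ∀ v : A, (v : V) ∉ B := fun v => Finset.disjoint_left.1 h v.2
  -- The witness acts as `M` on the coordinates in `A` and as the identity on those outside both `A`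
  -- and `B`.
  refine ⟨Matrix.of fun z z' => M (fun v => z ⟨v, hB v⟩) (fun v => z' ⟨v, hB v⟩) *
    if ∀ v : {v // v ∉ B}, (v : V) ∉ A → z v = z' v then 1 else 0, ext_glue B fun p p' => ?_⟩
  have h1 : ∀ p : (B → Fin q) × ({v // v ∉ B} → Fin q),
      ((glue A).symm (glue B p)).1 = fun v : A => p.2 ⟨v, hB v⟩ := fun p => by
    ext1 v
    exact glue_apply_notMem p ⟨v, hB v⟩
  have h2 : ((glue A).symm (glue B p)).2 = ((glue A).symm (glue B p')).2 ↔
      p.1 = p'.1 ∧ ∀ v : {v // v ∉ B}, (v : V) ∉ A → p.2 v = p'.2 v := by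
    constructor
    · intro h
      have h3 : ∀ v, v ∉ A → glue B p v = glue B p' v := fun v hv => congrFun h ⟨v, hv⟩
      refine ⟨?_, fun v hv => ?_⟩
      · ext1 v
        have := h3 v (Finset.disjoint_right.1 ‹Disjoint A B› v.2)
        rwa [glue_apply_mem, glue_apply_mem] at this
      · have := h3 v hv
        rwa [glue_apply_notMem, glue_apply_notMem] at this
    · rintro ⟨h3, h4⟩
      ext1 ⟨v, hv⟩
      change glue B p v = glue B p' v
      by_cases hvB : v ∈ B
      · have := congrFun h3 ⟨v, hvB⟩
        rwa [← glue_apply_mem p ⟨v, hvB⟩, ← glue_apply_mem p' ⟨v, hvB⟩] at this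
      · have := h4 ⟨v, hvB⟩ hv
        rwa [← glue_apply_notMem p ⟨v, hvB⟩, ← glue_apply_notMem p' ⟨v, hvB⟩] at this
  rw [coembed, lift_glue, embed, lift, submatrix_apply, kroneckerMap_apply, kroneckerMap_apply,
    one_apply, one_apply, h1, h1, of_apply]
  simp only [h2]
  by_cases h3 : p.1 = p'.1 <;> simp [h3]

omit [NeZero q] in
theorem trace_embed_mul (A : Finset V) (M : Op (A → Fin q)) (ρ : Op (V → Fin q)) :
    (embed A M * ρ).trace = (M * reduced ρ A).trace := by
  simp only [trace, diag, mul_apply, ← (glue A).sum_comp, Fintype.sum_prod_type]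
  simp only [embed_glue, one_apply]
  refine Finset.sum_congr rfl fun x _ => ?_
  simp only [mul_ite, mul_one, mul_zero, ite_mul, zero_mul, Finset.sum_ite_eq, Finset.mem_univ,
    if_true]
  rw [Finset.sum_comm]
  refine Finset.sum_congr rfl fun y _ => ?_
  rw [← Finset.mul_sum]
  rfl

omit [NeZero q] in
theorem reduced_add (ρ σ : Op (V → Fin q)) (A : Finset V) :
    reduced (ρ + σ) A = reduced ρ A + reduced σ A := by
  ext x y
  simp [reduced, Finset.sum_add_distrib]

omit [NeZero q] in
theorem reduced_smul (c : ℝ) (ρ : Op (V → Fin q)) (A : Finset V) :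
    reduced (c • ρ) A = c • reduced ρ A := by
  ext x y
  simp [reduced, Finset.mul_sum]

-- Tracing out the complement in the computational basis; each slice is again a stabilizer vector
-- when `φ` is.
omit [NeZero q] in
theorem reduced_vecMulVec (φ : (V → Fin q) → ℂ) (A : Finset V) :
    reduced (vecMulVec φ (star φ)) A = ∑ z, vecMulVec (sliceVec A z φ) (star (sliceVec A z φ)) := by
  ext x y
  rw [Matrix.sum_apply]
  rfl

omit [NeZero q] in
theorem IsState.reduced {ρ : Op (V → Fin q)} (h : IsState ρ) (A : Finset V) :
    IsState (reduced ρ A) := by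
  constructor
  · have : Magic.reduced ρ A =
        ∑ z, ρ.submatrix (fun x => glue A (x, z)) (fun x => glue A (x, z)) := by
      ext x y
      rw [Matrix.sum_apply]
      rfl
    rw [this]
    exact posSemidef_sum _ fun z _ => h.1.submatrix _
  · rw [← one_mul (Magic.reduced ρ A), ← trace_embed_mul, embed_one, one_mul, h.2]

-- The partial trace is cyclic for operators on the traced-out factor. It suffices to test against
-- every `M` on `A`, since `embed A M` commutes with `coembed A N`.
omit [NeZero q] in
theorem reduced_coembed_mul (A : Finset V) (N : Op ({v // v ∉ A} → Fin q)) (ρ : Op (V → Fin q)) :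
    reduced (coembed A N * ρ) A = reduced (ρ * coembed A N) A := by
  refine Matrix.ext_iff_trace_mul_left.2 fun M => ?_
  rw [← trace_embed_mul, ← trace_embed_mul, ← mul_assoc, embed_mul_coembed, mul_assoc,
    trace_mul_comm, mul_assoc]

/-- Orthogonal projections supported on `U` which preserve stabilizer vectors. -/
structure IsLocalProj (U : Finset V) (P : Op (V → Fin q)) : Prop where
  isHermitian : Pᴴ = P
  mul_self : P * P = P
  isStabVec : ∀ φ, IsStabVec φ → IsStabVec (P *ᵥ φ)
  -- Quantifying over all disjoint `B` keeps every subsystem not yet measured available.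
  exists_coembed : ∀ B, Disjoint U B → ∃ N, P = coembed B N

theorem IsLocalProj.posSemidef {U : Finset V} {P : Op (V → Fin q)} (h : IsLocalProj U P) :
    P.PosSemidef := by
  rw [← h.2]
  nth_rw 1 [← h.1]
  exact posSemidef_conjTranspose_mul_self P

theorem IsLocalProj.mul_embed {U A : Finset V} {P : Op (V → Fin q)} (h : IsLocalProj U P)
    (hUA : Disjoint U A) {Q : Op (A → Fin q)} (hQ : IsCodeProj Q) :
    IsLocalProj (U ∪ A) (P * embed A Q) := by
  obtain ⟨h1, h2, T, hT, hTP, hfix⟩ := hQ.embed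
  have hcomm : P * embed A Q = embed A Q * P := by
    obtain ⟨N, rfl⟩ := h.exists_coembed A hUA
    rw [embed_mul_coembed]
  refine ⟨?_, ?_, fun φ hφ => ?_, fun B hB => ?_⟩
  · rw [conjTranspose_mul, h1, h.isHermitian, hcomm]
  · rw [mul_assoc, ← mul_assoc (embed A Q) P, ← hcomm, mul_assoc P, h2, ← mul_assoc, h.mul_self]
  · rw [← mulVec_mulVec]
    exact h.isStabVec _ (hφ.projector h1 h2 T hT hTP hfix)
  · rw [Finset.disjoint_union_left] at hB
    obtain ⟨N, rfl⟩ := h.exists_coembed B hB.1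
    obtain ⟨N', hN'⟩ := exists_embed_eq_coembed hB.2 Q
    exact ⟨N * N', by rw [hN', coembed_mul]⟩

/-- Measurements whose effects are multiples of local projections on `U`. -/
def IsLocalMeas {X : Type*} [Fintype X] (U : Finset V) (N : X → Op (V → Fin q)) : Prop :=
  (∀ x, ∃ (c : ℝ) (P : Op (V → Fin q)), 0 ≤ c ∧ IsLocalProj U P ∧ N x = c • P) ∧ ∑ x, N x = 1

variable {X : Type*} [Fintype X] {U A : Finset V} {N : X → Op (V → Fin q)}

theorem isLocalMeas_trivial : IsLocalMeas ∅ (fun _ : Unit => (1 : Op (V → Fin q))) := by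
  refine ⟨fun _ => ⟨1, 1, zero_le_one, ⟨conjTranspose_one, one_mul 1, fun φ hφ => ?_, fun B _ => ?_⟩,
    (one_smul _ _).symm⟩, by simp⟩
  · rwa [one_mulVec]
  · exact ⟨1, (coembed_one B).symm⟩

theorem IsLocalMeas.isPOVM (h : IsLocalMeas U N) : IsPOVM N := by
  refine ⟨fun x => ?_, h.2⟩
  obtain ⟨c, P, hc, hP, hN⟩ := h.1 x
  rw [hN]
  exact hP.posSemidef.smul hc

theorem IsLocalMeas.exists_coembed (h : IsLocalMeas U N) (hUA : Disjoint U A) (x : X) :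
    ∃ M, N x = coembed A M := by
  obtain ⟨c, P, hc, hP, hN⟩ := h.1 x
  obtain ⟨M, rfl⟩ := hP.exists_coembed A hUA
  exact ⟨c • M, by rw [hN, coembed_smul]⟩

/-- The joint measurement of `N` and of `M` on the subsystem `A`. -/
def joint (N : X → Op (V → Fin q)) {m : ℕ} (M : Fin m → Op (A → Fin q)) (z : X × Fin m) :
    Op (V → Fin q) := N z.1 * embed A (M z.2)

variable {m : ℕ} {M : Fin m → Op (A → Fin q)}

theorem IsLocalMeas.joint (h : IsLocalMeas U N) (hUA : Disjoint U A) (hM : IsStabMeas M) :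
    IsLocalMeas (U ∪ A) (joint N M) := by
  constructor
  · rintro ⟨x, y⟩
    obtain ⟨c, P, hc, hP, hN⟩ := h.1 x
    obtain ⟨d, Q, hd, hQ, hMy⟩ := hM.exists_isCodeProj y
    refine ⟨c * d, P * embed A Q, by positivity, hP.mul_embed hUA hQ, ?_⟩
    rw [Magic.joint, hN, hMy, embed_smul, smul_mul_smul_comm]
  · simp only [Magic.joint]
    rw [Fintype.sum_prod_type]
    simp only [← Finset.mul_sum, ← embed_sum, hM.2, embed_one, mul_one, h.2]

omit [Fintype X] in
theorem sum_prob_joint_right (hM : IsStabMeas M) (ρ : Op (V → Fin q)) (x : X) :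
    ∑ y, prob (joint N M) ρ (x, y) = prob N ρ x := by
  simp only [prob, joint]
  rw [← Complex.re_sum, ← trace_sum, ← Finset.sum_mul, ← Finset.mul_sum, ← embed_sum, hM.2,
    embed_one, mul_one]

/-- No signalling: ignoring the outcome of `N` leaves the reduced state on `A` unaffected. -/
theorem sum_prob_joint_left (h : IsLocalMeas U N) (ρ : Op (V → Fin q)) (y : Fin m) :
    ∑ x, prob (joint N M) ρ (x, y) = prob M (reduced ρ A) y := by
  simp only [prob, joint]
  rw [← Complex.re_sum, ← trace_sum, ← Finset.sum_mul, ← Finset.sum_mul, h.2, one_mul,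
    trace_embed_mul]

theorem prob_joint (h : IsLocalMeas U N) (hUA : Disjoint U A) (ρ : Op (V → Fin q)) (x : X)
    (y : Fin m) : prob (joint N M) ρ (x, y) = prob M (reduced (N x * ρ) A) y := by
  obtain ⟨K, hK⟩ := h.exists_coembed hUA x
  rw [prob, prob, joint, ← trace_embed_mul, ← mul_assoc, hK, embed_mul_coembed]

/-- Local measurements map mixtures of stabilizer states to mixtures of stabilizer states. -/
theorem reduced_mul_mem_stabCone (h : IsLocalMeas U N) (hUA : Disjoint U A) (x : X)
    {σ : Op (V → Fin q)} (hσ : σ ∈ stabMix q V) : reduced (N x * σ) A ∈ stabCone q A := by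
  obtain ⟨c, P, hc, hP, hN⟩ := h.1 x
  -- By idempotence and cyclicity on the complement of `A`, the effect may act on both sides, which
  -- is the form preserving stabilizer vectors.
  have h1 : reduced (P * σ) A = reduced (P * σ * P) A := by
    obtain ⟨K, hK⟩ := hP.exists_coembed A hUA
    conv_lhs => rw [← hP.mul_self, mul_assoc]
    nth_rw 1 [hK]
    rw [reduced_coembed_mul, ← hK]
  rw [hN, smul_mul_assoc, reduced_smul, h1]
  refine smul_mem_stabCone ?_ hc
  let L : Op (V → Fin q) →ₗ[ℝ] Op (A → Fin q) :=
    { toFun := fun τ => reduced (P * τ * P) A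
      map_add' := fun τ τ' => by rw [mul_add, add_mul, reduced_add]
      map_smul' := fun r τ => by
        rw [mul_smul_comm, smul_mul_assoc, reduced_smul, RingHom.id_apply] }
  refine map_mem_stabCone L (fun φ hφ => ?_) hσ
  change reduced (P * vecMulVec φ (star φ) * P) A ∈ _
  nth_rw 2 [← hP.isHermitian]
  rw [mul_vecMulVec_star_mul, reduced_vecMulVec]
  exact sum_mem_stabCone _ fun z _ =>
    (isStabVec_sliceVec (hP.isStabVec φ hφ) A z).vecMulVec_mem_stabCone

/-- A reweighted mixture of the post-measurement states on `A`. -/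
def postState (N : X → Op (V → Fin q)) (σ : Op (V → Fin q)) (A : Finset V) (r : X → ℝ) :
    Op (A → Fin q) := ∑ x, (r x / prob N σ x) • reduced (N x * σ) A

theorem postState_mem_stabMix (h : IsLocalMeas U N) (hUA : Disjoint U A) {σ : Op (V → Fin q)}
    (hσ : σ ∈ stabMix q V) {r : X → ℝ} (hr : ∀ x, 0 ≤ r x) (hr1 : ∑ x, r x = 1)
    (hrσ : ∀ x, prob N σ x = 0 → r x = 0) : postState N σ A r ∈ stabMix q A := by
  have hσ0 := (isState_of_mem_stabMix hσ).1
  refine mem_stabMix_of_mem_stabCone (sum_mem_stabCone _ fun x _ =>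
    smul_mem_stabCone (reduced_mul_mem_stabCone h hUA x hσ)
      (div_nonneg (hr x) (prob_nonneg h.isPOVM.1 hσ0 x))) ?_
  have h1 : ∀ x, ((r x / prob N σ x) • reduced (N x * σ) A).trace = (r x : ℂ) := fun x => by
    rw [trace_smul, ← one_mul (reduced (N x * σ) A), ← trace_embed_mul, embed_one, one_mul,
      ← ofReal_prob h.isPOVM.1 hσ0, Complex.real_smul, ← Complex.ofReal_mul]
    congr 1
    rcases eq_or_ne (prob N σ x) 0 with h0 | h0
    · rw [h0, hrσ x h0, zero_div, zero_mul]
    · exact div_mul_cancel₀ _ h0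
  rw [postState, trace_sum]
  simp only [h1]
  rw [← Complex.ofReal_sum, hr1, Complex.ofReal_one]

/-- Identifies the second reference distribution in `klSum_chain` and `fidSum_chain` with the
outcomes of an actual stabilizer mixture. -/
theorem prob_postState (h : IsLocalMeas U N) (hUA : Disjoint U A) (σ : Op (V → Fin q)) (r : X → ℝ)
    (y : Fin m) : prob M (postState N σ A r) y =
      ∑ x, r x / prob N σ x * prob (joint N M) σ (x, y) := by
  simp only [prob_joint h hUA]
  simp only [prob, postState]
  rw [Finset.mul_sum, trace_sum, Complex.re_sum]
  refine Finset.sum_congr rfl fun x _ => ?_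
  rw [mul_smul_comm, trace_smul, Complex.smul_re, smul_eq_mul]

end Local

/-! ### Product states over a partition. -/

section Product

open Matrix
open scoped ComplexOrder Kronecker

variable {q : ℕ} [NeZero q] {V : Type*} [Fintype V] [DecidableEq V] {n : ℕ} {A : Fin n → Finset V}
  {ρ : ∀ i, Op (A i → Fin q)}

omit [Fintype V] in
theorem exists_tensorState_eq_lift (hA : Pairwise fun i j => Disjoint (A i) (A j))
    (ρ : ∀ i, Op (A i → Fin q)) (k : Fin n) :
    ∃ R, tensorState A ρ = lift (A k) (ρ k ⊗ₖ R) := by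
  refine ⟨Matrix.of fun z z' => ∏ i ∈ Finset.univ.erase k,
    ρ i (fun v => glue (A k) (0, z) v) (fun v => glue (A k) (0, z') v), ext_glue (A k) fun p p' => ?_⟩
  rw [lift_glue, kroneckerMap_apply, tensorState, of_apply, of_apply,
    ← Finset.mul_prod_erase _ _ (Finset.mem_univ k)]
  have h1 : ∀ p : (A k → Fin q) × ({v // v ∉ A k} → Fin q),
      (fun v : A k => glue (A k) p v) = p.1 := fun p => by
    ext1 v
    exact glue_apply_mem p v
  have h2 : ∀ i ≠ k, ∀ p : (A k → Fin q) × ({v // v ∉ A k} → Fin q),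
      (fun v : A i => glue (A k) p v) = fun v : A i => glue (A k) (0, p.2) v := fun i hi p => by
    ext1 v
    have hv : (v : V) ∉ A k := Finset.disjoint_left.1 (hA hi) v.2
    exact (glue_apply_notMem p ⟨v, hv⟩).trans (glue_apply_notMem (0, p.2) ⟨v, hv⟩).symm
  rw [h1, h1]
  congr 1
  refine Finset.prod_congr rfl fun i hi => ?_
  rw [h2 i (Finset.ne_of_mem_erase hi) p, h2 i (Finset.ne_of_mem_erase hi) p']

theorem prob_joint_tensorState (hA : Pairwise fun i j => Disjoint (A i) (A j))
    (hρ : ∀ i, IsState (ρ i)) {X : Type*} [Fintype X] {U : Finset V} {N : X → Op (V → Fin q)}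
    (hN : IsLocalMeas U N) {k : Fin n} (hU : Disjoint U (A k)) {m : ℕ}
    {M : Fin m → Op (A k → Fin q)} (hM : IsStabMeas M) (x : X) (y : Fin m) :
    prob (joint N M) (tensorState A ρ) (x, y) =
      prob N (tensorState A ρ) x * prob M (ρ k) y := by
  obtain ⟨R, hR⟩ := exists_tensorState_eq_lift hA ρ k
  obtain ⟨K, hK⟩ := hN.exists_coembed hU x
  have h1 : (N x * tensorState A ρ).trace = (K * R).trace := by
    rw [hK, hR, coembed, lift_mul, trace_lift, ← mul_kronecker_mul, trace_kronecker, one_mul,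
      (hρ k).2, one_mul]
  have h2 : (joint N M (x, y) * tensorState A ρ).trace =
      (M y * ρ k).trace * (K * R).trace := by
    rw [joint, hK, hR, coembed_mul_embed, lift_mul, trace_lift, ← mul_kronecker_mul,
      trace_kronecker]
  rw [prob, h2, ← ofReal_prob hM.isPOVM.1 (hρ k).1, Complex.re_ofReal_mul, ← h1, mul_comm]
  rfl

-- Positivity is the Schur product theorem, the tensor product being an entrywise product of
-- pulled-back matrices. The trace factorizes because disjointness and covering make global
-- configurations the same as families of local ones.
omit [NeZero q] in
theorem isState_tensorState (hA : Pairwise fun i j => Disjoint (A i) (A j))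
    (hcov : ∀ v, ∃ i, v ∈ A i) (hρ : ∀ i, IsState (ρ i)) : IsState (tensorState A ρ) := by
  constructor
  · have : ∀ s : Finset (Fin n), (Matrix.of fun x y : V → Fin q =>
        ∏ i ∈ s, ρ i (fun v => x v) (fun v => y v)).PosSemidef := fun s => by
      classical
      induction s using Finset.induction_on with
      | empty =>
        convert posSemidef_vecMulVec_self_star (fun _ : V → Fin q => (1 : ℂ)) using 1
        ext x y
        simp [vecMulVec_apply]
      | insert k s hk ih =>
        simp only [Finset.prod_insert hk]
        exact ((hρ k).1.submatrix fun (x : V → Fin q) (v : A k) => x v).hadamard ih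
    exact this Finset.univ
  · have hbij : Function.Bijective
        (fun (x : V → Fin q) (i : Fin n) (v : A i) => x v) := by
      constructor
      · intro x y h
        ext1 v
        obtain ⟨i, hi⟩ := hcov v
        exact congrFun (congrFun h i) ⟨v, hi⟩
      · intro f
        choose g hg using hcov
        refine ⟨fun v => f (g v) ⟨v, hg v⟩, ?_⟩
        ext1 i
        ext1 ⟨v, hv⟩
        have : g v = i := by
          by_contra h
          exact Finset.disjoint_left.1 (hA h) (hg v) hv
        subst this
        rfl
    have h1 : (tensorState A ρ).trace =
        ∑ f : ∀ i, A i → Fin q, ∏ i, ρ i (f i) (f i) := by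
      rw [← hbij.sum_comp]
      rfl
    rw [h1, ← Fintype.piFinset_univ, ← Finset.prod_univ_sum (fun _ => Finset.univ) fun i z => ρ i z z]
    exact Finset.prod_eq_one fun i _ => (hρ i).2

end Product

/-! ### Joining local measurements one subsystem at a time. -/

section Induction

open Matrix
open scoped ComplexOrder

variable {q : ℕ} [NeZero q] {V : Type*} [Fintype V] [DecidableEq V] {n : ℕ} {A : Fin n → Finset V}

/-- The measurement of each new subsystem may depend on `τ`, so it is chosen only after the earlier
ones have determined the relevant post-measurement mixture. The reals `c i` stand for values
strictly below the local quantities, so that no optimum has to be attained. -/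
theorem exists_isLocalMeas_sum_le_klSum (hA : Pairwise fun i j => Disjoint (A i) (A j))
    {ρ σ : Op (V → Fin q)} (hρ : IsState ρ) (hσ : σ ∈ stabMix q V)
    (hker : ∀ v, σ *ᵥ v = 0 → ρ *ᵥ v = 0) {c : Fin n → ℝ}
    (hc : ∀ i, ∀ τ ∈ stabMix q (A i), ∃ (m : ℕ) (M : Fin m → Op (A i → Fin q)), IsStabMeas M ∧
      (c i : EReal) < relEntropy (measure M (reduced ρ (A i))) (measure M τ))
    (s : Finset (Fin n)) : ∃ (X : Type) (_ : Fintype X) (N : X → Op (V → Fin q)),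
      IsLocalMeas (s.biUnion A) N ∧ ∑ i ∈ s, c i ≤ klSum (prob N ρ) (prob N σ) := by
  have hσ' := isState_of_mem_stabMix hσ
  classical
  induction s using Finset.induction_on with
  | empty =>
    refine ⟨Unit, inferInstance, _, isLocalMeas_trivial, le_of_eq ?_⟩
    simp [klSum, prob, hρ.2, hσ'.2]
  | insert k s hk ih =>
    obtain ⟨X, _, N, hN, hle⟩ := ih
    have hU : Disjoint (s.biUnion A) (A k) := (Finset.disjoint_biUnion_left _ _ _).2 fun i hi =>
      hA fun h => hk (h ▸ hi)
    have hsupp := prob_eq_zero hN.isPOVM.1 hσ'.1 hker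
    have hp1 : ∀ x, 0 ≤ prob N ρ x := prob_nonneg hN.isPOVM.1 hρ.1
    have hq1 : ∀ x, 0 ≤ prob N σ x := prob_nonneg hN.isPOVM.1 hσ'.1
    -- Conditionals of `σ` weighted by the outcome probabilities of `ρ`, as `klSum_chain` demands.
    have hτ : postState N σ (A k) (prob N ρ) ∈ stabMix q (A k) :=
      postState_mem_stabMix hN hU hσ hp1 (by rw [sum_prob hN.2, hρ.2, Complex.one_re]) hsupp
    obtain ⟨m, M, hM, hlt⟩ := hc k _ hτ
    have hJ := hN.joint hU hM
    have hp : ∀ z, 0 ≤ prob (joint N M) ρ z := prob_nonneg hJ.isPOVM.1 hρ.1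
    have hq : ∀ z, 0 ≤ prob (joint N M) σ z := prob_nonneg hJ.isPOVM.1 hσ'.1
    have hsuppJ := prob_eq_zero hJ.isPOVM.1 hσ'.1 hker
    refine ⟨X × Fin m, inferInstance, joint N M, ?_, ?_⟩
    · rwa [Finset.biUnion_insert, Finset.union_comm]
    have hchain := klSum_chain hp hq hsuppJ (fun x => (sum_prob_joint_right hM ρ x).symm)
      (fun x => (sum_prob_joint_right hM σ x).symm)
    simp only [sum_prob_joint_left hN, ← prob_postState hN hU] at hchain
    rw [measure_eq_diagonal hM (hρ.reduced _).1,
      measure_eq_diagonal hM (isState_of_mem_stabMix hτ).1, relEntropy_diagonal,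
      EReal.coe_lt_coe_iff] at hlt
    · rw [Finset.sum_insert hk]
      linarith
    · intro y hy
      rw [prob_postState hN hU, Finset.sum_eq_zero_iff_of_nonneg fun x _ =>
        mul_nonneg (div_nonneg (hp1 x) (hq1 x)) (hq _)] at hy
      rw [← sum_prob_joint_left hN]
      refine Finset.sum_eq_zero fun x _ => ?_
      rcases mul_eq_zero.1 (hy x (Finset.mem_univ x)) with h | h
      · have h0 : prob N ρ x = 0 := (div_eq_zero_iff.1 h).elim id (hsupp x)
        rw [← sum_prob_joint_right hM, Finset.sum_eq_zero_iff_of_nonneg fun y _ => hp _] at h0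
        exact h0 y (Finset.mem_univ y)
      · exact hsuppJ _ h

theorem exists_isLocalMeas_fidSum_le_prod (hA : Pairwise fun i j => Disjoint (A i) (A j))
    {ρ : ∀ i, Op (A i → Fin q)} (hρ : ∀ i, IsState (ρ i)) (hT : IsState (tensorState A ρ))
    {σ : Op (V → Fin q)} (hσ : σ ∈ stabMix q V) {c : Fin n → ℝ}
    (hc : ∀ i, ∀ τ ∈ stabMix q (A i), ∃ (m : ℕ) (M : Fin m → Op (A i → Fin q)), IsStabMeas M ∧
      fidelity (measure M (ρ i)) (measure M τ) < c i)
    (s : Finset (Fin n)) : ∃ (X : Type) (_ : Fintype X) (N : X → Op (V → Fin q)),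
      IsLocalMeas (s.biUnion A) N ∧
        fidSum (prob N (tensorState A ρ)) (prob N σ) ≤ ∏ i ∈ s, c i := by
  have hσ' := isState_of_mem_stabMix hσ
  classical
  induction s using Finset.induction_on with
  | empty =>
    refine ⟨Unit, inferInstance, _, isLocalMeas_trivial, le_of_eq ?_⟩
    simp [fidSum, prob, hT.2, hσ'.2]
  | insert k s hk ih =>
    obtain ⟨X, _, N, hN, hle⟩ := ih
    have hU : Disjoint (s.biUnion A) (A k) := (Finset.disjoint_biUnion_left _ _ _).2 fun i hi =>
      hA fun h => hk (h ▸ hi)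
    set p1 := prob N (tensorState A ρ) with hp1_def
    set F := fidSum p1 (prob N σ) with hF
    have hp1 : ∀ x, 0 ≤ p1 x := prob_nonneg hN.isPOVM.1 hT.1
    have hF0 : 0 ≤ F := fidSum_nonneg _ _
    -- With zero fidelity so far the weights are undefined; any mixture serves, since the bound is
    -- then trivial.
    obtain ⟨τ, hτ, hτr⟩ : ∃ τ ∈ stabMix q (A k), F ≠ 0 →
        τ = postState N σ (A k) fun x => √(p1 x) * √(prob N σ x) / F := by
      by_cases h0 : F = 0
      · obtain ⟨τ, hτ⟩ := stabMix_nonempty (q := q) (V := A k)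
        exact ⟨τ, hτ, fun h => absurd h0 h⟩
      · refine ⟨_, postState_mem_stabMix hN hU hσ (fun x => by positivity) ?_ fun x hx => ?_,
          fun _ => rfl⟩
        · rw [← Finset.sum_div]
          exact div_self h0
        · rw [hx, Real.sqrt_zero, mul_zero, zero_div]
    obtain ⟨m, M, hM, hlt⟩ := hc k τ hτ
    have hJ := hN.joint hU hM
    refine ⟨X × Fin m, inferInstance, joint N M, ?_, ?_⟩
    · rwa [Finset.biUnion_insert, Finset.union_comm]
    have hchain := fidSum_chain (p2 := prob M (ρ k)) hp1 (prob_nonneg hJ.isPOVM.1 hσ'.1)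
      (fun x => (sum_prob_joint_right hM σ x).symm)
    rw [← hF] at hchain
    have hprod : prob (joint N M) (tensorState A ρ) = fun z => p1 z.1 * prob M (ρ k) z.2 := by
      ext1 ⟨x, y⟩
      exact prob_joint_tensorState hA hρ hN hU hM x y
    rw [measure_eq_diagonal hM (hρ k).1, measure_eq_diagonal hM (isState_of_mem_stabMix hτ).1,
      fidelity_diagonal] at hlt
    have hck : 0 ≤ c k := (fidSum_nonneg _ _).trans hlt.le
    rw [Finset.prod_insert hk, hprod]
    refine hchain.trans ?_
    rcases eq_or_ne F 0 with h0 | h0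
    · rw [h0, zero_mul]
      exact mul_nonneg hck (hF0.trans hle)
    · rw [hτr h0] at hlt
      rw [mul_comm (c k)]
      refine mul_le_mul hle ?_ (fidSum_nonneg _ _) (hF0.trans hle)
      simp only [← prob_postState hN hU]
      exact hlt.le

end Induction

/-! ### Quantitative local bounds from distance to stabilizer mixtures. -/

section Bounds

open Matrix
open scoped ComplexOrder

variable {q : ℕ} [NeZero q] {V : Type*} [Fintype V] [DecidableEq V]

-- A failure of absolute continuity makes the entropy `⊤`, so a real lower bound need only be shown
-- on supports.
omit [NeZero q] in
theorem le_relEntropy_diagonal {X : Type*} [Fintype X] [DecidableEq X] {p q : X → ℝ} {r : ℝ}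
    (h : (∀ x, q x = 0 → p x = 0) → r ≤ klSum p q) :
    (r : EReal) ≤ relEntropy (diagonal fun x => (p x : ℂ)) (diagonal fun x => (q x : ℂ)) := by
  by_cases hpq : ∀ x, q x = 0 → p x = 0
  · rw [relEntropy_diagonal hpq]
    exact EReal.coe_le_coe_iff.2 (h hpq)
  · rw [relEntropy, if_neg]
    · exact le_top
    · push Not at hpq
      obtain ⟨x, hx, hpx⟩ := hpq
      intro h'
      have h1 := congrFun (h' (Pi.single x 1) (by ext y; by_cases hy : y = x <;>
        simp [mulVec_diagonal, hy, hx])) x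
      simp [mulVec_diagonal] at h1
      exact hpx h1

theorem FarFromStab.exists_isStabMeas {ρ : Op (V → Fin q)} (hρ : IsState ρ) {ε : ℝ} (hε : 0 ≤ ε)
    (h : FarFromStab ε ρ) {D : ℕ} (hD : q ^ Fintype.card V ≤ D) {τ : Op (V → Fin q)}
    (hτ : τ ∈ stabMix q V) : ∃ M : Fin q → Op (V → Fin q), IsStabMeas M ∧
      ε ^ 2 / (D : ℝ) ^ 2 ≤ (∑ k, |prob M ρ k - prob M τ k|) ^ 2 := by
  obtain ⟨M, hM, hle⟩ := exists_isStabMeas_traceNorm_le hρ.1 (isState_of_mem_stabMix hτ).1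
  have hD' : (q : ℝ) ^ Fintype.card V ≤ D := by exact_mod_cast hD
  have hD0 : (0 : ℝ) < D := lt_of_lt_of_le (pow_pos (Nat.cast_pos.2 (Nat.pos_of_neZero q)) _) hD'
  refine ⟨M, hM, ?_⟩
  rw [← div_pow]
  refine pow_le_pow_left₀ (by positivity) ?_ 2
  rw [div_le_iff₀' hD0]
  exact ((h τ hτ).trans hle).trans
    (mul_le_mul_of_nonneg_right hD' (Finset.sum_nonneg fun k _ => abs_nonneg _))

theorem FarFromStab.le_relEntMagicSM {ρ : Op (V → Fin q)} (hρ : IsState ρ) {ε : ℝ} (hε : 0 ≤ ε)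
    (h : FarFromStab ε ρ) {D : ℕ} (hD : q ^ Fintype.card V ≤ D) :
    ((ε ^ 2 / (2 * (D : ℝ) ^ 2) : ℝ) : EReal) ≤ relEntMagicSM ρ := by
  refine le_iInf₂ fun τ hτ => ?_
  obtain ⟨M, hM, hle⟩ := h.exists_isStabMeas hρ hε hD hτ
  have hτ' := isState_of_mem_stabMix hτ
  refine le_trans ?_ (le_iSup_of_le q (le_iSup₂_of_le M hM le_rfl))
  rw [measure_eq_diagonal hM hρ.1, measure_eq_diagonal hM hτ'.1]
  refine le_relEntropy_diagonal fun hsupp => le_trans ?_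
    (pinsker (prob_nonneg hM.isPOVM.1 hρ.1) (prob_nonneg hM.isPOVM.1 hτ'.1)
      (by rw [sum_prob hM.2, hρ.2, Complex.one_re]) (by rw [sum_prob hM.2, hτ'.2, Complex.one_re])
      hsupp)
  rw [mul_comm, ← div_div]
  gcongr

/-- The case `ε = 0` of the distance bound. -/
theorem relEntMagicSM_nonneg {ρ : Op (V → Fin q)} (hρ : IsState ρ) : 0 ≤ relEntMagicSM ρ := by
  have := FarFromStab.le_relEntMagicSM hρ le_rfl (fun τ _ => traceNorm_nonneg _) le_rfl
  simpa using this

theorem bddBelow_fidelity_measure (ρ τ : Op (V → Fin q)) :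
    BddBelow {x | ∃ (m : ℕ) (M : Fin m → Op (V → Fin q)), IsStabMeas M ∧
      x = fidelity (measure M ρ) (measure M τ)} := by
  refine ⟨0, ?_⟩
  rintro _ ⟨m, M, -, rfl⟩
  exact traceNorm_nonneg _

theorem fidelitySM_nonneg (ρ τ : Op (V → Fin q)) : 0 ≤ fidelitySM ρ τ := by
  refine Real.sInf_nonneg ?_
  rintro _ ⟨m, M, -, rfl⟩
  exact traceNorm_nonneg _

theorem FarFromStab.fidelitySM_sq_le {ρ : Op (V → Fin q)} (hρ : IsState ρ) {ε : ℝ} (hε : 0 ≤ ε)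
    (h : FarFromStab ε ρ) {D : ℕ} (hD : q ^ Fintype.card V ≤ D) {τ : Op (V → Fin q)}
    (hτ : τ ∈ stabMix q V) : fidelitySM ρ τ ^ 2 ≤ 1 - ε ^ 2 / (4 * (D : ℝ) ^ 2) := by
  obtain ⟨M, hM, hle⟩ := h.exists_isStabMeas hρ hε hD hτ
  have hτ' := isState_of_mem_stabMix hτ
  have h1 : fidelitySM ρ τ ≤ fidSum (prob M ρ) (prob M τ) := by
    rw [← fidelity_diagonal, ← measure_eq_diagonal hM hρ.1, ← measure_eq_diagonal hM hτ'.1]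
    exact csInf_le (bddBelow_fidelity_measure ρ τ) ⟨q, M, hM, rfl⟩
  have h2 := sq_sum_abs_sub_le_fidSum (prob_nonneg hM.isPOVM.1 hρ.1) (prob_nonneg hM.isPOVM.1 hτ'.1)
    (by rw [sum_prob hM.2, hρ.2, Complex.one_re]) (by rw [sum_prob hM.2, hτ'.2, Complex.one_re])
  have h3 := pow_le_pow_left₀ (fidelitySM_nonneg ρ τ) h1 2
  have h4 : ε ^ 2 / (4 * (D : ℝ) ^ 2) = ε ^ 2 / (D : ℝ) ^ 2 / 4 := by rw [mul_comm, div_div]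
  linarith

theorem fidelitySM_le_one {ρ : Op (V → Fin q)} (hρ : IsState ρ) {τ : Op (V → Fin q)}
    (hτ : τ ∈ stabMix q V) : fidelitySM ρ τ ≤ 1 := by
  have := FarFromStab.fidelitySM_sq_le hρ le_rfl (fun τ _ => traceNorm_nonneg _) le_rfl hτ
  exact (sq_le_one_iff₀ (fidelitySM_nonneg ρ τ)).1 (by simpa using this)

theorem stabFidelitySM_nonneg (ρ : Op (V → Fin q)) : 0 ≤ stabFidelitySM ρ := by
  refine Real.sSup_nonneg ?_
  rintro _ ⟨τ, -, rfl⟩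
  exact fidelitySM_nonneg ρ τ

theorem fidelitySM_le_stabFidelitySM {ρ : Op (V → Fin q)} (hρ : IsState ρ) {τ : Op (V → Fin q)}
    (hτ : τ ∈ stabMix q V) : fidelitySM ρ τ ≤ stabFidelitySM ρ := by
  refine le_csSup ⟨1, ?_⟩ ⟨τ, hτ, rfl⟩
  rintro _ ⟨τ, hτ, rfl⟩
  exact fidelitySM_le_one hρ hτ

theorem FarFromStab.stabFidelitySM_sq_le {ρ : Op (V → Fin q)} (hρ : IsState ρ) {ε : ℝ}
    (hε : 0 ≤ ε) (h : FarFromStab ε ρ) {D : ℕ} (hD : q ^ Fintype.card V ≤ D) :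
    stabFidelitySM ρ ^ 2 ≤ 1 - ε ^ 2 / (4 * (D : ℝ) ^ 2) := by
  obtain ⟨τ, hτ⟩ := stabMix_nonempty (q := q) (V := V)
  have h0 : 0 ≤ 1 - ε ^ 2 / (4 * (D : ℝ) ^ 2) :=
    (sq_nonneg _).trans (h.fidelitySM_sq_le hρ hε hD hτ)
  rw [← Real.le_sqrt (stabFidelitySM_nonneg ρ) h0]
  refine Real.sSup_le ?_ (Real.sqrt_nonneg _)
  rintro _ ⟨τ, hτ, rfl⟩
  exact Real.le_sqrt_of_sq_le (h.fidelitySM_sq_le hρ hε hD hτ)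

theorem fidelity_nonneg {ι : Type*} [Fintype ι] [DecidableEq ι] (ρ σ : Op ι) : 0 ≤ fidelity ρ σ :=
  traceNorm_nonneg _

/-- The left side is the squared Hilbert-Schmidt norm of `√ρ √σ`. This keeps the fidelity with the
maximally mixed state away from 0. -/
theorem trace_mul_le_fidelity_sq {ι : Type*} [Fintype ι] [DecidableEq ι] {ρ σ : Op ι}
    (hρ : ρ.PosSemidef) (hσ : σ.PosSemidef) : (ρ * σ).trace.re ≤ fidelity ρ σ ^ 2 := by
  refine le_trans (le_of_eq ?_) (trace_le_traceNorm_sq _)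
  rw [conjTranspose_mul, isHermitian_cfc hρ.1, isHermitian_cfc hσ.1, mul_assoc,
    ← mul_assoc (cfc Real.sqrt ρ), cfc_sqrt_mul_self hρ, trace_mul_comm (cfc Real.sqrt σ), mul_assoc,
    cfc_sqrt_mul_self hσ]

theorem coe_sum_ereal {ι : Type*} (s : Finset ι) (f : ι → ℝ) :
    ((∑ i ∈ s, f i : ℝ) : EReal) = ∑ i ∈ s, (f i : EReal) := by
  classical
  induction s using Finset.induction_on with
  | empty => simp
  | insert k s hk ih => rw [Finset.sum_insert hk, Finset.sum_insert hk, EReal.coe_add, ih]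

theorem sum_coe_le_of_forall_lt {ι : Type*} [Fintype ι] {f : ι → EReal} {r : ℝ} (h0 : ∀ i, 0 ≤ f i)
    (h : ∀ c : ι → ℝ, (∀ i, (c i : EReal) < f i) → ∑ i, c i ≤ r) : ∑ i, f i ≤ (r : EReal) := by
  classical
  have htop : ∀ i, f i ≠ ⊤ := fun i hi => by
    -- An infinite term admits any real below it; this value outweighs the `-1` in every other slot
    -- and would exceed `r`.
    have h1 := h (Function.update (fun _ => -1) i (r + Fintype.card ι + 1)) fun j => by
      rcases eq_or_ne j i with rfl | hj
      · rw [Function.update_self, hi]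
        exact EReal.coe_lt_top _
      · rw [Function.update_of_ne hj]
        exact lt_of_lt_of_le (by exact_mod_cast neg_one_lt_zero) (h0 j)
    rw [Finset.sum_update_of_mem (Finset.mem_univ i), Finset.sum_const, nsmul_eq_mul] at h1
    have h2 : ((Finset.univ \ {i}).card : ℝ) ≤ Fintype.card ι := by
      exact_mod_cast Finset.card_le_univ _
    linarith
  have hbot : ∀ i, f i ≠ ⊥ := fun i hi => by
    have := h0 i
    rw [hi] at this
    simp at this
  lift f to ι → ℝ using fun i => ⟨htop i, hbot i⟩
  rw [← coe_sum_ereal Finset.univ f, EReal.coe_le_coe_iff]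
  refine le_of_forall_pos_le_add fun ε hε => ?_
  have h1 := h (fun i => f i - ε / (Fintype.card ι + 1)) fun i =>
    EReal.coe_lt_coe_iff.2 (sub_lt_self _ (by positivity))
  rw [Finset.sum_sub_distrib, Finset.sum_const, nsmul_eq_mul, Finset.card_univ] at h1
  have h2 : (Fintype.card ι : ℝ) * (ε / (Fintype.card ι + 1)) ≤ ε := by
    rw [← mul_div_assoc, div_le_iff₀ (by positivity)]
    nlinarith
  linarith

end Bounds

/-! ### Assembly of the superadditivity and multiplicativity bounds. -/

section Main

open Matrix
open scoped ComplexOrder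

variable {q : ℕ} [NeZero q] {V : Type*} [Fintype V] [DecidableEq V] {n : ℕ} {A : Fin n → Finset V}

theorem sum_relEntMagicSM_le (hA : Pairwise fun i j => Disjoint (A i) (A j)) {ρ : Op (V → Fin q)}
    (hρ : IsState ρ) : ∑ i, relEntMagicSM (reduced ρ (A i)) ≤ relEntMagic ρ := by
  refine le_iInf₂ fun σ hσ => ?_
  by_cases hker : ∀ v, σ *ᵥ v = 0 → ρ *ᵥ v = 0
  · rw [relEntropy, if_pos hker]
    refine sum_coe_le_of_forall_lt (fun i => relEntMagicSM_nonneg (hρ.reduced _)) fun c hc => ?_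
    obtain ⟨X, _, N, hN, hle⟩ := exists_isLocalMeas_sum_le_klSum hA hρ hσ hker (c := c)
      (fun i τ hτ => by
        have h1 := lt_of_lt_of_le (hc i) (iInf₂_le τ hτ)
        simp only [relEntropySM, lt_iSup_iff] at h1
        obtain ⟨m, M, hM, hlt⟩ := h1
        exact ⟨m, M, hM, hlt⟩) Finset.univ
    exact hle.trans (klSum_prob_le hN.isPOVM hρ.1 (isState_of_mem_stabMix hσ).1 hker)
  · rw [relEntropy, if_neg hker]
    exact le_top

theorem fidelity_tensorState_le (hA : Pairwise fun i j => Disjoint (A i) (A j))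
    {ρ : ∀ i, Op (A i → Fin q)} (hρ : ∀ i, IsState (ρ i)) (hT : IsState (tensorState A ρ))
    {σ : Op (V → Fin q)} (hσ : σ ∈ stabMix q V) :
    fidelity (tensorState A ρ) σ ≤ ∏ i, stabFidelitySM (ρ i) := by
  -- The slack `δ` provides a measurement strictly below the bound without attaining the infimum; it
  -- tends to 0 at the end.
  have hδ : ∀ δ ∈ Set.Ioi (0 : ℝ),
      fidelity (tensorState A ρ) σ ≤ ∏ i, (stabFidelitySM (ρ i) + δ) := fun δ hδ => by
    obtain ⟨X, _, N, hN, hle⟩ := exists_isLocalMeas_fidSum_le_prod hA hρ hT hσ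
      (c := fun i => stabFidelitySM (ρ i) + δ) (fun i τ hτ => by
        have h1 : fidelitySM (ρ i) τ < stabFidelitySM (ρ i) + δ :=
          lt_of_le_of_lt (fidelitySM_le_stabFidelitySM (hρ i) hτ) (lt_add_of_pos_right _ hδ)
        obtain ⟨M, hM, -⟩ := exists_isStabMeas_traceNorm_le (hρ i).1 (isState_of_mem_stabMix hτ).1
        obtain ⟨_, ⟨m, M, hM, rfl⟩, hlt⟩ := exists_lt_of_csInf_lt
          (s := {x | ∃ (m : ℕ) (M : Fin m → Op (A i → Fin q)), IsStabMeas M ∧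
            x = fidelity (measure M (ρ i)) (measure M τ)}) ⟨_, q, M, hM, rfl⟩ h1
        exact ⟨m, M, hM, hlt⟩) Finset.univ
    exact (fidelity_le_fidSum hN.isPOVM hT.1 (isState_of_mem_stabMix hσ).1).trans hle
  have hlim : Filter.Tendsto (fun δ : ℝ => ∏ i, (stabFidelitySM (ρ i) + δ))
      (nhdsWithin 0 (Set.Ioi 0)) (nhds (∏ i, stabFidelitySM (ρ i))) := by
    have : Continuous fun δ : ℝ => ∏ i, (stabFidelitySM (ρ i) + δ) := by fun_prop
    simpa using (this.tendsto 0).mono_left nhdsWithin_le_nhds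
  exact ge_of_tendsto hlim (Filter.eventually_of_mem self_mem_nhdsWithin hδ)

theorem stabFidelity_tensorState_le (hA : Pairwise fun i j => Disjoint (A i) (A j))
    {ρ : ∀ i, Op (A i → Fin q)} (hρ : ∀ i, IsState (ρ i)) (hT : IsState (tensorState A ρ)) :
    stabFidelity (tensorState A ρ) ≤ ∏ i, stabFidelitySM (ρ i) := by
  refine Real.sSup_le ?_ (Finset.prod_nonneg fun i _ => stabFidelitySM_nonneg _)
  rintro _ ⟨σ, hσ, rfl⟩
  exact fidelity_tensorState_le hA hρ hT hσ

theorem le_logStabFidelity_tensorState (hA : Pairwise fun i j => Disjoint (A i) (A j))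
    {ρ : ∀ i, Op (A i → Fin q)} (hρ : ∀ i, IsState (ρ i)) (hT : IsState (tensorState A ρ))
    {r : ℝ} (hr : ∀ i, stabFidelitySM (ρ i) ^ 2 ≤ r) :
    (n : ℝ) * Real.log r⁻¹ ≤ logStabFidelity (tensorState A ρ) := by
  have hle : ∀ σ ∈ stabMix q V, fidelity (tensorState A ρ) σ ^ 2 ≤ r ^ n := fun σ hσ => by
    refine (pow_le_pow_left₀ (fidelity_nonneg _ _) (fidelity_tensorState_le hA hρ hT hσ) 2).trans ?_
    rw [← Finset.prod_pow]
    refine (Finset.prod_le_prod (fun i _ => sq_nonneg _) fun i _ => hr i).trans (le_of_eq ?_)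
    rw [Finset.prod_const, Finset.card_univ, Fintype.card_fin]
  have hsup : sSup {x | ∃ σ ∈ stabMix q V, x = fidelity (tensorState A ρ) σ ^ 2} ≤ r ^ n := by
    refine csSup_le ⟨_, _, maximallyMixed_mem_stabMix, rfl⟩ ?_
    rintro _ ⟨σ, hσ, rfl⟩
    exact hle σ hσ
  -- Needed because `Real.log 0 = 0`; the maximally mixed state has squared fidelity at least `q ^
  -- (-|V|)` with any state.
  have hpos : 0 < sSup {x | ∃ σ ∈ stabMix q V, x = fidelity (tensorState A ρ) σ ^ 2} := by
    have hq : (0 : ℝ) < ((q : ℝ) ^ Fintype.card V)⁻¹ :=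
      inv_pos.2 (pow_pos (Nat.cast_pos.2 (Nat.pos_of_neZero q)) _)
    refine lt_of_lt_of_le ?_ (le_csSup ⟨r ^ n, ?_⟩ ⟨_, maximallyMixed_mem_stabMix, rfl⟩)
    · refine lt_of_lt_of_le hq (le_trans (le_of_eq ?_) (trace_mul_le_fidelity_sq hT.1
        (isState_of_mem_stabMix maximallyMixed_mem_stabMix).1))
      rw [mul_smul_comm, mul_one, trace_smul, hT.2, Complex.smul_re, Complex.one_re, smul_eq_mul,
        mul_one]
    · rintro _ ⟨σ, hσ, rfl⟩
      exact hle σ hσ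
  rw [logStabFidelity, Real.log_inv, mul_neg, neg_le_neg_iff, ← Real.log_pow]
  exact Real.log_le_log hpos hsup

end Main
end Magic

end

theorem mainTheorem10 {V : Type*} [Fintype V] [DecidableEq V] (q : ℕ) [NeZero q]
    (n : ℕ) (A : Fin n → Finset V) (hA : Pairwise fun i j => Disjoint (A i) (A j)) :
    -- arbitrary states
    (∀ ρ : Magic.Op (V → Fin q), Magic.IsState ρ →
      (∑ i, Magic.relEntMagicSM (Magic.reduced ρ (A i)) ≤ Magic.relEntMagic ρ) ∧
      (∀ (D : ℕ) (ε : ℝ), (∀ i, q ^ (A i).card ≤ D) → 0 ≤ ε →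
        (∀ i, Magic.FarFromStab ε (Magic.reduced ρ (A i))) →
        (((n : ℝ) * ε ^ 2 / (2 * (D : ℝ) ^ 2) : ℝ) : EReal) ≤ Magic.relEntMagic ρ)) ∧
    -- product states
    ((∀ v, ∃ i, v ∈ A i) →
      ∀ ρ : ∀ i, Magic.Op (A i → Fin q), (∀ i, Magic.IsState (ρ i)) →
        (Magic.stabFidelity (Magic.tensorState A ρ) ≤ ∏ i, Magic.stabFidelitySM (ρ i)) ∧
        (∀ (D : ℕ) (ε : ℝ), (∀ i, q ^ (A i).card ≤ D) → 0 ≤ ε →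
          (∀ i, Magic.FarFromStab ε (ρ i)) →
          (n : ℝ) * Real.log (1 - ε ^ 2 / (4 * (D : ℝ) ^ 2))⁻¹
            ≤ Magic.logStabFidelity (Magic.tensorState A ρ))) := by
  refine ⟨fun ρ hρ => ⟨Magic.sum_relEntMagicSM_le hA hρ, fun D ε hD hε h => ?_⟩,
    fun hcov ρ hρ => ?_⟩
  · refine le_trans ?_ (Magic.sum_relEntMagicSM_le hA hρ)
    have : (n : ℝ) * ε ^ 2 / (2 * (D : ℝ) ^ 2) = ∑ _i : Fin n, ε ^ 2 / (2 * (D : ℝ) ^ 2) := by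
      rw [Finset.sum_const, Finset.card_univ, Fintype.card_fin, nsmul_eq_mul, mul_div_assoc]
    rw [this, Magic.coe_sum_ereal]
    exact Finset.sum_le_sum fun i _ =>
      (h i).le_relEntMagicSM (hρ.reduced _) hε (by rw [Fintype.card_coe]; exact hD i)
  · have hT := Magic.isState_tensorState hA hcov hρ
    exact ⟨Magic.stabFidelity_tensorState_le hA hρ hT, fun D ε hD hε h =>
      Magic.le_logStabFidelity_tensorState hA hρ hT fun i =>
        (h i).stabFidelitySM_sq_le (hρ i) hε (by rw [Fintype.card_coe]; exact hD i)⟩
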